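/- Let $\Xi=\mathbb R^n\times\mathbb R^n$ with points $X=(x,\xi)$, $Y=(y,\eta)$, symplectic form $\sigma(X,Y)=y\cdot\xi-x\cdot\eta$ and measure $dX=(2\pi)^{-n}dx\,d\xi$; put $\langle f,g\rangle=\int_\Xi fg\,dX$ (also for the duality of $\mathcal S'$ and $\mathcal S$, on $\Xi$ and on $\Xi\times\Xi$), $\widehat f(Y)=\int_\Xi e^{-i\sigma(Y,Z)}f(Z)\,dZ$ and $\mathfrak e_X(Z)=e^{i\sigma(X,Z)}$. Let $\#$ be a bilinear, separately continuous composition law on $\mathcal S(\Xi)$ such that: (A) $\#$ is associative, $\overline{f\#g}=\overline g\#\overline f$, and $\int_\Xi f\#g\,dX=\int_\Xi fg\,dX$ for $f,g\in\mathcal S(\Xi)$; (B) $\mathcal S(\Xi)\#\mathcal S'(\Xi)\#\mathcal S(\Xi)\subset\mathcal S(\Xi)$, where for $T\in\mathcal S'(\Xi)$, $g,k\in\mathcal S(\Xi)$ one sets $\langle T\#g,k\rangle=\langle T,g\#k\rangle$ and $\langle g\#T,k\rangle=\langle T,k\#g\rangle$; (C) $\int_\Xi\langle\Theta_Z(f),g\rangle\,dZ=\int_\Xi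 f\,dX\int_\Xi g\,dX$ for $f,g\in\mathcal S(\Xi)$, where $\langle\Theta_Z(f),g\rangle=\langle \mathfrak e_{-Z},f\#\mathfrak e_Z\#g\rangle$. Let $\mathbf N$ be the continuous linear map of $\mathcal S'(\Xi\times\Xi)$ determined by $\langle\mathbf N(f_1\otimes f_2),g_1\otimes g_2\rangle=\langle\widehat g_1\#f_1,\widehat g_2\#f_2\rangle$ for $f_i,g_i\in\mathcal S(\Xi)$, let $\mathbf M(F)=\mathbf N(F)\circ C$ with $C(X,Y)=(-X,X-Y)$ (so $[\mathbf M(f\otimes g)](X,Y)=\langle\mathfrak e_{-X}\#f,\mathfrak e_{X-Y}\#g\rangle$ for $f,g\in\mathcal S(\Xi)$), and for $h\in\mathcal S(\Xi)$ let $\mathbf M_h(f)=\mathbf M(f\otimes h)$, $f\in\mathcal S'(\Xi)$. For a subspace $\mathfrak L\subset\mathcal S'(\Xi\times\Xi)$ put $\mathfrak L^{\mathbf M}_h=\{f\in\mathcal S'(\Xi):\mathbf M_h(f)\in\mathfrak L\}$. Let $\mathcal S'_\#(\Xi)=\{T\in\mathcal S'(\Xi): T\#\mathcal S(\Xi)\subset\mathcal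 S(\Xi),\ \mathcal S(\Xi)\#T\subset\mathcal S(\Xi)\}$, with the product $\langle S\#T,k\rangle=\langle S,T\#k\rangle$. Let $\mathcal S'_\diamond(\Xi\times\Xi)$ be the algebra obtained in the same way from the crossed product $(F\diamond G)(X,Y)=\int_\Xi F(X,Z)\,G(X-Z,Y-Z)\,dZ$ on $\mathcal S(\Xi\times\Xi)$, where the extension to distributions uses the duality $\langle\!\langle F,G\rangle\!\rangle'=\int_\Xi\int_\Xi F(X,X-Y)\,G(Y,Y-X)\,dX\,dY$. A subalgebra $\mathfrak K$ of a unital algebra $\mathfrak L$ is called inverse-closed in $\mathfrak L$ if $F\in\mathfrak K$, $G\in\mathfrak L$ and $FG=GF=1_{\mathfrak L}$ imply $G\in\mathfrak K$. It is called spectrally invariant in $\mathfrak L$ if moreover $1_{\mathfrak L}\in\mathfrak K$. Let $\mathfrak K\subset\mathfrak L\subset\mathcal S'_\diamond(\Xi\times\Xi)$ be subalgebras such that $\mathfrak L$ is unital and $\mathfrak K$ is spectrally invariant in $\mathfrak L$. Let $0\neq h\in\mathcal S(\Xi)$ satisfy $h\#h=h$, and assume that each of $\mathfrak K^{\mathbf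 M}_h$ and $\mathfrak L^{\mathbf M}_h$ has a unit. Then $\mathfrak K^{\mathbf M}_h\subset\mathfrak L^{\mathbf M}_h$ are subalgebras of $\mathcal S'_\#(\Xi)$ and $\mathfrak K^{\mathbf M}_h$ is inverse-closed in $\mathfrak L^{\mathbf M}_h$. In particular, if $\mathfrak K^{\mathbf M}_h$ contains the unit of $\mathfrak L^{\mathbf M}_h$, then $\mathfrak K^{\mathbf M}_h$ is spectrally invariant in $\mathfrak L^{\mathbf M}_h$. -/

import Mathlib

open MeasureTheory SchwartzMap
open scoped ContDiff FourierTransform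

namespace PhaseSpace

theorem continuous_finset_sup_seminorm {E V : Type} [NormedAddCommGroup E] [NormedSpace ℝ E]
    [NormedAddCommGroup V] [NormedSpace ℝ V] (s : Finset (ℕ × ℕ)) :
    Continuous (s.sup (schwartzSeminormFamily ℝ E V) : Seminorm ℝ 𝓢(E, V)) := by
  classical
  induction s using Finset.induction_on with
  | empty => exact continuous_const
  | insert a s _ ihs =>
    rw [Finset.sup_insert, Seminorm.coe_sup]
    exact ((schwartz_withSeminorms ℝ E V).continuous_seminorm a).sup ihs

section PartialIntegral
variable {E F : Type} [NormedAddCommGroup E] [NormedSpace ℝ E]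
  [NormedAddCommGroup F] [NormedSpace ℝ F]

theorem norm_partial_le {V : Type} [NormedAddCommGroup V] [NormedSpace ℝ V] (k N : ℕ)
    (G : 𝓢(E × F, V)) (x : E) (y : F) :
    ‖x‖ ^ k * ‖G (x, y)‖ ≤ (1 + ‖y‖) ^ (-(N : ℝ)) * (2 ^ (k + N) *
      (Finset.Iic (k + N, 0)).sup (schwartzSeminormFamily ℝ (E × F) V) G) := by
  have h1 := one_add_le_sup_seminorm_apply (𝕜 := ℝ) (m := (k + N, 0)) (k := k + N) (n := 0)
    le_rfl le_rfl G (x, y)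
  rw [norm_iteratedFDeriv_zero] at h1
  have hy : (0 : ℝ) < 1 + ‖y‖ := by positivity
  rw [Real.rpow_neg hy.le, Real.rpow_natCast, ← div_eq_inv_mul, le_div_iff₀ (by positivity)]
  refine le_trans ?_ h1
  have hx : ‖x‖ ≤ 1 + ‖(x, y)‖ := (norm_fst_le (x, y)).trans (by linarith [norm_nonneg (x, y)])
  have hy' : 1 + ‖y‖ ≤ 1 + ‖(x, y)‖ := by gcongr; exact norm_snd_le (x, y)
  calc ‖x‖ ^ k * ‖G (x, y)‖ * (1 + ‖y‖) ^ N = ‖x‖ ^ k * (1 + ‖y‖) ^ N * ‖G (x, y)‖ := by ring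
    _ ≤ (1 + ‖(x, y)‖) ^ k * (1 + ‖(x, y)‖) ^ N * ‖G (x, y)‖ := by gcongr
    _ = _ := by rw [pow_add]

variable [MeasurableSpace F] (μ : Measure F) [hμ : μ.HasTemperateGrowth]

theorem norm_integral_partial_le {V : Type} [NormedAddCommGroup V] [NormedSpace ℝ V] (k : ℕ) :
    ∃ (s : Finset (ℕ × ℕ)) (C : ℝ), 0 ≤ C ∧ ∀ (G : 𝓢(E × F, V)) (x : E),
      ‖x‖ ^ k * ‖∫ y, G (x, y) ∂μ‖ ≤ C * s.sup (schwartzSeminormFamily ℝ (E × F) V) G := by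
  rcases hμ.exists_integrable with ⟨N, h⟩
  refine ⟨Finset.Iic (k + N, 0), 2 ^ (k + N) * ∫ y : F, (1 + ‖y‖) ^ (-(N : ℝ)) ∂μ,
    by positivity, fun G x => ?_⟩
  calc ‖x‖ ^ k * ‖∫ y, G (x, y) ∂μ‖ = ‖∫ y, ‖x‖ ^ k • G (x, y) ∂μ‖ := by
        rw [integral_smul, norm_smul, norm_pow, norm_norm]
    _ ≤ ∫ y, (1 + ‖y‖) ^ (-(N : ℝ)) * (2 ^ (k + N) *
          (Finset.Iic (k + N, 0)).sup (schwartzSeminormFamily ℝ (E × F) V) G) ∂μ := by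
        refine norm_integral_le_of_norm_le (h.mul_const _) (.of_forall fun y => ?_)
        rw [norm_smul, norm_pow, norm_norm]
        exact norm_partial_le k N G x y
    _ = _ := by rw [integral_mul_const]; ring

variable [BorelSpace F] [SecondCountableTopology F]

theorem integrable_partial {V : Type} [NormedAddCommGroup V] [NormedSpace ℝ V]
    (G : 𝓢(E × F, V)) (x : E) : Integrable (fun y => G (x, y)) μ := by
  rcases hμ.exists_integrable with ⟨N, h⟩
  refine (h.mul_const (2 ^ (0 + N) *
      (Finset.Iic (0 + N, 0)).sup (schwartzSeminormFamily ℝ (E × F) V) G)).mono' (by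
    have : Continuous fun y => G (x, y) := G.continuous.comp (by fun_prop)
    exact this.aestronglyMeasurable) (.of_forall fun y => ?_)
  simpa using norm_partial_le 0 N G x y

/-- The derivative of a Schwartz function in its first variable. -/
noncomputable def partialFDeriv {V : Type} [NormedAddCommGroup V] [NormedSpace ℝ V] :
    𝓢(E × F, V) →L[ℝ] 𝓢(E × F, E →L[ℝ] V) :=
  (postcompCLM (𝕜 := ℝ) (ContinuousLinearMap.precomp V (ContinuousLinearMap.inl ℝ E F))).comp
    (fderivCLM ℝ (E × F) V)

theorem hasFDerivAt_integral_partial {V : Type} [NormedAddCommGroup V] [NormedSpace ℝ V]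
    (G : 𝓢(E × F, V)) (x₀ : E) :
    HasFDerivAt (fun x => ∫ y, G (x, y) ∂μ) (∫ y, partialFDeriv G (x₀, y) ∂μ) x₀ := by
  rcases hμ.exists_integrable with ⟨N, h⟩
  refine hasFDerivAt_integral_of_dominated_of_fderiv_le (s := Set.univ)
    (F' := fun x y => partialFDeriv G (x, y)) (bound := fun y => (1 + ‖y‖) ^ (-(N : ℝ)) *
      (2 ^ (0 + N) * (Finset.Iic (0 + N, 0)).sup
        (schwartzSeminormFamily ℝ (E × F) (E →L[ℝ] V)) (partialFDeriv G))) Filter.univ_mem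
    (.of_forall fun x => (integrable_partial μ G x).aestronglyMeasurable)
    (integrable_partial μ G x₀) (integrable_partial μ (partialFDeriv G) x₀).aestronglyMeasurable
    (.of_forall fun y x _ => ?_) (h.mul_const _) (.of_forall fun y x _ => ?_)
  · simpa using norm_partial_le 0 N (partialFDeriv G) x y
  · have h1 : HasFDerivAt (fun x : E => (x, y)) (ContinuousLinearMap.inl ℝ E F) x :=
      hasFDerivAt_prodMk_left x y
    exact (G.hasFDerivAt (x, y)).comp x h1

theorem contDiff_integral_partial (n : ℕ) {V : Type} [NormedAddCommGroup V] [NormedSpace ℝ V]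
    (G : 𝓢(E × F, V)) : ContDiff ℝ n (fun x => ∫ y, G (x, y) ∂μ) := by
  induction n generalizing V with
  | zero =>
    exact contDiff_zero.2 (continuous_iff_continuousAt.2 fun x =>
      (hasFDerivAt_integral_partial μ G x).continuousAt)
  | succ n ih =>
    exact_mod_cast contDiff_succ_iff_hasFDerivAt.2
      ⟨_, ih (partialFDeriv G), hasFDerivAt_integral_partial μ G⟩

theorem norm_iteratedFDeriv_integral_partial_le (k n : ℕ) {V : Type} [NormedAddCommGroup V]
    [NormedSpace ℝ V] :
    ∃ (s : Finset (ℕ × ℕ)) (C : ℝ), 0 ≤ C ∧ ∀ (G : 𝓢(E × F, V)) (x : E),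
      ‖x‖ ^ k * ‖iteratedFDeriv ℝ n (fun x => ∫ y, G (x, y) ∂μ) x‖ ≤
        C * s.sup (schwartzSeminormFamily ℝ (E × F) V) G := by
  induction n generalizing V with
  | zero => simpa using norm_integral_partial_le μ k
  | succ n ih =>
    obtain ⟨s, C, hC, h⟩ := ih (V := E →L[ℝ] V)
    obtain ⟨t, D, -, hD⟩ := Seminorm.bound_of_continuous (schwartz_withSeminorms ℝ (E × F) V)
      ((s.sup (schwartzSeminormFamily ℝ (E × F) (E →L[ℝ] V))).comp
        (partialFDeriv (E := E) (F := F) (V := V)).toLinearMap) (by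
        have : Continuous (s.sup (schwartzSeminormFamily ℝ (E × F) (E →L[ℝ] V)) :
            Seminorm ℝ 𝓢(E × F, E →L[ℝ] V)) :=
          continuous_finset_sup_seminorm s
        exact this.comp (partialFDeriv (E := E) (F := F) (V := V)).continuous)
    refine ⟨t, C * D, by positivity, fun G x => ?_⟩
    have e : fderiv ℝ (fun x => ∫ y, G (x, y) ∂μ) = fun x => ∫ y, partialFDeriv G (x, y) ∂μ :=
      funext fun x => (hasFDerivAt_integral_partial μ G x).fderiv
    rw [← norm_iteratedFDeriv_fderiv, e, mul_assoc]
    exact (h _ x).trans (mul_le_mul_of_nonneg_left (hD G) hC)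

/-- Integration over the second variable, `G ↦ (x ↦ ∫ G(x, y) dμ(y))`, on Schwartz functions. -/
noncomputable def partialIntegral : 𝓢(E × F, ℂ) →L[ℂ] 𝓢(E, ℂ) :=
  mkCLM (fun G x => ∫ y, G (x, y) ∂μ)
    (fun G H x => integral_add (integrable_partial μ G x) (integrable_partial μ H x))
    (fun a G x => integral_const_mul a _)
    (fun G => contDiff_infty.2 fun n => contDiff_integral_partial μ n G)
    (fun n => by
      obtain ⟨s, C, hC, h⟩ := norm_iteratedFDeriv_integral_partial_le μ n.1 n.2 (E := E) (F := F)
        (V := ℂ)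
      refine ⟨s, C, hC, fun G x => (h G x).trans_eq ?_⟩
      simp only [Seminorm.finset_sup_apply]
      rfl)

@[simp] theorem partialIntegral_apply (G : 𝓢(E × F, ℂ)) (x : E) :
    partialIntegral μ G x = ∫ y, G (x, y) ∂μ := rfl

end PartialIntegral

section Tensor
variable {E F : Type} [NormedAddCommGroup E] [NormedSpace ℝ E]
  [NormedAddCommGroup F] [NormedSpace ℝ F]

theorem norm_iteratedFDeriv_comp_clm_le {D : Type} [NormedAddCommGroup D] [NormedSpace ℝ D]
    (L : D →L[ℝ] E) (hL : ‖L‖ ≤ 1) (f : 𝓢(E, ℂ)) (i : ℕ) (x : D) :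
    ‖iteratedFDeriv ℝ i (fun x => f (L x)) x‖ ≤ ‖iteratedFDeriv ℝ i f (L x)‖ := by
  have := L.iteratedFDeriv_comp_right (f.smooth ⊤) x (i := i) (mod_cast le_top)
  rw [show (fun x => f (L x)) = f ∘ L from rfl, this]
  refine (ContinuousMultilinearMap.norm_compContinuousLinearMap_le _ _).trans ?_
  refine mul_le_of_le_one_right (norm_nonneg _) ?_
  simpa using pow_le_one₀ (norm_nonneg _) hL

/-- The tensor product `(x, y) ↦ f x * g y` of two Schwartz functions. -/
noncomputable def schwartzTensor (f : 𝓢(E, ℂ)) : 𝓢(F, ℂ) →L[ℂ] 𝓢(E × F, ℂ) :=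
  mkCLM (fun g p => f p.1 * g p.2)
    (fun g h p => by simp [mul_add]) (fun a g p => by simp [mul_left_comm])
    (fun g => ((f.smooth ⊤).comp contDiff_fst).mul ((g.smooth ⊤).comp contDiff_snd)) <| by
  rintro ⟨k, n⟩
  refine ⟨Finset.Iic (k, n), ∑ i ∈ Finset.range (n + 1), (n.choose i : ℝ) *
    (SchwartzMap.seminorm ℝ k i f + SchwartzMap.seminorm ℝ 0 i f) * 2 ^ k, by positivity,
    fun g p => ?_⟩
  rw [Finset.sum_mul]
  refine (mul_le_mul_of_nonneg_left (norm_iteratedFDeriv_mul_le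
    (N := ∞) ((f.smooth ⊤).comp contDiff_fst) ((g.smooth ⊤).comp contDiff_snd) p
    (mod_cast le_top)) (by positivity)).trans ?_
  rw [Finset.mul_sum]
  refine Finset.sum_le_sum fun i hi => ?_
  have h1 := norm_iteratedFDeriv_comp_clm_le (ContinuousLinearMap.fst ℝ E F)
    (ContinuousLinearMap.norm_fst_le ℝ E F) f i p
  have h2 := norm_iteratedFDeriv_comp_clm_le (ContinuousLinearMap.snd ℝ E F)
    (ContinuousLinearMap.norm_snd_le ℝ E F) g (n - i) p
  have hg := one_add_le_sup_seminorm_apply (𝕜 := ℂ) (m := (k, n)) (k := k) (n := n - i) le_rfl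
    (Nat.sub_le n i) g p.2
  set S := (Finset.Iic (k, n)).sup (fun m => SchwartzMap.seminorm ℂ m.1 m.2) g
  have hf1 := f.le_seminorm ℝ k i p.1
  have hf0 := f.norm_iteratedFDeriv_le_seminorm ℝ i p.1
  have hp : ‖p‖ ^ k ≤ ‖p.1‖ ^ k + ‖p.2‖ ^ k := by
    rw [Prod.norm_def]
    rcases max_choice ‖p.1‖ ‖p.2‖ with h | h <;> rw [h] <;> simp
  have hg1 : ‖p.2‖ ^ k * ‖iteratedFDeriv ℝ (n - i) g p.2‖ ≤ 2 ^ k * S :=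
    le_trans (by gcongr; linarith [norm_nonneg p.2]) hg
  have hg0 : ‖iteratedFDeriv ℝ (n - i) g p.2‖ ≤ 2 ^ k * S :=
    le_trans (le_mul_of_one_le_left (norm_nonneg _)
      (one_le_pow₀ (by linarith [norm_nonneg p.2]))) hg
  have hS : 0 ≤ 2 ^ k * S := (norm_nonneg _).trans hg0
  calc ‖p‖ ^ k * ((n.choose i : ℝ) * ‖iteratedFDeriv ℝ i (fun p : E × F => f p.1) p‖ *
        ‖iteratedFDeriv ℝ (n - i) (fun p : E × F => g p.2) p‖)
      ≤ (‖p.1‖ ^ k + ‖p.2‖ ^ k) * ((n.choose i : ℝ) * ‖iteratedFDeriv ℝ i f p.1‖ *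
        ‖iteratedFDeriv ℝ (n - i) g p.2‖) := by gcongr; exacts [h1, h2]
    _ = (n.choose i : ℝ) * ((‖p.1‖ ^ k * ‖iteratedFDeriv ℝ i f p.1‖) *
        ‖iteratedFDeriv ℝ (n - i) g p.2‖ + ‖iteratedFDeriv ℝ i f p.1‖ *
          (‖p.2‖ ^ k * ‖iteratedFDeriv ℝ (n - i) g p.2‖)) := by ring
    _ ≤ (n.choose i : ℝ) * (SchwartzMap.seminorm ℝ k i f * (2 ^ k * S) +
          SchwartzMap.seminorm ℝ 0 i f * (2 ^ k * S)) := by gcongr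
    _ = (n.choose i : ℝ) * (SchwartzMap.seminorm ℝ k i f + SchwartzMap.seminorm ℝ 0 i f) * 2 ^ k *
          S := by ring

@[simp] theorem schwartzTensor_apply (f : 𝓢(E, ℂ)) (g : 𝓢(F, ℂ)) (p : E × F) :
    schwartzTensor f g p = f p.1 * g p.2 := rfl
end Tensor

section Products
variable {E : Type} [NormedAddCommGroup E] [NormedSpace ℝ E]

/-- A bilinear, separately continuous composition law on the Schwartz space `𝓢(E)`. -/
structure SchwartzProduct (E : Type) [NormedAddCommGroup E] [NormedSpace ℝ E] where
  mul : 𝓢(E, ℂ) →ₗ[ℂ] 𝓢(E, ℂ) →ₗ[ℂ] 𝓢(E, ℂ)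
  continuous_mul_left : ∀ f, Continuous fun g => mul f g
  continuous_mul_right : ∀ g, Continuous fun f => mul f g

variable (P : SchwartzProduct E)

/-- `g ↦ f · g`. -/
noncomputable def SchwartzProduct.leftCLM (f : 𝓢(E, ℂ)) : 𝓢(E, ℂ) →L[ℂ] 𝓢(E, ℂ) :=
  ⟨P.mul f, P.continuous_mul_left f⟩

/-- `f ↦ f · g`. -/
noncomputable def SchwartzProduct.rightCLM (g : 𝓢(E, ℂ)) : 𝓢(E, ℂ) →L[ℂ] 𝓢(E, ℂ) :=
  ⟨P.mul.flip g, P.continuous_mul_right g⟩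

/-! Extension of a product to tempered distributions by duality. The duality is
`⟪T, h⟫ := T (τ h)`, where `τ` is a continuous linear involution of `𝓢(E)`; for the product on
phase space `τ` is the identity. -/

variable (τ : 𝓢(E, ℂ) →L[ℂ] 𝓢(E, ℂ))

/-- The product `T · g` of a distribution and a test function: `⟪T · g, h⟫ = ⟪T, g · h⟫`. -/
noncomputable def SchwartzProduct.distMul (g : 𝓢(E, ℂ)) : 𝓢'(E, ℂ) →L[ℂ] 𝓢'(E, ℂ) :=
  PointwiseConvergenceCLM.precomp ℂ (τ ∘L P.leftCLM g ∘L τ)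

/-- The product `g · T` of a test function and a distribution: `⟪g · T, h⟫ = ⟪T, h · g⟫`. -/
noncomputable def SchwartzProduct.mulDist (g : 𝓢(E, ℂ)) : 𝓢'(E, ℂ) →L[ℂ] 𝓢'(E, ℂ) :=
  PointwiseConvergenceCLM.precomp ℂ (τ ∘L P.rightCLM g ∘L τ)

theorem SchwartzProduct.distMul_apply (hτ : ∀ h, τ (τ h) = h) (g h : 𝓢(E, ℂ)) (T : 𝓢'(E, ℂ)) :
    P.distMul τ g T (τ h) = T (τ (P.mul g h)) := by
  change T (τ (P.mul g (τ (τ h)))) = _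
  rw [hτ]

theorem SchwartzProduct.mulDist_apply (hτ : ∀ h, τ (τ h) = h) (g h : 𝓢(E, ℂ)) (T : 𝓢'(E, ℂ)) :
    P.mulDist τ g T (τ h) = T (τ (P.mul h g)) := by
  change T (τ (P.mul (τ (τ h)) g)) = _
  rw [hτ]

variable [MeasurableSpace E] [BorelSpace E] [SecondCountableTopology E]
  (μ : Measure E) [μ.HasTemperateGrowth]

/-- The embedding `𝓢(E) ⊂ 𝓢'(E)` given by the measure `μ`: `⟨f, h⟩ = ∫ f h dμ`. -/
noncomputable abbrev embed : 𝓢(E, ℂ) →L[ℂ] 𝓢'(E, ℂ) := toTemperedDistributionCLM E ℂ μ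

theorem embed_apply (f h : 𝓢(E, ℂ)) : embed μ f h = ∫ x, h x * f x ∂μ :=
  toTemperedDistributionCLM_apply_apply μ f h

/-- The Moyal algebra of a product: the distributions `T` with `T · 𝓢 ⊂ 𝓢` and `𝓢 · T ⊂ 𝓢`. -/
noncomputable def SchwartzProduct.moyal : Submodule ℂ 𝓢'(E, ℂ) where
  carrier := {T | ∀ g, (∃ k, embed μ k = P.distMul τ g T) ∧ ∃ k, embed μ k = P.mulDist τ g T}
  zero_mem' g := ⟨⟨0, by simp⟩, ⟨0, by simp⟩⟩
  add_mem' := fun {S T} hS hT g => by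
    obtain ⟨⟨a, ha⟩, ⟨b, hb⟩⟩ := hS g
    obtain ⟨⟨c, hc⟩, ⟨d, hd⟩⟩ := hT g
    exact ⟨⟨a + c, by rw [map_add, map_add, ha, hc]⟩, ⟨b + d, by rw [map_add, map_add, hb, hd]⟩⟩
  smul_mem' := fun z T hT g => by
    obtain ⟨⟨a, ha⟩, ⟨b, hb⟩⟩ := hT g
    exact ⟨⟨z • a, by rw [map_smul, map_smul, ha]⟩, ⟨z • b, by rw [map_smul, map_smul, hb]⟩⟩

/-- The product of two elements of the Moyal algebra: the tempered distribution `S · T` with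
`⟪S · T, h⟫ = ⟪S, T · h⟫` for all test functions `h`, where `k = T · h` is a test function.
(When `T` is in the Moyal algebra, there is at most one such distribution, and the
choice operator picks it.) -/
noncomputable def SchwartzProduct.moyalMul (S T : 𝓢'(E, ℂ)) : 𝓢'(E, ℂ) :=
  Classical.epsilon fun U => ∀ h k, embed μ k = P.distMul τ h T → U (τ h) = S (τ k)

end Products

section Phase

/-- The phase space `Ξ = ℝⁿ × ℝⁿ`: a point `X = (x, ξ)` has the coordinates
`x i = X (Sum.inl i)` and `ξ i = X (Sum.inr i)`. -/
abbrev Phase (n : ℕ) : Type := EuclideanSpace ℝ (Fin n ⊕ Fin n)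

/-- The symplectic form `σ(X, Y) = y · ξ - x · η` for `X = (x, ξ)` and `Y = (y, η)`. -/
noncomputable def sympl {n : ℕ} (X Y : Phase n) : ℝ :=
  ∑ i, (Y (.inl i) * X (.inr i) - X (.inl i) * Y (.inr i))

/-- The Haar measure `dX = (2π)⁻ⁿ dx dξ`, for which the symplectic Fourier transformation is
unitary. -/
noncomputable def phaseMeasure (n : ℕ) : Measure (Phase n) :=
  ENNReal.ofReal ((2 * Real.pi)⁻¹ ^ n) • volume

instance (n : ℕ) : (phaseMeasure n).IsAddHaarMeasure :=
  Measure.IsAddHaarMeasure.smul _ (by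
    rw [Ne, ENNReal.ofReal_eq_zero, not_le]; positivity) ENNReal.ofReal_ne_top

/-- The rotation `Y = (y, η) ↦ (2π)⁻¹ (η, -y)`. -/
noncomputable def symplRotation (n : ℕ) : Phase n ≃L[ℝ] Phase n :=
  LinearEquiv.toContinuousLinearEquiv
    { toFun := fun Y => WithLp.toLp 2 (Sum.elim (fun i => (2 * Real.pi)⁻¹ * Y (.inr i))
        (fun i => -((2 * Real.pi)⁻¹ * Y (.inl i))))
      invFun := fun W => WithLp.toLp 2 (Sum.elim (fun i => -(2 * Real.pi * W (.inr i)))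
        (fun i => 2 * Real.pi * W (.inl i)))
      map_add' := fun X Y => by ext (i | i) <;> simp <;> ring
      map_smul' := fun c X => by ext (i | i) <;> simp <;> ring
      left_inv := fun X => by
        have := Real.pi_ne_zero
        ext (i | i) <;> simp <;> field_simp
      right_inv := fun X => by
        have := Real.pi_ne_zero
        ext (i | i) <;> simp <;> field_simp }

/-- The symplectic Fourier transformation on the Schwartz space of phase space; see
`symplFourier_apply`. -/
noncomputable def symplFourier (n : ℕ) : 𝓢(Phase n, ℂ) →L[ℂ] 𝓢(Phase n, ℂ) :=
  (((2 * Real.pi)⁻¹ ^ n : ℝ) : ℂ) •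
    (compCLMOfContinuousLinearEquiv ℂ (symplRotation n) ∘L fourierTransformCLM ℂ)

theorem symplFourier_apply {n : ℕ} (f : 𝓢(Phase n, ℂ)) (Y : Phase n) :
    symplFourier n f Y = ∫ Z, Complex.exp (-Complex.I * sympl Y Z) * f Z ∂phaseMeasure n := by
  have h1 : symplFourier n f Y =
      (((2 * Real.pi)⁻¹ ^ n : ℝ) : ℂ) * (𝓕 (f : Phase n → ℂ)) (symplRotation n Y) := rfl
  rw [h1, Real.fourier_eq', phaseMeasure, integral_smul_measure,
    ENNReal.toReal_ofReal (by positivity), Complex.real_smul]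
  congr 2
  ext Z
  rw [smul_eq_mul]
  congr 2
  have h2 : 2 * Real.pi * inner ℝ Z (symplRotation n Y) = sympl Y Z := by
    have := Real.pi_ne_zero
    simp only [symplRotation, sympl, LinearEquiv.coe_toContinuousLinearEquiv', LinearEquiv.coe_mk,
      PiLp.inner_apply, Fintype.sum_sum_type, Finset.sum_sub_distrib]
    simp [mul_add, Finset.mul_sum]
    rw [← sub_eq_add_neg, ← Finset.sum_sub_distrib, ← Finset.sum_sub_distrib]
    refine Finset.sum_congr rfl fun i _ => ?_
    field_simp
  rw [← h2]
  push_cast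
  ring

/-- The bounded function `𝐞_X(Z) = exp(i σ(X, Z))` as a tempered distribution; see
`expDist_apply`. -/
noncomputable def expDist {n : ℕ} (X : Phase n) : 𝓢'(Phase n, ℂ) :=
  PointwiseConvergenceCLM.precomp ℂ (symplFourier n) (TemperedDistribution.delta (-X))

theorem expDist_apply {n : ℕ} (X : Phase n) (f : 𝓢(Phase n, ℂ)) :
    expDist X f = ∫ Z, Complex.exp (Complex.I * sympl X Z) * f Z ∂phaseMeasure n := by
  have h1 : expDist X f = symplFourier n f (-X) := rfl
  rw [h1, symplFourier_apply]
  congr 1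
  ext Z
  congr 2
  have : sympl (-X) Z = -sympl X Z := by
    simp only [sympl, PiLp.neg_apply, ← Finset.sum_neg_distrib]
    exact Finset.sum_congr rfl fun i _ => by ring
  rw [this]
  push_cast
  ring

/-- Complex conjugation of Schwartz functions. -/
noncomputable def schwartzConj {n : ℕ} (f : 𝓢(Phase n, ℂ)) : 𝓢(Phase n, ℂ) :=
  postcompCLM (𝕜 := ℝ) (Complex.conjCLE : ℂ →L[ℝ] ℂ) f

/-- The composition law `#` makes `𝓢(Ξ)` a `*`-algebra with the complex conjugation
as involution, and `∫ f # g = ∫ f g`. -/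
structure IsTracialStarProduct {n : ℕ} (P : SchwartzProduct (Phase n)) : Prop where
  mul_assoc : ∀ f g h, P.mul (P.mul f g) h = P.mul f (P.mul g h)
  conj_mul : ∀ f g, schwartzConj (P.mul f g) = P.mul (schwartzConj g) (schwartzConj f)
  integral_mul : ∀ f g, ∫ X, P.mul f g X ∂phaseMeasure n = ∫ X, f X * g X ∂phaseMeasure n

variable {n : ℕ} (P : SchwartzProduct (Phase n))

/-- The inclusion `𝓢 # 𝓢' # 𝓢 ⊂ 𝓢`. -/
def IsSmoothing : Prop :=
  ∀ (f g : 𝓢(Phase n, ℂ)) (T : 𝓢'(Phase n, ℂ)), ∃ k,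
    embed (phaseMeasure n) k = P.distMul (.id ℂ _) g (P.mulDist (.id ℂ _) f T)

/-- The Schwartz function `f # T # g` for test functions `f`, `g` and a distribution `T`
(meaningful when `IsSmoothing` holds). -/
noncomputable def sandwich (f : 𝓢(Phase n, ℂ)) (T : 𝓢'(Phase n, ℂ)) (g : 𝓢(Phase n, ℂ)) :
    𝓢(Phase n, ℂ) :=
  Classical.epsilon fun k =>
    embed (phaseMeasure n) k = P.distMul (.id ℂ _) g (P.mulDist (.id ℂ _) f T)

/-- The functional `Θ_Z(f) = 𝐞_{-Z} # f # 𝐞_Z` for a test function `f`, where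
`⟨S # f # T, h⟩ = ⟨S, f # T # h⟩`. -/
noncomputable def theta (Z : Phase n) (f h : 𝓢(Phase n, ℂ)) : ℂ :=
  expDist (-Z) (sandwich P f (expDist Z) h)

/-- The orthogonality condition `∫ ⟨Θ_Z(f), g⟩ dZ = ∫ f ∫ g`. -/
def HasOrthogonality : Prop :=
  ∀ f g : 𝓢(Phase n, ℂ), ∫ Z, theta P Z f g ∂phaseMeasure n =
    (∫ Z, f Z ∂phaseMeasure n) * ∫ Y, g Y ∂phaseMeasure n

/-! The modulation mapping. -/

/-- The measure `dX dY` on `Ξ × Ξ`. -/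
noncomputable abbrev phaseMeasure₂ (n : ℕ) : Measure (Phase n × Phase n) :=
  (phaseMeasure n).prod (phaseMeasure n)

instance (n : ℕ) : (phaseMeasure₂ n).IsAddHaarMeasure :=
  Measure.prod.instIsAddHaarMeasure _ _

/-- The tensor product `T ⊗ h` of a distribution and a test function,
`⟨T ⊗ h, G⟩ = ⟨T, X ↦ ∫ h(Y) G(X, Y) dY⟩`. -/
noncomputable def distTensor (h : 𝓢(Phase n, ℂ)) :
    𝓢'(Phase n, ℂ) →L[ℂ] 𝓢'(Phase n × Phase n, ℂ) :=
  PointwiseConvergenceCLM.precomp ℂ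
    (partialIntegral (phaseMeasure n) ∘L smulLeftCLM ℂ (fun p : Phase n × Phase n => h p.2))

theorem distTensor_apply (h : 𝓢(Phase n, ℂ)) (T : 𝓢'(Phase n, ℂ))
    (G : 𝓢(Phase n × Phase n, ℂ)) :
    ∃ k : 𝓢(Phase n, ℂ), (∀ X, k X = ∫ Y, h Y * G (X, Y) ∂phaseMeasure n) ∧
      distTensor h T G = T k := by
  refine ⟨_, fun X => ?_, rfl⟩
  have hg : (fun p : Phase n × Phase n => h p.2).HasTemperateGrowth :=
    h.hasTemperateGrowth.comp (ContinuousLinearMap.snd ℝ (Phase n) (Phase n)).hasTemperateGrowth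
  simp [smulLeftCLM_apply_apply hg]

/-- `N` is the continuous linear map of `𝓢'(Ξ × Ξ)` determined by
`⟨N(f₁ ⊗ f₂), g₁ ⊗ g₂⟩ = ⟨ĝ₁ # f₁, ĝ₂ # f₂⟩` for test functions. -/
def IsNMap (N : 𝓢'(Phase n × Phase n, ℂ) →L[ℂ] 𝓢'(Phase n × Phase n, ℂ)) : Prop :=
  ∀ f₁ f₂ g₁ g₂ : 𝓢(Phase n, ℂ),
    N (embed (phaseMeasure₂ n) (schwartzTensor f₁ f₂)) (schwartzTensor g₁ g₂) =
      ∫ X, P.mul (symplFourier n g₁) f₁ X * P.mul (symplFourier n g₂) f₂ X ∂phaseMeasure n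

/-- The map `N` on `𝓢'(Ξ × Ξ)` (it exists when `IsTracialStarProduct` and `IsSmoothing` hold, and is unique because the
elementary tensors span dense subspaces). -/
noncomputable def mapN : 𝓢'(Phase n × Phase n, ℂ) →L[ℂ] 𝓢'(Phase n × Phase n, ℂ) :=
  Classical.epsilon (IsNMap P)

/-- The change of variables `C(X, Y) = (-X, X - Y)`. -/
noncomputable def changeC (n : ℕ) : (Phase n × Phase n) ≃L[ℝ] (Phase n × Phase n) :=
  LinearEquiv.toContinuousLinearEquiv
    { toFun := fun p => (-p.1, p.1 - p.2)
      invFun := fun p => (-p.1, -p.1 - p.2)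
      map_add' := fun p q => by ext1 <;> simp <;> abel
      map_smul' := fun c p => by ext1 <;> simp [smul_sub]
      left_inv := fun p => by ext1 <;> simp
      right_inv := fun p => by ext1 <;> simp }

/-- The map `F ↦ F ∘ C` on `𝓢'(Ξ × Ξ)`: `⟨F ∘ C, G⟩ = ⟨F, G ∘ C⁻¹⟩`, since `C` preserves the
measure. -/
noncomputable def mapC (n : ℕ) :
    𝓢'(Phase n × Phase n, ℂ) →L[ℂ] 𝓢'(Phase n × Phase n, ℂ) :=
  PointwiseConvergenceCLM.precomp ℂ (compCLMOfContinuousLinearEquiv ℂ (changeC n).symm)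

/-- The modulation mapping: for test functions `M(f ⊗ g)` is the function
`(X, Y) ↦ N(f ⊗ g)(-X, X - Y) = ⟨𝐞_{-X} # f, 𝐞_{X - Y} # g⟩`. -/
noncomputable def modulation : 𝓢'(Phase n × Phase n, ℂ) →L[ℂ] 𝓢'(Phase n × Phase n, ℂ) :=
  mapC n ∘L mapN P

/-- The modulation mapping with window `h`, `M_h(f) = M(f ⊗ h)`. -/
noncomputable def modulationWindow (h : 𝓢(Phase n, ℂ)) :
    𝓢'(Phase n, ℂ) →L[ℂ] 𝓢'(Phase n × Phase n, ℂ) :=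
  modulation P ∘L distTensor h

/-- The induced space `𝔏^M_h = M_h⁻¹(𝔏)`. -/
noncomputable def induced (h : 𝓢(Phase n, ℂ)) (L : Submodule ℂ 𝓢'(Phase n × Phase n, ℂ)) :
    Submodule ℂ 𝓢'(Phase n, ℂ) :=
  L.comap (modulationWindow P h).toLinearMap

/-- The Moyal algebra `𝓢'_#(Ξ)`. -/
noncomputable def moyalSharp : Submodule ℂ 𝓢'(Phase n, ℂ) :=
  P.moyal (.id ℂ _) (phaseMeasure n)

/-- The product `#` on `𝓢'_#(Ξ)`. -/
noncomputable def sharpMul : 𝓢'(Phase n, ℂ) → 𝓢'(Phase n, ℂ) → 𝓢'(Phase n, ℂ) :=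
  P.moyalMul (.id ℂ _) (phaseMeasure n)

/-! The crossed product. -/

/-- The linear map `((X, Y), Z) ↦ ((X, Z), (X - Z, Y - Z))`. -/
noncomputable def crossedMap (n : ℕ) :
    ((Phase n × Phase n) × Phase n) →ₗ[ℝ] (Phase n × Phase n) × (Phase n × Phase n) where
  toFun p := ((p.1.1, p.2), (p.1.1 - p.2, p.1.2 - p.2))
  map_add' p q := by ext1 <;> ext1 <;> simp <;> abel
  map_smul' c p := by ext1 <;> ext1 <;> simp [smul_sub]

theorem crossedMap_ker (n : ℕ) : LinearMap.ker (crossedMap n) = ⊥ := by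
  refine LinearMap.ker_eq_bot'.2 fun p hp => ?_
  obtain ⟨⟨x, y⟩, z⟩ := p
  simp only [crossedMap, LinearMap.coe_mk, AddHom.coe_mk, Prod.mk_eq_zero] at hp
  obtain ⟨⟨hx, hz⟩, -, hy⟩ := hp
  simp_all

/-- `K ↦ ((X, Y) ↦ ∫ K((X, Z), (X - Z, Y - Z)) dZ)`. -/
noncomputable def crossedIntegral (n : ℕ) :
    𝓢((Phase n × Phase n) × (Phase n × Phase n), ℂ) →L[ℂ] 𝓢(Phase n × Phase n, ℂ) :=
  partialIntegral (phaseMeasure n) ∘L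
    compCLMOfAntilipschitz ℂ (crossedMap n).toContinuousLinearMap.hasTemperateGrowth
      ((crossedMap n).exists_antilipschitzWith (crossedMap_ker n)).choose_spec.2

/-- The crossed product `(F ⋄ G)(X, Y) = ∫ F(X, Z) G(X - Z, Y - Z) dZ` on `𝓢(Ξ × Ξ)`. -/
noncomputable def diamond (n : ℕ) : SchwartzProduct (Phase n × Phase n) where
  mul := LinearMap.mk₂ ℂ (fun F G => crossedIntegral n (schwartzTensor F G))
    (fun F F' G => by
      rw [← map_add]; congr 1; ext p; simp [add_mul])
    (fun c F G => by
      rw [← map_smul]; congr 1; ext p; simp [mul_assoc])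
    (fun F G G' => by simp) (fun c F G => by simp)
  continuous_mul_left F := ((crossedIntegral n).comp (schwartzTensor F)).continuous
  continuous_mul_right G := by
    have h : Continuous fun F => crossedIntegral n (compCLMOfContinuousLinearEquiv ℂ
        (ContinuousLinearEquiv.prodComm ℝ (Phase n × Phase n) (Phase n × Phase n))
        (schwartzTensor G F)) :=
      (crossedIntegral n).continuous.comp ((ContinuousLinearMap.continuous _).comp
        (schwartzTensor G).continuous)
    convert! h using 2 with F
    simp only [LinearMap.mk₂_apply]
    congr 1
    ext p
    simp [mul_comm]

theorem diamond_apply (F G : 𝓢(Phase n × Phase n, ℂ)) (X Y : Phase n) :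
    (diamond n).mul F G (X, Y) = ∫ Z, F (X, Z) * G (X - Z, Y - Z) ∂phaseMeasure n := rfl

/-- The change of variables `(X, Y) ↦ (X - Y, -Y)`. -/
noncomputable def reflectEquiv (n : ℕ) : (Phase n × Phase n) ≃L[ℝ] (Phase n × Phase n) :=
  LinearEquiv.toContinuousLinearEquiv
    { toFun := fun p => (p.1 - p.2, -p.2)
      invFun := fun p => (p.1 - p.2, -p.2)
      map_add' := fun p q => by ext1 <;> simp <;> abel
      map_smul' := fun c p => by ext1 <;> simp [smul_sub]
      left_inv := fun p => by ext1 <;> simp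
      right_inv := fun p => by ext1 <;> simp }

/-- `(τ G)(X, Y) = G(X - Y, -Y)`. The duality
`⟪F, G⟫' = ∫∫ F(X, X - Y) G(Y, Y - X) dX dY` that goes with the crossed product is
`⟪F, G⟫' = ∫∫ F (τ G)`, by the change of variables `(X, Y) ↦ (X, X - Y)`. -/
noncomputable def reflect (n : ℕ) : 𝓢(Phase n × Phase n, ℂ) →L[ℂ] 𝓢(Phase n × Phase n, ℂ) :=
  compCLMOfContinuousLinearEquiv ℂ (reflectEquiv n)

theorem reflect_apply (F : 𝓢(Phase n × Phase n, ℂ)) (X Y : Phase n) :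
    reflect n F (X, Y) = F (X - Y, -Y) := rfl

theorem reflect_reflect (F : 𝓢(Phase n × Phase n, ℂ)) : reflect n (reflect n F) = F := by
  ext ⟨X, Y⟩
  simp [reflect_apply]

/-- The Moyal algebra `𝓢'_⋄(Ξ × Ξ)`. -/
noncomputable def moyalDiamond (n : ℕ) : Submodule ℂ 𝓢'(Phase n × Phase n, ℂ) :=
  (diamond n).moyal (reflect n) (phaseMeasure₂ n)

/-- The product `⋄` on `𝓢'_⋄(Ξ × Ξ)`. -/
noncomputable def diamondMul (n : ℕ) : 𝓢'(Phase n × Phase n, ℂ) →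
    𝓢'(Phase n × Phase n, ℂ) → 𝓢'(Phase n × Phase n, ℂ) :=
  (diamond n).moyalMul (reflect n) (phaseMeasure₂ n)

end Phase

section Algebras
variable {V : Type} [AddCommGroup V] [Module ℂ V] (mul : V → V → V)

/-- `L` is a subalgebra of the algebra `A` with product `mul`. -/
def IsSubalgebraOf (A L : Submodule ℂ V) : Prop :=
  L ≤ A ∧ ∀ F ∈ L, ∀ G ∈ L, mul F G ∈ L

/-- `e` is the unit of the algebra `L`. -/
def IsUnitOf (L : Submodule ℂ V) (e : V) : Prop :=
  e ∈ L ∧ ∀ F ∈ L, mul e F = F ∧ mul F e = F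

/-- The algebra `L` is unital. -/
def IsUnital (L : Submodule ℂ V) : Prop := ∃ e, IsUnitOf mul L e

/-- Every element of `K` that has an inverse `G` in `L` (with respect to the unit of `L`) has
its inverse in `K`. -/
def IsInverseClosed (K L : Submodule ℂ V) : Prop :=
  ∀ e, IsUnitOf mul L e → ∀ F ∈ K, ∀ G ∈ L, mul F G = e → mul G F = e → G ∈ K

/-- `K` is spectrally invariant in `L`: it is contained in `L`, it contains the unit of `L`, and
the inverse in `L` of an element of `K` belongs to `K`. -/
def IsSpectrallyInvariant (K L : Submodule ℂ V) : Prop :=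
  K ≤ L ∧ (∃ e ∈ K, IsUnitOf mul L e) ∧ IsInverseClosed mul K L

end Algebras

end PhaseSpace

open PhaseSpace

/-! The algebraic core is a corner argument. For an idempotent window `h` the map `M_h` carries `#`
to `⋄`, but the image `p = M_h(e)` of the unit `e` of `𝔏^M_h` is in general only an idempotent of
`𝔏`, different from the unit `u`. Let `F` in `𝔎^M_h` have the inverse `G` in `𝔏^M_h`, and let `e'`
be the unit of `𝔎^M_h`. Then `e' = e' # (F # G) = (e' # F) # G = e`, so `p` and `u - p` lie in `𝔎`.
The elements `M_h(F) + (u - p)` and `M_h(G) + (u - p)` are inverse to each other in `𝔏`, the first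
lies in `𝔎`, hence so does the second, and subtracting `u - p` gives `M_h(G) ∈ 𝔎`
(`diamondMul_add_one_sub`, `isInverseClosed_induced`).

Three facts about `M_h` support this. On test functions `M_h(f) ⋄ M_{h'}(g) = M_{h' # h}(f # g)`, by
Parseval's formula and the exchange rule `⟨S, f # T # g⟩ = ⟨T, g # S # f⟩` (`diamond_window`,
`apply_sandwich`). The orthogonality (C) says that `⟪M_h(f), M_{h'}(f')⟫' = ⟨f, f'⟩⟨h, h'⟩`, so the
transpose of `M_{h'}` inverts `M_h` up to a factor, and `T` is a test function whenever `M_h(T)` is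
one (`embed_window_window`, `exists_embed_of_modulationWindow`). Weak continuity extends the product
formula to one distributional factor, and duality extends it to the Moyal algebras
(`modulationWindow_sharpMul`). Hence the induced spaces are subalgebras of `𝓢'_#(Ξ)`.

The analytic core is that (B), a mere inclusion of sets, provides a Schwartz function `k_{f,g}` on
`Ξ × Ξ` that represents `φ ↦ f # φ # g` (`exists_kernel`). It makes `N` exist and makes `M_h(f)` a
Schwartz function for every test function `f`. The tools are continuous Gabor frames, `φ = ∫ ⟨φ,
b_z⟩ a_z dz` with rapidly decaying coefficients. They take the place of nuclearity, of the closed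
graph theorem and of the kernel theorem, and are combined with Banach–Steinhaus and Baire category
in the Fréchet space `𝓢`. -/

set_option linter.unusedSectionVars false

namespace PhaseSpace

/-! ### Completeness of the Schwartz space. -/

section Completeness
variable {E : Type} [NormedAddCommGroup E] [NormedSpace ℝ E]

/-- The increasing sequence of seminorms that defines the topology of the Schwartz space. -/
noncomputable def schwartzNorm (E : Type) [NormedAddCommGroup E] [NormedSpace ℝ E] (m : ℕ) :
    Seminorm ℂ 𝓢(E, ℂ) :=
  (Finset.Iic (m, m)).sup (schwartzSeminormFamily ℂ E ℂ)

theorem continuous_schwartzNorm (m : ℕ) : Continuous (schwartzNorm E m) := by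
  have : ∀ s : Finset (ℕ × ℕ), Continuous (s.sup (schwartzSeminormFamily ℂ E ℂ) : Seminorm ℂ 𝓢(E, ℂ)) := by
    intro s
    induction s using Finset.induction_on with
    | empty => exact continuous_const
    | insert a s _ ihs =>
      rw [Finset.sup_insert, Seminorm.coe_sup]
      exact ((schwartz_withSeminorms ℂ E ℂ).continuous_seminorm a).sup ihs
  exact this _

theorem schwartzNorm_mono {m m' : ℕ} (h : m ≤ m') : schwartzNorm E m ≤ schwartzNorm E m' :=
  Finset.sup_mono (Finset.Iic_subset_Iic.2 (Prod.mk_le_mk.2 ⟨h, h⟩))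

theorem seminorm_le_schwartzNorm {k n m : ℕ} (hk : k ≤ m) (hn : n ≤ m) (f : 𝓢(E, ℂ)) :
    SchwartzMap.seminorm ℂ k n f ≤ schwartzNorm E m f :=
  Finset.le_sup (f := schwartzSeminormFamily ℂ E ℂ) (b := (k, n))
    (Finset.mem_Iic.2 (Prod.mk_le_mk.2 ⟨hk, hn⟩)) f

theorem exists_le_schwartzNorm (p : Seminorm ℂ 𝓢(E, ℂ)) (hp : Continuous p) :
    ∃ (m : ℕ) (C : ℝ), 0 < C ∧ ∀ f, p f ≤ C * schwartzNorm E m f := by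
  obtain ⟨s, C, hC, h⟩ := Seminorm.bound_of_continuous (schwartz_withSeminorms ℂ E ℂ) p hp
  refine ⟨s.sup (fun i => max i.1 i.2), C, by positivity, fun f => (h f).trans ?_⟩
  have h1 : s.sup (schwartzSeminormFamily ℂ E ℂ) ≤
      schwartzNorm E (s.sup (fun i => max i.1 i.2)) :=
    Finset.sup_mono fun i hi => Finset.mem_Iic.2
      ⟨(le_max_left i.1 i.2).trans (Finset.le_sup (f := fun i : ℕ × ℕ => max i.1 i.2) hi),
        (le_max_right i.1 i.2).trans (Finset.le_sup (f := fun i : ℕ × ℕ => max i.1 i.2) hi)⟩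
  exact mul_le_mul_of_nonneg_left (h1 f) C.2

theorem schwartzNorm_withSeminorms : WithSeminorms (schwartzNorm E) := by
  refine (schwartz_withSeminorms ℂ E ℂ).congr ?_ ?_
  · intro m
    exact ⟨Finset.Iic (m, m), 1, by simp [schwartzNorm]⟩
  · intro i
    refine ⟨{max i.1 i.2}, 1, fun f => ?_⟩
    rw [Finset.sup_singleton, one_smul]
    exact seminorm_le_schwartzNorm (le_max_left i.1 i.2) (le_max_right i.1 i.2) f

/-- Summability of all seminorms permits termwise differentiation. The explicit bound on the
seminorms of the sum controls the remainders in the proof of completeness. -/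
theorem exists_hasSum_schwartz (w : ℕ → 𝓢(E, ℂ))
    (hw : ∀ k n, Summable fun j => SchwartzMap.seminorm ℂ k n (w j)) :
    ∃ F : 𝓢(E, ℂ), (∀ x, HasSum (fun j => w j x) (F x)) ∧
      ∀ k n, SchwartzMap.seminorm ℂ k n F ≤ ∑' j, SchwartzMap.seminorm ℂ k n (w j) := by
  have hsum : ∀ x, Summable fun j => w j x := fun x =>
    Summable.of_norm_bounded (hw 0 0) fun j => norm_le_seminorm ℂ (w j) x
  have hb : ∀ (k j : ℕ) (x : E), (k : ℕ∞) ≤ ∞ → ‖iteratedFDeriv ℝ k (w j) x‖ ≤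
      SchwartzMap.seminorm ℂ 0 k (w j) := fun k j x _ =>
    norm_iteratedFDeriv_le_seminorm ℂ (w j) k x
  have hd : ∀ k n (x : E), ‖x‖ ^ k * ‖iteratedFDeriv ℝ n (fun y => ∑' j, w j y) x‖ ≤
      ∑' j, SchwartzMap.seminorm ℂ k n (w j) := fun k n x => by
    rw [iteratedFDeriv_tsum_apply (N := ⊤) (fun j => (w j).smooth ⊤) (fun k _ => hw 0 k)
      (fun k j x _ => norm_iteratedFDeriv_le_seminorm ℂ (w j) k x) le_top]
    have h2 : Summable fun j => ‖iteratedFDeriv ℝ n (w j) x‖ :=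
      Summable.of_nonneg_of_le (fun _ => norm_nonneg _)
        (fun j => norm_iteratedFDeriv_le_seminorm ℂ (w j) n x) (hw 0 n)
    calc _ ≤ ‖x‖ ^ k * ∑' j, ‖iteratedFDeriv ℝ n (w j) x‖ := by
          gcongr
          exact norm_tsum_le_tsum_norm h2
      _ = ∑' j, ‖x‖ ^ k * ‖iteratedFDeriv ℝ n (w j) x‖ := tsum_mul_left.symm
      _ ≤ _ := (h2.mul_left _).tsum_le_tsum (fun j => le_seminorm ℂ k n (w j) x) (hw k n)
  refine ⟨⟨fun y => ∑' j, w j y, contDiff_tsum (fun j => (w j).smooth ⊤) (fun k _ => hw 0 k)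
      (fun k j x _ => norm_iteratedFDeriv_le_seminorm ℂ (w j) k x),
      fun k n => ⟨_, hd k n⟩⟩, fun x => (hsum x).hasSum, fun k n => ?_⟩
  exact seminorm_le_bound ℂ k n _ (tsum_nonneg fun j => apply_nonneg _ _) (hd k n)

/-- The topology is metrizable, so it is enough to treat sequences with prescribed speed of
convergence. Such a sequence is the sequence of partial sums of a telescoping series whose seminorms
are dominated by a geometric series. -/
instance : CompleteSpace 𝓢(E, ℂ) := by
  have : (uniformity 𝓢(E, ℂ)).IsCountablyGenerated :=
    IsUniformAddGroup.uniformity_countably_generated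
  refine UniformSpace.complete_of_convergent_controlled_sequences
    (fun N => {fg | schwartzNorm E N (fg.2 - fg.1) < (1 / 2) ^ N}) (fun N => ?_) fun u hu => ?_
  · rw [uniformity_eq_comap_nhds_zero 𝓢(E, ℂ)]
    refine ⟨{f | schwartzNorm E N f < (1 / 2) ^ N}, ?_, fun _ h => h⟩
    exact (isOpen_lt (continuous_schwartzNorm N) continuous_const).mem_nhds (by simp)
  -- The `N`-th increment is controlled in the norm of order `N` only, so the estimate of the
  -- seminorm `(k, n)` starts at the index `max k n`.
  have hv : ∀ k n j, SchwartzMap.seminorm ℂ k n (u (j + max k n + 1) - u (j + max k n)) ≤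
      (1 / 2) ^ j := fun k n j => by
    have h1 := hu (j + max k n) (j + max k n) (j + max k n + 1) le_rfl (Nat.le_succ _)
    refine (seminorm_le_schwartzNorm (m := j + max k n) (by omega) (by omega) _).trans
      (h1.le.trans (pow_le_pow_of_le_one (by norm_num) (by norm_num) (by omega)))
  have hs : ∀ k n, Summable fun j => SchwartzMap.seminorm ℂ k n (u (j + 1) - u j) := fun k n => by
    rw [← summable_nat_add_iff (max k n)]
    exact Summable.of_nonneg_of_le (fun _ => apply_nonneg _ _) (hv k n)
      (summable_geometric_of_lt_one (by norm_num) (by norm_num))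
  have ht : ∀ N k n, Summable fun j =>
      SchwartzMap.seminorm ℂ k n (u (j + N + 1) - u (j + N)) := fun N k n =>
    (summable_nat_add_iff (f := fun j => SchwartzMap.seminorm ℂ k n (u (j + 1) - u j)) N).2
      (hs k n)
  choose F hF1 hF2 using fun N => exists_hasSum_schwartz _ (ht N)
  refine ⟨u 0 + F 0, ?_⟩
  -- The distance from the limit to `u N` is the tail of the telescoping series, whose seminorms
  -- tend to zero.
  have e : ∀ N, u 0 + F 0 - u N = F N := fun N => by
    ext x
    have h1 : ∀ N, Filter.Tendsto (fun K => u K x) Filter.atTop (nhds (u N x + F N x)) := by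
      intro N
      have h2 := (hF1 N x).tendsto_sum_nat.const_add (u N x)
      refine (Filter.tendsto_add_atTop_iff_nat N).1 (h2.congr fun K => ?_)
      have h3 := Finset.sum_range_sub (fun j => u (j + N) x) K
      simp only [add_right_comm _ 1 N, zero_add] at h3
      simp only [sub_apply, h3]
      ring
    have h4 := tendsto_nhds_unique (h1 0) (h1 N)
    simp only [sub_apply, add_apply, h4]
    ring
  rw [(schwartz_withSeminorms ℂ E ℂ).tendsto_nhds_atTop]
  rintro ⟨k, n⟩ ε hε
  have h5 := (tendsto_sum_nat_add (fun j => SchwartzMap.seminorm ℂ k n (u (j + 1) - u j)))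
  obtain ⟨N₀, h6⟩ := (Filter.eventually_atTop.1 (h5.eventually (gt_mem_nhds hε)))
  refine ⟨N₀, fun N hN => ?_⟩
  rw [map_sub_rev, e N]
  exact (hF2 N k n).trans_lt (h6 N hN)

end Completeness

/-! ### Weak boundedness and vector-valued integrals in the Schwartz space. -/

section Frechet

/-- A Banach space that completes a space with respect to a seminorm. -/
theorem exists_completion_of_seminorm {X : Type} [AddCommGroup X] [Module ℂ X]
    (q : Seminorm ℂ X) :
    ∃ (Y : Type) (_ : NormedAddCommGroup Y) (_ : NormedSpace ℂ Y) (_ : CompleteSpace Y)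
      (ι : X →ₗ[ℂ] Y), (∀ x, ‖ι x‖ = q x) ∧ DenseRange ι := by
  let _ : SeminormedAddCommGroup X := q.toAddGroupSeminorm.toSeminormedAddCommGroup
  let _ : NormedSpace ℂ X := ⟨fun a b => (map_smul_eq_mul q a b).le⟩
  refine ⟨UniformSpace.Completion X, inferInstance, inferInstance, inferInstance,
    (UniformSpace.Completion.toComplL (𝕜 := ℂ) (E := X)).toLinearMap, fun x => ?_, ?_⟩
  · exact UniformSpace.Completion.norm_coe x
  · exact UniformSpace.Completion.denseRange_coe

/-- Banach–Steinhaus in the bidual of the Banach space that completes `X` for `q`: functionals on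
the completion restrict to `q`-bounded functionals on `X`, and the embedding into the bidual is
isometric. -/
theorem bddAbove_seminorm_of_weakly_bounded {X I : Type} [AddCommGroup X] [Module ℂ X]
    (q : Seminorm ℂ X) (x : I → X)
    (h : ∀ (l : X →ₗ[ℂ] ℂ), (∃ C, ∀ y, ‖l y‖ ≤ C * q y) → BddAbove (Set.range fun i => ‖l (x i)‖)) :
    BddAbove (Set.range fun i => q (x i)) := by
  obtain ⟨Y, _, _, _, ι, h1, -⟩ := exists_completion_of_seminorm q
  obtain ⟨C, hC⟩ := banach_steinhaus (g := fun i => NormedSpace.inclusionInDoubleDual ℂ Y (ι (x i)))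
    fun l => by
      obtain ⟨C, hC⟩ := h (l.toLinearMap ∘ₗ ι) ⟨‖l‖, fun y => by
        rw [← h1]; exact l.le_opNorm _⟩
      exact ⟨C, fun i => hC ⟨i, rfl⟩⟩
  refine ⟨C, ?_⟩
  rintro _ ⟨i, rfl⟩
  have h2 := hC i
  change q (x i) ≤ C
  rw [← h1]
  refine le_trans (le_of_eq ?_) h2
  exact ((NormedSpace.inclusionInDoubleDualLi ℂ (E := Y)).norm_map (ι (x i))).symm

variable {E Z : Type} [NormedAddCommGroup E] [NormedSpace ℝ E]
  [TopologicalSpace Z] [SecondCountableTopology Z] [MeasurableSpace Z] [OpensMeasurableSpace Z]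

/-- Integration in the Schwartz space: a continuous family of Schwartz functions on which all
continuous seminorms are integrable has a weak integral. -/
theorem exists_schwartz_integral (ν : Measure Z) (Φ : Z → 𝓢(E, ℂ)) (hΦ : Continuous Φ)
    (hi : ∀ m, Integrable (fun z => schwartzNorm E m (Φ z)) ν) :
    ∃ I : 𝓢(E, ℂ), (∀ l : 𝓢(E, ℂ) →L[ℂ] ℂ, l I = ∫ z, l (Φ z) ∂ν) ∧
      ∀ m, schwartzNorm E m I ≤ ∫ z, schwartzNorm E m (Φ z) ∂ν := by
  choose Y hY1 hY2 hY3 ι hι hd using fun m => exists_completion_of_seminorm (schwartzNorm E m)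
  have hc : ∀ m, Continuous (ι m) := fun m =>
    (WithSeminorms.continuous_of_isBounded (schwartzNorm_withSeminorms (E := E))
      (norm_withSeminorms ℂ (Y m)) (ι m) (fun _ => ⟨{m}, 1, fun f => by
        simp [hι m f]⟩))
  have hJ : ∀ m, Integrable (fun z => ι m (Φ z)) ν := fun m =>
    (hi m).mono' ((hc m).comp hΦ).aestronglyMeasurable (.of_forall fun z => (hι m _).le)
  -- Each Bochner integral lives only in the Banach completion of level `m`. Schwartz functions
  -- approximate it with error `2⁻ᵐ`. Since the transition maps between the levels are contractions
  -- that respect the integrals, these approximants form a Cauchy sequence in `𝓢`, whose limit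
  -- represents the integral at every level.
  have hn : ∀ m, ∃ I : 𝓢(E, ℂ), ‖ι m I - ∫ z, ι m (Φ z) ∂ν‖ < (1 / 2) ^ m := fun m => by
    obtain ⟨I, h⟩ := (hd m).exists_dist_lt (∫ z, ι m (Φ z) ∂ν)
      (show (0 : ℝ) < (1 / 2) ^ m by positivity)
    exact ⟨I, by rwa [← dist_eq_norm, dist_comm]⟩
  choose I hI using hn
  -- the transition maps
  have ht : ∀ k m, k ≤ m → ∀ f, ‖ι k f - ∫ z, ι k (Φ z) ∂ν‖ ≤ ‖ι m f - ∫ z, ι m (Φ z) ∂ν‖ := by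
    intro k m hkm f
    have hb : ∀ x, ‖ι k x‖ ≤ 1 * ‖ι m x‖ := fun x => by
      rw [hι, hι, one_mul]; exact schwartzNorm_mono hkm x
    set π := (ι k).extendOfNorm (ι m)
    have hπ : ∀ x, π (ι m x) = ι k x := LinearMap.extendOfNorm_eq (hd m) ⟨1, hb⟩
    have h1 : π (∫ z, ι m (Φ z) ∂ν) = ∫ z, ι k (Φ z) ∂ν := by
      rw [← π.integral_comp_comm (hJ m)]
      simp only [hπ]
    rw [← hπ, ← h1, ← map_sub]
    simpa using LinearMap.norm_extendOfNorm_apply_le (hd m) 1 hb (ι m f - ∫ z, ι m (Φ z) ∂ν)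
  have hcau : CauchySeq I := by
    refine ((schwartzNorm_withSeminorms (E := E)).hasBasis_zero_ball.uniformity_of_nhds_zero
      ).cauchySeq_iff.2 ?_
    rintro ⟨s, r⟩ hr
    obtain ⟨N, hN⟩ := exists_pow_lt_of_lt_one (half_pos hr) (show (1 / 2 : ℝ) < 1 by norm_num)
    have hs : s.sup (schwartzNorm E) ≤ schwartzNorm E (s.sup id) :=
      Finset.sup_le fun i hi => schwartzNorm_mono (Finset.le_sup (f := id) hi)
    refine ⟨max N (s.sup id), fun a ha b hb => ?_⟩
    have h1 : ∀ a, max N (s.sup id) ≤ a →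
        ‖ι (s.sup id) (I a) - ∫ z, ι (s.sup id) (Φ z) ∂ν‖ < r / 2 := fun a ha =>
      ((ht _ a ((le_max_right _ _).trans ha) _).trans_lt (hI a)).trans_le
        ((pow_le_pow_of_le_one (by norm_num) (by norm_num)
          ((le_max_left _ _).trans ha)).trans hN.le)
    change I b - I a ∈ (s.sup (schwartzNorm E)).ball 0 r
    rw [Seminorm.mem_ball_zero]
    refine (hs _).trans_lt ?_
    rw [← hι, map_sub]
    calc _ = ‖(ι (s.sup id) (I b) - ∫ z, ι (s.sup id) (Φ z) ∂ν) -
          (ι (s.sup id) (I a) - ∫ z, ι (s.sup id) (Φ z) ∂ν)‖ := by congr 1; abel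
      _ ≤ _ := norm_sub_le _ _
      _ < r / 2 + r / 2 := add_lt_add (h1 b hb) (h1 a ha)
      _ = r := add_halves r
  obtain ⟨I', hI'⟩ := cauchySeq_tendsto_of_complete hcau
  have hlim : ∀ m, ι m I' = ∫ z, ι m (Φ z) ∂ν := fun m => by
    have h1 := ((hc m).tendsto I').comp hI'
    refine tendsto_nhds_unique h1 ?_
    rw [tendsto_iff_norm_sub_tendsto_zero]
    refine squeeze_zero' (.of_forall fun _ => norm_nonneg _) ?_
      (tendsto_pow_atTop_nhds_zero_of_lt_one (r := (1 / 2 : ℝ)) (by norm_num) (by norm_num))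
    filter_upwards [Filter.eventually_ge_atTop m] with j hj
    exact (ht m j hj _).trans (hI j).le
  refine ⟨I', fun l => ?_, fun m => ?_⟩
  -- A continuous functional is bounded by one norm, so it factors through a single completion and
  -- commutes with the Bochner integral there.
  · obtain ⟨m, C, -, h⟩ := exists_le_schwartzNorm ((normSeminorm ℂ ℂ).comp l.toLinearMap)
      (continuous_norm.comp l.continuous)
    have hb : ∀ x, ‖l.toLinearMap x‖ ≤ C * ‖ι m x‖ := fun x => by rw [hι]; exact h x
    have hL : ∀ x, (l.toLinearMap).extendOfNorm (ι m) (ι m x) = l x :=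
      LinearMap.extendOfNorm_eq (hd m) ⟨C, hb⟩
    rw [← hL, hlim, ← ContinuousLinearMap.integral_comp_comm _ (hJ m)]
    simp only [hL]
  · rw [← hι, hlim]
    exact (norm_integral_le_integral_norm _).trans_eq (by simp only [hι])

end Frechet

/-! ### Uniform boundedness and bilinear maps. -/

section Bilinear
variable {E F H : Type} [NormedAddCommGroup E] [NormedSpace ℝ E]
  [NormedAddCommGroup F] [NormedSpace ℝ F] [NormedAddCommGroup H] [NormedSpace ℝ H]

instance : BaireSpace 𝓢(E, ℂ) := by
  have : (uniformity 𝓢(E, ℂ)).IsCountablyGenerated :=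
    IsUniformAddGroup.uniformity_countably_generated
  let _ := UniformSpace.pseudoMetricSpace 𝓢(E, ℂ)
  infer_instance

/-- A functional that is bounded by one of the norms is continuous on `𝓢`, so the Banach space
version applies to each norm separately. -/
theorem bddAbove_schwartzNorm_of_weakly_bounded {I : Type} (x : I → 𝓢(E, ℂ))
    (h : ∀ l : 𝓢(E, ℂ) →L[ℂ] ℂ, BddAbove (Set.range fun i => ‖l (x i)‖)) (m : ℕ) :
    BddAbove (Set.range fun i => schwartzNorm E m (x i)) := by
  refine bddAbove_seminorm_of_weakly_bounded _ x fun l hl => h ⟨l, ?_⟩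
  obtain ⟨C, hC⟩ := hl
  refine WithSeminorms.continuous_normedSpace_rng ℂ schwartzNorm_withSeminorms l
    ⟨{m}, C.toNNReal, fun f => ?_⟩
  simp only [Finset.sup_singleton]
  refine (hC f).trans ?_
  exact mul_le_mul_of_nonneg_right (Real.le_coe_toNNReal C) (apply_nonneg _ _)

/-- Uniform boundedness for families of separately continuous bilinear maps on Schwartz spaces. -/
theorem exists_bound_of_pointwise_bounded {I W : Type} [AddCommGroup W] [Module ℂ W]
    (p : I → Seminorm ℂ W) (B : I → 𝓢(E, ℂ) →ₗ[ℂ] 𝓢(F, ℂ) →ₗ[ℂ] W)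
    (hl : ∀ i f, Continuous fun g => p i (B i f g))
    (hr : ∀ i g, Continuous fun f => p i (B i f g))
    (hB : ∀ f g, BddAbove (Set.range fun i => p i (B i f g))) :
    ∃ (m : ℕ) (C : ℝ), 0 ≤ C ∧ ∀ i f g,
      p i (B i f g) ≤ C * (schwartzNorm E m f * schwartzNorm F m g) := by
  have h1 : ∀ g, ∃ (m : ℕ) (C : ℝ), 0 < C ∧ ∀ i f, p i (B i f g) ≤ C * schwartzNorm E m f := by
    intro g
    have hbdd : BddAbove (Set.range fun i => (p i).comp ((B i).flip g)) :=
      Seminorm.bddAbove_range_iff.2 fun f => hB f g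
    obtain ⟨m, C, hC, h⟩ := exists_le_schwartzNorm (⨆ i, (p i).comp ((B i).flip g)) (by
      have := Seminorm.continuous_iSup (fun i => (p i).comp ((B i).flip g))
        (fun i => hr i g) hbdd
      rwa [← Seminorm.coe_iSup_eq hbdd] at this)
    exact ⟨m, C, hC, fun i f => (le_ciSup hbdd i f).trans (h f)⟩
  -- One natural number serves both as the order of the norm and as the constant, which gives a
  -- countable closed cover for Baire's theorem.
  let A : ℕ → Set 𝓢(F, ℂ) := fun m => {g | ∀ i f, p i (B i f g) ≤ m * schwartzNorm E m f}
  have hA : ∀ m, IsClosed (A m) := fun m => by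
    simp only [A, Set.ofPred_forall]
    exact isClosed_iInter fun i => isClosed_iInter fun f => isClosed_le (hl i f) continuous_const
  have hU : ⋃ m, A m = Set.univ := Set.eq_univ_of_forall fun g => by
    obtain ⟨m, C, hC, h⟩ := h1 g
    refine Set.mem_iUnion.2 ⟨max m ⌈C⌉₊, fun i f => (h i f).trans ?_⟩
    refine mul_le_mul ((Nat.le_ceil C).trans (by simp))
      (schwartzNorm_mono (le_max_left _ _) f) (apply_nonneg _ _) (by positivity)
  obtain ⟨m, g₀, hg₀⟩ := nonempty_interior_of_iUnion_of_closed hA hU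
  have hg₁ : g₀ ∈ A m := interior_subset hg₀
  have h2 : (fun g => g₀ + g) ⁻¹' (A m) ∈ nhds (0 : 𝓢(F, ℂ)) := by
    refine (continuous_const.add continuous_id).continuousAt.preimage_mem_nhds ?_
    simpa using mem_interior_iff_mem_nhds.1 hg₀
  obtain ⟨⟨s, r⟩, hr0, hs⟩ := (schwartzNorm_withSeminorms (E := F)).hasBasis_zero_ball.mem_iff.1 h2
  have hr0 : 0 < r := hr0
  set k := s.sup id
  have hsk : s.sup (schwartzNorm F) ≤ schwartzNorm F k :=
    Finset.sup_le fun i hi => schwartzNorm_mono (Finset.le_sup (f := id) hi)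
  -- The factor `2` comes from writing `g = (g₀ + g) - g₀` with both terms in `A m`.
  have h3 : ∀ g, schwartzNorm F k g < r → ∀ i f, p i (B i f g) ≤
      2 * m * schwartzNorm E m f := fun g hg i f => by
    have h4 : g₀ + g ∈ A m := hs (by
      change g ∈ (s.sup (schwartzNorm F)).ball 0 r
      rw [Seminorm.mem_ball_zero]
      exact (hsk g).trans_lt hg)
    have h5 : B i f g = B i f (g₀ + g) - B i f g₀ := by rw [map_add]; abel
    rw [h5]
    refine (map_sub_le_add _ _ _).trans ?_
    linarith [h4 i f, hg₁ i f]
  have h6 : ∀ g i f, p i (B i f g) ≤ (2 * m / r) * (schwartzNorm E m f * schwartzNorm F k g) := by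
    intro g i f
    -- The norm of `g` is not assumed positive, so `g` is rescaled by `r / t` with a larger `t`,
    -- which then decreases to that norm.
    have h7 : ∀ t, schwartzNorm F k g < t → p i (B i f g) ≤
        (2 * m / r) * (schwartzNorm E m f * t) := by
      intro t ht
      have ht0 : 0 < t := (apply_nonneg _ _).trans_lt ht
      have h8 := h3 (((r / t : ℝ) : ℂ) • g) (by
        rw [map_smul_eq_mul, Complex.norm_real, Real.norm_of_nonneg (by positivity),
          div_mul_eq_mul_div, div_lt_iff₀ ht0]
        exact mul_lt_mul_of_pos_left ht hr0) i f
      rw [map_smul, map_smul_eq_mul, Complex.norm_real, Real.norm_of_nonneg (by positivity),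
        div_mul_eq_mul_div, div_le_iff₀ ht0] at h8
      rw [div_mul_eq_mul_div, le_div_iff₀ hr0]
      linarith
    have h9 : Filter.Tendsto (fun t => (2 * m / r) * (schwartzNorm E m f * t))
        (nhdsWithin (schwartzNorm F k g) (Set.Ioi (schwartzNorm F k g)))
        (nhds ((2 * m / r) * (schwartzNorm E m f * schwartzNorm F k g))) := by
      have : Continuous fun t => (2 * m / r) * (schwartzNorm E m f * t) := by fun_prop
      exact (this.tendsto _).mono_left nhdsWithin_le_nhds
    exact ge_of_tendsto h9 (by filter_upwards [self_mem_nhdsWithin] with t ht using h7 t ht)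
  refine ⟨max m k, 2 * m / r, by positivity, fun i f g => (h6 g i f).trans ?_⟩
  refine mul_le_mul_of_nonneg_left (mul_le_mul (schwartzNorm_mono (le_max_left _ _) f)
    (schwartzNorm_mono (le_max_right _ _) g) (apply_nonneg _ _) (apply_nonneg _ _)) (by positivity)

/-- Bilinear maps of Schwartz spaces that are bounded in the seminorms. -/
def IsJointlyBounded (B : 𝓢(E, ℂ) →ₗ[ℂ] 𝓢(F, ℂ) →ₗ[ℂ] 𝓢(H, ℂ)) : Prop :=
  ∀ m, ∃ (m' : ℕ) (C : ℝ), 0 ≤ C ∧ ∀ f g,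
    schwartzNorm H m (B f g) ≤ C * (schwartzNorm E m' f * schwartzNorm F m' g)

/-- The uniform boundedness theorem for a family with one member, applied to each norm of the
target. -/
theorem isJointlyBounded_of_separately_continuous (B : 𝓢(E, ℂ) →ₗ[ℂ] 𝓢(F, ℂ) →ₗ[ℂ] 𝓢(H, ℂ))
    (hl : ∀ f, Continuous fun g => B f g) (hr : ∀ g, Continuous fun f => B f g) :
    IsJointlyBounded B := fun m => by
  obtain ⟨m', C, hC, h⟩ := exists_bound_of_pointwise_bounded (I := Unit)
    (fun _ => schwartzNorm H m) (fun _ => B) (fun _ f => (continuous_schwartzNorm m).comp (hl f))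
    (fun _ g => (continuous_schwartzNorm m).comp (hr g)) (fun f g =>
      (Set.finite_range _).bddAbove)
  exact ⟨m', C, hC, h ()⟩

theorem IsJointlyBounded.continuous {B : 𝓢(E, ℂ) →ₗ[ℂ] 𝓢(F, ℂ) →ₗ[ℂ] 𝓢(H, ℂ)}
    (hB : IsJointlyBounded B) : Continuous fun p : 𝓢(E, ℂ) × 𝓢(F, ℂ) => B p.1 p.2 := by
  refine continuous_iff_continuousAt.2 fun p₀ => ?_
  refine ((schwartzNorm_withSeminorms (E := H)).tendsto_nhds _ _).2 fun m ε hε => ?_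
  obtain ⟨m', C, hC, h⟩ := hB m
  have hc : Continuous fun p : 𝓢(E, ℂ) × 𝓢(F, ℂ) =>
      C * (schwartzNorm E m' (p.1 - p₀.1) * schwartzNorm F m' (p.2 - p₀.2)) +
      C * (schwartzNorm E m' (p.1 - p₀.1) * schwartzNorm F m' p₀.2) +
      C * (schwartzNorm E m' p₀.1 * schwartzNorm F m' (p.2 - p₀.2)) := by
    have h1 : Continuous (schwartzNorm E m') := continuous_schwartzNorm m'
    have h2 : Continuous (schwartzNorm F m') := continuous_schwartzNorm m'
    fun_prop
  have h0 := hc.tendsto p₀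
  simp only [sub_self, map_zero, mul_zero, zero_mul, add_zero] at h0
  filter_upwards [h0.eventually (gt_mem_nhds hε)] with p hp
  have e : B p.1 p.2 - B p₀.1 p₀.2 = B (p.1 - p₀.1) (p.2 - p₀.2) + B (p.1 - p₀.1) p₀.2 +
      B p₀.1 (p.2 - p₀.2) := by
    simp only [map_sub, LinearMap.sub_apply]; abel
  rw [e]
  refine lt_of_le_of_lt ?_ hp
  exact (map_add_le_add _ _ _).trans (add_le_add ((map_add_le_add _ _ _).trans
    (add_le_add (h _ _) (h _ _))) (h _ _))

theorem exists_bound_of_continuous (L : 𝓢(E, ℂ) →L[ℂ] 𝓢(F, ℂ)) (m : ℕ) :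
    ∃ (m' : ℕ) (C : ℝ), 0 < C ∧ ∀ f, schwartzNorm F m (L f) ≤ C * schwartzNorm E m' f :=
  exists_le_schwartzNorm ((schwartzNorm F m).comp L.toLinearMap)
    ((continuous_schwartzNorm m).comp L.continuous)

theorem exists_bound_of_functional (l : 𝓢(E, ℂ) →L[ℂ] ℂ) :
    ∃ (m : ℕ) (C : ℝ), 0 < C ∧ ∀ f, ‖l f‖ ≤ C * schwartzNorm E m f :=
  exists_le_schwartzNorm ((normSeminorm ℂ ℂ).comp l.toLinearMap)
      (continuous_norm.comp l.continuous)

theorem isJointlyBounded_schwartzTensor :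
    IsJointlyBounded (LinearMap.mk₂ ℂ (fun (f : 𝓢(E, ℂ)) (g : 𝓢(F, ℂ)) => schwartzTensor f g)
      (fun f f' g => by ext p; simp [add_mul]) (fun c f g => by ext p; simp [mul_assoc])
      (fun f g g' => by simp) (fun c f g => by simp)) := by
  refine isJointlyBounded_of_separately_continuous _ (fun f => (schwartzTensor f).continuous)
    fun g => ?_
  have h : Continuous fun f => compCLMOfContinuousLinearEquiv ℂ
        (ContinuousLinearEquiv.prodComm ℝ E F) (schwartzTensor g f) :=
      (ContinuousLinearMap.continuous _).comp (schwartzTensor g).continuous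
  convert! h using 2 with f
  ext p
  simp [mul_comm]

end Bilinear

/-! ### Translations and restrictions of Schwartz functions. -/

section Translation
variable {E F : Type} [NormedAddCommGroup E] [NormedSpace ℝ E]
  [NormedAddCommGroup F] [NormedSpace ℝ F]

theorem schwartzNorm_le {m : ℕ} {f : 𝓢(E, ℂ)} {C : ℝ} (hC : 0 ≤ C)
    (h : ∀ k ≤ m, ∀ n ≤ m, ∀ x, ‖x‖ ^ k * ‖iteratedFDeriv ℝ n f x‖ ≤ C) :
    schwartzNorm E m f ≤ C := by
  refine Seminorm.finset_sup_apply_le hC fun i hi => ?_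
  have hi' := Prod.le_def.1 (Finset.mem_Iic.1 hi)
  exact seminorm_le_bound ℂ i.1 i.2 f hC (h _ hi'.1 _ hi'.2)

theorem one_add_norm_pow_mul_le {m k n : ℕ} (hk : k ≤ m) (hn : n ≤ m) (f : 𝓢(E, ℂ)) (x : E) :
    (1 + ‖x‖) ^ k * ‖iteratedFDeriv ℝ n f x‖ ≤ 2 ^ m * schwartzNorm E m f :=
  one_add_le_sup_seminorm_apply (𝕜 := ℂ) (m := (m, m)) hk hn f x

theorem iteratedFDeriv_compSubConstCLM (q : E) (f : 𝓢(E, ℂ)) (n : ℕ) (x : E) :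
    iteratedFDeriv ℝ n (compSubConstCLM ℂ q f) x = iteratedFDeriv ℝ n f (x - q) := by
  have : (compSubConstCLM ℂ q f : E → ℂ) = fun x => f (x - q) := funext fun x => by simp
  rw [this, iteratedFDeriv_comp_sub]

theorem schwartzNorm_translate_le (m : ℕ) (q : E) (f : 𝓢(E, ℂ)) :
    schwartzNorm E m (compSubConstCLM ℂ q f) ≤ 2 ^ m * (1 + ‖q‖) ^ m * schwartzNorm E m f := by
  refine schwartzNorm_le (by positivity) fun k hk n hn x => ?_
  rw [iteratedFDeriv_compSubConstCLM]
  have h1 := one_add_norm_pow_mul_le hk hn f (x - q)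
  have h2 : ‖x‖ ≤ (1 + ‖q‖) * (1 + ‖x - q‖) := by
    have := norm_add_le (x - q) q
    rw [sub_add_cancel] at this
    nlinarith [norm_nonneg q, norm_nonneg (x - q)]
  calc ‖x‖ ^ k * ‖iteratedFDeriv ℝ n f (x - q)‖
      ≤ ((1 + ‖q‖) * (1 + ‖x - q‖)) ^ k * ‖iteratedFDeriv ℝ n f (x - q)‖ := by gcongr
    _ = (1 + ‖q‖) ^ k * ((1 + ‖x - q‖) ^ k * ‖iteratedFDeriv ℝ n f (x - q)‖) := by
        rw [mul_pow]; ring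
    _ ≤ (1 + ‖q‖) ^ m * (2 ^ m * schwartzNorm E m f) := by
        gcongr
        linarith [norm_nonneg q]
    _ = _ := by ring

/-- The mean value inequality for the derivatives of `f` along the segment from `x` to `x - q`. It
costs one more derivative, hence the order `m + 1`. -/
theorem schwartzNorm_translate_sub_le (m : ℕ) (q : E) (hq : ‖q‖ ≤ 1) (f : 𝓢(E, ℂ)) :
    schwartzNorm E m (compSubConstCLM ℂ q f - f) ≤
      2 ^ m * 2 ^ (m + 1) * schwartzNorm E (m + 1) f * ‖q‖ := by
  refine schwartzNorm_le (by positivity) fun k hk n hn x => ?_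
  have e : iteratedFDeriv ℝ n (⇑(compSubConstCLM ℂ q f - f)) x =
      iteratedFDeriv ℝ n f (x - q) - iteratedFDeriv ℝ n f x := by
    have : (⇑(compSubConstCLM ℂ q f - f) : E → ℂ) = ⇑(compSubConstCLM ℂ q f) - ⇑f := by
      ext; simp
    rw [this, iteratedFDeriv_sub_apply ((compSubConstCLM ℂ q f).smooth n).contDiffAt
      (f.smooth n).contDiffAt, iteratedFDeriv_compSubConstCLM]
  rw [e]
  -- Within distance `1` of `x` the weight at `x` is at most twice the weight at `t`, which produces
  -- the factor `2 ^ m`.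
  have h1 : ∀ t ∈ Metric.closedBall x 1, ‖fderiv ℝ (iteratedFDeriv ℝ n f) t‖ ≤
      (2 ^ m * 2 ^ (m + 1) * schwartzNorm E (m + 1) f) / (1 + ‖x‖) ^ k := fun t ht => by
    rw [norm_fderiv_iteratedFDeriv, le_div_iff₀ (by positivity)]
    have h2 := one_add_norm_pow_mul_le (m := m + 1) (k := k) (n := n + 1) (by omega) (by omega) f t
    have h3 : 1 + ‖x‖ ≤ 2 * (1 + ‖t‖) := by
      have := norm_le_norm_add_norm_sub' x t
      rw [← dist_eq_norm, dist_comm] at this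
      linarith [Metric.mem_closedBall.1 ht, norm_nonneg t]
    calc ‖iteratedFDeriv ℝ (n + 1) f t‖ * (1 + ‖x‖) ^ k
        ≤ ‖iteratedFDeriv ℝ (n + 1) f t‖ * (2 * (1 + ‖t‖)) ^ k := by gcongr
      _ = 2 ^ k * ((1 + ‖t‖) ^ k * ‖iteratedFDeriv ℝ (n + 1) f t‖) := by
          rw [mul_pow]; ring
      _ ≤ 2 ^ m * (2 ^ (m + 1) * schwartzNorm E (m + 1) f) := by
          gcongr
          norm_num
      _ = _ := by ring
  have h4 := (convex_closedBall x 1).norm_image_sub_le_of_norm_fderiv_le (𝕜 := ℝ)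
    (f := iteratedFDeriv ℝ n f) (x := x) (y := x - q)
    (fun t _ => ((f.smooth ⊤).differentiable_iteratedFDeriv (m := n)
      (mod_cast ENat.natCast_lt_top n)).differentiableAt) h1
    (Metric.mem_closedBall_self zero_le_one) (by simpa using hq)
  have h5 : ‖x‖ ^ k ≤ (1 + ‖x‖) ^ k := by gcongr; linarith
  calc _ ≤ (1 + ‖x‖) ^ k * ((2 ^ m * 2 ^ (m + 1) * schwartzNorm E (m + 1) f) / (1 + ‖x‖) ^ k *
        ‖x - q - x‖) := by gcongr
    _ = _ := by
      rw [sub_sub_cancel_left, norm_neg]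
      field_simp

theorem continuous_translate :
    Continuous fun p : E × 𝓢(E, ℂ) => compSubConstCLM ℂ p.1 p.2 := by
  refine continuous_iff_continuousAt.2 fun p₀ => ?_
  refine ((schwartzNorm_withSeminorms (E := E)).tendsto_nhds _ _).2 fun m ε hε => ?_
  have hc : Continuous fun p : E × 𝓢(E, ℂ) =>
      2 ^ m * (1 + ‖p.1‖) ^ m * schwartzNorm E m (p.2 - p₀.2) +
      2 ^ m * 2 ^ (m + 1) * schwartzNorm E (m + 1) (compSubConstCLM ℂ p₀.1 p₀.2) *
        ‖p.1 - p₀.1‖ := by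
    have h1 : Continuous (schwartzNorm E m) := continuous_schwartzNorm m
    fun_prop
  have h0 := hc.tendsto p₀
  simp only [sub_self, map_zero, mul_zero, norm_zero, add_zero] at h0
  have hb : ∀ᶠ p : E × 𝓢(E, ℂ) in nhds p₀, ‖p.1 - p₀.1‖ < 1 := by
    have h1 : Continuous fun p : E × 𝓢(E, ℂ) => ‖p.1 - p₀.1‖ := by fun_prop
    exact (h1.tendsto p₀).eventually (gt_mem_nhds (by simp))
  filter_upwards [h0.eventually (gt_mem_nhds hε), hb] with p hp hq
  -- The first part is small by the locally uniform bound on translations, the second by the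
  -- Lipschitz estimate at the fixed function.
  have e : compSubConstCLM ℂ p.1 p.2 - compSubConstCLM ℂ p₀.1 p₀.2 =
      compSubConstCLM ℂ p.1 (p.2 - p₀.2) + (compSubConstCLM ℂ (p.1 - p₀.1)
        (compSubConstCLM ℂ p₀.1 p₀.2) - compSubConstCLM ℂ p₀.1 p₀.2) := by
    ext x
    simp
  rw [e]
  exact lt_of_le_of_lt ((map_add_le_add _ _ _).trans (add_le_add
    (schwartzNorm_translate_le _ _ _) (schwartzNorm_translate_sub_le _ _ hq.le _))) hp

/-- The restriction `G ↦ G(x, ·)` of a Schwartz function of two variables. -/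
noncomputable def sliceCLM (x : E) : 𝓢(E × F, ℂ) →L[ℂ] 𝓢(F, ℂ) :=
  compCLMOfAntilipschitz (K := 1) ℂ (ContinuousLinearMap.inr ℝ E F).hasTemperateGrowth
    (AntilipschitzWith.of_le_mul_dist fun y z => by simp [Prod.dist_eq]) ∘L
    compSubConstCLM ℂ (-(x, (0 : F)))

@[simp] theorem sliceCLM_apply (x : E) (G : 𝓢(E × F, ℂ)) (y : F) : sliceCLM x G y = G (x, y) := by
  simp [sliceCLM]

theorem schwartzNorm_slice_le (M m : ℕ) (x : E) (G : 𝓢(E × F, ℂ)) :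
    (1 + ‖x‖) ^ M * schwartzNorm F m (sliceCLM x G) ≤
      2 ^ (M + m) * schwartzNorm (E × F) (M + m) G := by
  have hx : 0 < (1 + ‖x‖) ^ M := by positivity
  rw [← le_div_iff₀' hx]
  refine schwartzNorm_le (by positivity) fun k hk n hn y => ?_
  rw [le_div_iff₀' hx]
  have h1 : ‖iteratedFDeriv ℝ n (sliceCLM x G) y‖ ≤ ‖iteratedFDeriv ℝ n G (x, y)‖ := by
    have h2 := norm_iteratedFDeriv_comp_clm_le (ContinuousLinearMap.inr ℝ E F)
      (ContinuousLinearMap.opNorm_le_bound _ zero_le_one fun y => by simp) (compSubConstCLM ℂ (-(x, (0 : F))) G) n y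
    rw [iteratedFDeriv_compSubConstCLM] at h2
    refine (le_of_eq ?_).trans (h2.trans (le_of_eq ?_))
    · congr 2
    · simp
  have h3 := one_add_norm_pow_mul_le (m := M + m) (k := M + k) (n := n) (by omega) (by omega) G (x, y)
  refine le_trans ?_ h3
  have hx' : ‖x‖ ≤ ‖(x, y)‖ := norm_fst_le (x, y)
  have hy' : ‖y‖ ≤ 1 + ‖(x, y)‖ := (norm_snd_le (x, y)).trans (by linarith)
  rw [← mul_assoc, pow_add]
  gcongr

end Translation

/-! ### Gabor atoms: growth, decay of coefficients, inversion. -/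

section Gabor
variable {E : Type} [NormedAddCommGroup E] [InnerProductSpace ℝ E] [FiniteDimensional ℝ E]
  [MeasurableSpace E] [BorelSpace E]

/-- The time-frequency shift `x ↦ exp(2πi⟪w, x⟫) γ(x - q)` of a window, for `z = (q, w)`. -/
noncomputable def gabor (γ : 𝓢(E, ℂ)) (z : E × E) : 𝓢(E, ℂ) :=
  𝓕⁻ (compSubConstCLM ℂ z.2 (𝓕 (compSubConstCLM ℂ z.1 γ)))

theorem gabor_apply (γ : 𝓢(E, ℂ)) (z : E × E) (x : E) :
    gabor γ z x = Complex.exp (((2 * Real.pi * inner ℝ z.2 x : ℝ) : ℂ) * Complex.I) *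
      γ (x - z.1) := by
  have h1 : ∀ f : 𝓢(E, ℂ), (𝓕⁻ f : 𝓢(E, ℂ)) x =
      ∫ v, Complex.exp (((2 * Real.pi * inner ℝ v x : ℝ) : ℂ) * Complex.I) • f v := fun f => by
    rw [fourierInv_coe, Real.fourierInv_eq']
  have h2 : γ (x - z.1) = (𝓕⁻ (𝓕 (compSubConstCLM ℂ z.1 γ)) : 𝓢(E, ℂ)) x := by
    rw [FourierTransform.fourierInv_fourier_eq]; simp
  rw [h2, gabor, h1, h1, ← integral_const_mul, eq_comm,
    ← integral_sub_right_eq_self _ z.2]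
  congr 1
  ext v
  rw [compSubConstCLM_apply, smul_eq_mul, smul_eq_mul, ← mul_assoc, ← Complex.exp_add]
  congr 2
  rw [inner_sub_left]
  push_cast
  ring

/-- The modulation is realised as a translation conjugated by the Fourier transformation, so joint
continuity of translations is all that is needed. -/
theorem continuous_gabor (γ : 𝓢(E, ℂ)) : Continuous (gabor γ) := by
  have h1 : Continuous fun f : 𝓢(E, ℂ) => (𝓕 f : 𝓢(E, ℂ)) :=
    (FourierTransform.fourierCLM ℂ 𝓢(E, ℂ)).continuous
  have h2 : Continuous fun f : 𝓢(E, ℂ) => (𝓕⁻ f : 𝓢(E, ℂ)) :=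
    (FourierTransform.fourierInvCLM ℂ 𝓢(E, ℂ)).continuous
  have h3 := continuous_translate (E := E)
  exact h2.comp (h3.comp (continuous_snd.prodMk (h1.comp (h3.comp
    (continuous_fst.prodMk continuous_const)))))

theorem schwartzNorm_gabor_le (γ : 𝓢(E, ℂ)) (m : ℕ) :
    ∃ (N : ℕ) (C : ℝ), 0 ≤ C ∧ ∀ z, schwartzNorm E m (gabor γ z) ≤ C * (1 + ‖z‖) ^ N := by
  obtain ⟨m₁, C₁, hC₁, h₁⟩ :=
    exists_bound_of_continuous (FourierTransform.fourierInvCLM ℂ 𝓢(E, ℂ)) m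
  obtain ⟨m₂, C₂, hC₂, h₂⟩ :=
    exists_bound_of_continuous (FourierTransform.fourierCLM ℂ 𝓢(E, ℂ)) m₁
  refine ⟨m₁ + m₂, C₁ * (2 ^ m₁ * (C₂ * (2 ^ m₂ * schwartzNorm E m₂ γ))), by positivity,
    fun z => ?_⟩
  have hz1 : ‖z.1‖ ≤ ‖z‖ := norm_fst_le z
  have hz2 : ‖z.2‖ ≤ ‖z‖ := norm_snd_le z
  calc _ ≤ C₁ * schwartzNorm E m₁ _ := h₁ _
    _ ≤ C₁ * (2 ^ m₁ * (1 + ‖z.2‖) ^ m₁ * schwartzNorm E m₁ _) := by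
        gcongr; exact schwartzNorm_translate_le _ _ _
    _ ≤ C₁ * (2 ^ m₁ * (1 + ‖z.2‖) ^ m₁ * (C₂ * schwartzNorm E m₂ _)) := by
        gcongr; exact h₂ _
    _ ≤ C₁ * (2 ^ m₁ * (1 + ‖z.2‖) ^ m₁ * (C₂ * (2 ^ m₂ * (1 + ‖z.1‖) ^ m₂ *
          schwartzNorm E m₂ γ))) := by gcongr; exact schwartzNorm_translate_le _ _ _
    _ ≤ C₁ * (2 ^ m₁ * (1 + ‖z‖) ^ m₁ * (C₂ * (2 ^ m₂ * (1 + ‖z‖) ^ m₂ *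
          schwartzNorm E m₂ γ))) := by gcongr
    _ = _ := by rw [pow_add]; ring

/-- The map `φ ↦ ((q, p) ↦ γ(p - q) φ(p))`. -/
noncomputable def windowCLM (γ : 𝓢(E, ℂ)) : 𝓢(E, ℂ) →L[ℂ] 𝓢(E × E, ℂ) :=
  compCLMOfContinuousLinearEquiv ℂ (LinearEquiv.toContinuousLinearEquiv
    { toFun := fun p : E × E => (p.2 - p.1, p.2)
      invFun := fun p => (p.2 - p.1, p.2)
      map_add' := fun p q => by ext1 <;> simp; abel
      map_smul' := fun c p => by ext1 <;> simp [smul_sub]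
      left_inv := fun p => by ext1 <;> simp
      right_inv := fun p => by ext1 <;> simp }) ∘L schwartzTensor γ

theorem windowCLM_apply (γ φ : 𝓢(E, ℂ)) (q p : E) :
    windowCLM γ φ (q, p) = γ (p - q) * φ p := rfl

/-- The coefficients form a short-time Fourier transform. Since the pairing is bilinear, without
conjugation, the frequency appears with a minus sign. -/
theorem integral_mul_gabor (γ φ : 𝓢(E, ℂ)) (q w : E) :
    ∫ p, φ p * gabor γ (q, w) p = (𝓕 (sliceCLM q (windowCLM γ φ)) : 𝓢(E, ℂ)) (-w) := by
  rw [fourier_coe, Real.fourier_eq']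
  congr 1
  ext p
  rw [gabor_apply, sliceCLM_apply, windowCLM_apply, smul_eq_mul, inner_neg_right,
    real_inner_comm]
  simp only [mul_neg, neg_mul, neg_neg]
  ring

/-- Decay in `q` holds because `γ(p - q) φ(p)` is a Schwartz function of both variables; decay in
`w` holds because its slices are Fourier transformed in `p`. -/
theorem gabor_decay (γ : 𝓢(E, ℂ)) (M : ℕ) : ∃ (m : ℕ) (C : ℝ), 0 ≤ C ∧ ∀ φ (q w : E),
    (1 + ‖q‖) ^ M * (1 + ‖w‖) ^ M * ‖∫ p, φ p * gabor γ (q, w) p‖ ≤ C * schwartzNorm E m φ := by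
  obtain ⟨m₁, C₁, hC₁, h₁⟩ :=
    exists_bound_of_continuous (FourierTransform.fourierCLM ℂ 𝓢(E, ℂ)) M
  obtain ⟨m₂, C₂, hC₂, h₂⟩ := exists_bound_of_continuous (windowCLM γ) (M + m₁)
  refine ⟨m₂, 2 ^ M * (C₁ * (2 ^ (M + m₁) * C₂)), by positivity, fun φ q w => ?_⟩
  rw [integral_mul_gabor]
  set f := sliceCLM q (windowCLM γ φ)
  have h3 := one_add_norm_pow_mul_le (m := M) (k := M) (n := 0) le_rfl (Nat.zero_le _)
    (𝓕 f : 𝓢(E, ℂ)) (-w)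
  rw [norm_iteratedFDeriv_zero, norm_neg] at h3
  calc _ = (1 + ‖q‖) ^ M * ((1 + ‖w‖) ^ M * ‖(𝓕 f : 𝓢(E, ℂ)) (-w)‖) := by ring
    _ ≤ (1 + ‖q‖) ^ M * (2 ^ M * (C₁ * schwartzNorm E m₁ f)) := by
        refine mul_le_mul_of_nonneg_left ?_ (by positivity)
        exact h3.trans (mul_le_mul_of_nonneg_left (h₁ f) (by positivity))
    _ = 2 ^ M * (C₁ * ((1 + ‖q‖) ^ M * schwartzNorm E m₁ f)) := by ring
    _ ≤ 2 ^ M * (C₁ * (2 ^ (M + m₁) * (C₂ * schwartzNorm E m₂ φ))) := by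
        refine mul_le_mul_of_nonneg_left (mul_le_mul_of_nonneg_left ?_ hC₁.le) (by positivity)
        exact (schwartzNorm_slice_le M m₁ q _).trans
          (mul_le_mul_of_nonneg_left (h₂ φ) (by positivity))
    _ = _ := by ring

theorem gabor_decay' (γ : 𝓢(E, ℂ)) (M : ℕ) : ∃ (m : ℕ) (C : ℝ), 0 ≤ C ∧ ∀ φ (z : E × E),
    (1 + ‖z‖) ^ M * ‖∫ p, φ p * gabor γ z p‖ ≤ C * schwartzNorm E m φ := by
  obtain ⟨m, C, hC, h⟩ := gabor_decay γ M
  refine ⟨m, C, hC, fun φ z => le_trans ?_ (h φ z.1 z.2)⟩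
  gcongr
  rw [← mul_pow]
  gcongr
  rw [Prod.norm_def]
  rcases max_choice ‖z.1‖ ‖z.2‖ with h | h <;> rw [h] <;>
    nlinarith [norm_nonneg z.1, norm_nonneg z.2]

theorem exists_normalized_window (E : Type) [NormedAddCommGroup E] [InnerProductSpace ℝ E]
    [FiniteDimensional ℝ E] [MeasurableSpace E] [BorelSpace E] :
    ∃ γ : 𝓢(E, ℂ), ∫ x, γ x * γ x = 1 := by
  obtain ⟨χ⟩ : Nonempty (ContDiffBump (0 : E)) := ⟨⟨1, 2, one_pos, one_lt_two⟩⟩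
  have hs : ContDiff ℝ ∞ fun x => ((χ x : ℝ) : ℂ) := Complex.ofRealCLM.contDiff.comp χ.contDiff
  have hc : HasCompactSupport fun x => ((χ x : ℝ) : ℂ) := χ.hasCompactSupport.comp_left Complex.ofReal_zero
  obtain ⟨f, hf⟩ : ∃ f : 𝓢(E, ℂ), ∀ x, f x = ((χ x : ℝ) : ℂ) :=
    ⟨hc.toSchwartzMap hs, fun x => hc.toSchwartzMap_toFun hs x⟩
  have h1 : 0 < ∫ x, χ x * χ x := by
    have hcont : Continuous fun x => χ x * χ x := χ.continuous.mul χ.continuous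
    refine (integral_pos_iff_support_of_nonneg (fun x => mul_self_nonneg _)
      (hcont.integrable_of_hasCompactSupport χ.hasCompactSupport.mul_left)).2 ?_
    refine hcont.isOpen_support.measure_pos volume ⟨0, ?_⟩
    have : χ (0 : E) = 1 := χ.one_of_mem_closedBall (Metric.mem_closedBall_self χ.rIn_pos.le)
    simp [this]
  set c := ∫ x, χ x * χ x with hcdef
  have h2 : ∫ x, f x * f x = (c : ℂ) := by
    rw [hcdef, ← integral_complex_ofReal]
    simp only [hf, Complex.ofReal_mul]
  refine ⟨((Real.sqrt c : ℝ) : ℂ)⁻¹ • f, ?_⟩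
  have h3 : ∀ c : ℂ, ∫ x, (c • f) x * (c • f) x = c * c * ∫ x, f x * f x := fun c => by
    rw [← integral_const_mul]; congr 1; ext x; simp; ring
  have h4 : ((Real.sqrt c : ℝ) : ℂ) * ((Real.sqrt c : ℝ) : ℂ) = c := by
    exact_mod_cast Real.mul_self_sqrt h1.le
  rw [h3, h2, ← mul_inv, h4]
  exact inv_mul_cancel₀ (by exact_mod_cast h1.ne')

theorem integrable_of_decay {Z V : Type} [NormedAddCommGroup Z] [MeasurableSpace Z]
    [BorelSpace Z] [SecondCountableTopology Z] [NormedSpace ℝ Z]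
    [NormedAddCommGroup V] (ν : Measure Z) [ν.HasTemperateGrowth]
    (f : Z → V) (hf : AEStronglyMeasurable f ν) (C : ℝ)
    (h : ∀ z, (1 + ‖z‖) ^ ν.integrablePower * ‖f z‖ ≤ C) : Integrable f ν := by
  refine ((Measure.integrable_pow_neg_integrablePower ν).mul_const C).mono' hf (.of_forall fun z => ?_)
  have hz : (0 : ℝ) < 1 + ‖z‖ := by positivity
  rw [Real.rpow_neg hz.le, Real.rpow_natCast, ← div_eq_inv_mul, le_div_iff₀ (by positivity),
    mul_comm]
  exact h z

/-- For fixed `q` the integral over the frequency is Fourier inversion and gives `φ(x) γ(x - q)²`;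
the integral over `q` then uses the normalization of the window. The frequency is reflected in the
coefficient to compensate for the bilinear pairing. -/
theorem gabor_reproducing {γ : 𝓢(E, ℂ)} (hγ : ∫ x, γ x * γ x = 1) (φ : 𝓢(E, ℂ)) (x : E) :
    ∫ z : E × E, (∫ p, φ p * gabor γ (z.1, -z.2) p) * gabor γ z x = φ x := by
  have hcont : Continuous fun z : E × E => (∫ p, φ p * gabor γ (z.1, -z.2) p) * gabor γ z x := by
    have h1 : ∀ z : E × E, ∫ p, φ p * gabor γ (z.1, -z.2) p =
        integralCLM ℂ volume (pairing (ContinuousLinearMap.mul ℂ ℂ) φ (gabor γ (z.1, -z.2))) :=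
      fun z => by simp [integralCLM_apply, pairing_apply_apply]
    simp only [h1]
    have h2 : Continuous fun z : E × E => gabor γ (z.1, -z.2) :=
      (continuous_gabor γ).comp (by fun_prop)
    have h3 : Continuous fun z : E × E => gabor γ z x :=
      (TemperedDistribution.delta x).continuous.comp (continuous_gabor γ)
    exact ((integralCLM ℂ volume).continuous.comp
      ((pairing (ContinuousLinearMap.mul ℂ ℂ) φ).continuous.comp h2)).mul h3
  have : (volume : Measure (E × E)).IsAddHaarMeasure := Measure.prod.instIsAddHaarMeasure _ _
  have hint : Integrable fun z : E × E =>
      (∫ p, φ p * gabor γ (z.1, -z.2) p) * gabor γ z x := by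
    obtain ⟨N, D, hD, h2⟩ := schwartzNorm_gabor_le γ 0
    obtain ⟨m, C, hC, h1⟩ := gabor_decay' γ
      ((volume : Measure (E × E)).integrablePower + N)
    refine integrable_of_decay volume _ hcont.aestronglyMeasurable (C * schwartzNorm E m φ * D)
      fun z => ?_
    have hz : ‖((z.1, -z.2) : E × E)‖ = ‖z‖ := by simp [Prod.norm_def]
    have h3 := h1 φ (z.1, -z.2)
    rw [hz, pow_add] at h3
    have h4 : ‖gabor γ z x‖ ≤ D * (1 + ‖z‖) ^ N :=
      ((norm_le_seminorm ℂ _ x).trans (seminorm_le_schwartzNorm le_rfl le_rfl _)).trans (h2 z)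
    rw [norm_mul]
    calc _ ≤ (1 + ‖z‖) ^ (volume : Measure (E × E)).integrablePower *
          (‖∫ p, φ p * gabor γ (z.1, -z.2) p‖ * (D * (1 + ‖z‖) ^ N)) := by gcongr
      _ = ((1 + ‖z‖) ^ (volume : Measure (E × E)).integrablePower * (1 + ‖z‖) ^ N *
          ‖∫ p, φ p * gabor γ (z.1, -z.2) p‖) * D := by ring
      _ ≤ _ := by gcongr
  rw [Measure.volume_eq_prod] at hint ⊢
  rw [integral_prod _ hint]
  have h5 : ∀ q : E, ∫ w, (∫ p, φ p * gabor γ (q, -w) p) * gabor γ (q, w) x =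
      φ x * (γ (x - q) * γ (x - q)) := fun q => by
    set f := sliceCLM q (windowCLM γ φ)
    have h6 : (𝓕⁻ (𝓕 f) : 𝓢(E, ℂ)) x = γ (x - q) * φ x := by
      rw [FourierTransform.fourierInv_fourier_eq]; simp [f, windowCLM_apply]
    rw [fourierInv_coe, Real.fourierInv_eq'] at h6
    calc _ = ∫ w, (Complex.exp (((2 * Real.pi * inner ℝ w x : ℝ) : ℂ) * Complex.I) •
          (𝓕 f : 𝓢(E, ℂ)) w) * γ (x - q) := by
          congr 1; ext w
          rw [integral_mul_gabor, gabor_apply, neg_neg, smul_eq_mul]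
          ring
      _ = _ := by rw [integral_mul_const, h6]; ring
  simp only [h5]
  rw [integral_const_mul, integral_sub_left_eq_self (fun y => γ y * γ y) volume x, hγ, mul_one]

end Gabor

/-! ### Continuous frames of the Schwartz space. -/

section Frames
variable {E H Z : Type} [NormedAddCommGroup E] [NormedSpace ℝ E]
  [MeasurableSpace E] [BorelSpace E] [SecondCountableTopology E]
  [NormedAddCommGroup H] [NormedSpace ℝ H]
  [NormedAddCommGroup Z] [MeasurableSpace Z] [BorelSpace Z]

theorem embed_symm (μ : Measure E) [μ.HasTemperateGrowth] (f g : 𝓢(E, ℂ)) :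
    embed μ f g = embed μ g f := by
  rw [embed_apply, embed_apply]
  congr 1; ext x; ring

/-- Families of Schwartz functions that grow at most polynomially. -/
def IsModerate (a : Z → 𝓢(E, ℂ)) : Prop :=
  ∀ m, ∃ (N : ℕ) (C : ℝ), 0 ≤ C ∧ ∀ z, schwartzNorm E m (a z) ≤ C * (1 + ‖z‖) ^ N

/-- Families of Schwartz functions whose coefficients decay rapidly. -/
def HasDecay (μ : Measure E) [μ.HasTemperateGrowth] (b : Z → 𝓢(E, ℂ)) : Prop :=
  ∀ M : ℕ, ∃ (m : ℕ) (C : ℝ), 0 ≤ C ∧ ∀ φ z,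
    (1 + ‖z‖) ^ M * ‖embed μ (b z) φ‖ ≤ C * schwartzNorm E m φ

/-- A continuous frame of the Schwartz space: `φ = ∫ ⟨φ, b z⟩ a z dν(z)`. -/
structure IsFrame (μ : Measure E) [μ.HasTemperateGrowth] (ν : Measure Z)
    (a b : Z → 𝓢(E, ℂ)) : Prop where
  continuous_left : Continuous a
  continuous_right : Continuous b
  moderate_left : IsModerate a
  moderate_right : IsModerate b
  decay : HasDecay μ b
  reproducing : ∀ φ x, ∫ z, embed μ (b z) φ * a z x ∂ν = φ x

theorem schwartzMap_ext_functional {f g : 𝓢(H, ℂ)} (h : ∀ l : 𝓢(H, ℂ) →L[ℂ] ℂ, l f = l g) :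
    f = g := by
  ext x
  exact h (TemperedDistribution.delta x)

theorem continuous_embed_apply (μ : Measure E) [μ.HasTemperateGrowth] {b : Z → 𝓢(E, ℂ)}
    (hb : Continuous b) (φ : 𝓢(E, ℂ)) : Continuous fun z => embed μ (b z) φ := by
  simp_rw [embed_symm μ _ φ]
  exact (ContinuousLinearMap.continuous _).comp hb

variable [SecondCountableTopology Z] [NormedSpace ℝ Z] {μ : Measure E} [μ.HasTemperateGrowth]
  {ν : Measure Z} [ν.HasTemperateGrowth] {a b : Z → 𝓢(E, ℂ)}

/-- Weighted integrals of moderate families of Schwartz functions. -/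
theorem exists_weighted_integral (ν : Measure Z) [ν.HasTemperateGrowth] (Φ : Z → 𝓢(H, ℂ))
    (hΦ : Continuous Φ) (hm : IsModerate Φ) (c : Z → ℂ) (hc : Continuous c)
    (hd : ∀ M : ℕ, ∃ C, ∀ z, (1 + ‖z‖) ^ M * ‖c z‖ ≤ C) :
    ∃ I : 𝓢(H, ℂ), (∀ l : 𝓢(H, ℂ) →L[ℂ] ℂ, l I = ∫ z, c z * l (Φ z) ∂ν) ∧
      ∀ (m N : ℕ) (C D : ℝ), 0 ≤ C → (∀ z, schwartzNorm H m (Φ z) ≤ C * (1 + ‖z‖) ^ N) →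
        (∀ z, (1 + ‖z‖) ^ (ν.integrablePower + N) * ‖c z‖ ≤ D) →
        schwartzNorm H m I ≤ (∫ z, (1 + ‖z‖) ^ (-(ν.integrablePower : ℝ)) ∂ν) * (C * D) := by
  have hbound : ∀ (m N : ℕ) (C D : ℝ), 0 ≤ C →
      (∀ z, schwartzNorm H m (Φ z) ≤ C * (1 + ‖z‖) ^ N) →
      (∀ z, (1 + ‖z‖) ^ (ν.integrablePower + N) * ‖c z‖ ≤ D) →
      ∀ z, (1 + ‖z‖) ^ ν.integrablePower * ‖schwartzNorm H m (c z • Φ z)‖ ≤ C * D := by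
    intro m N C D hC h1 h2 z
    rw [Real.norm_of_nonneg (apply_nonneg _ _), map_smul_eq_mul]
    calc _ ≤ (1 + ‖z‖) ^ ν.integrablePower * (‖c z‖ * (C * (1 + ‖z‖) ^ N)) := by
          gcongr; exact h1 z
      _ = C * ((1 + ‖z‖) ^ (ν.integrablePower + N) * ‖c z‖) := by rw [pow_add]; ring
      _ ≤ _ := by gcongr; exact h2 z
  have hcont : Continuous fun z => c z • Φ z := hc.smul hΦ
  have hint : ∀ m, Integrable (fun z => schwartzNorm H m (c z • Φ z)) ν := fun m => by
    obtain ⟨N, C, hC, h1⟩ := hm m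
    obtain ⟨D, h2⟩ := hd (ν.integrablePower + N)
    exact integrable_of_decay ν _ ((continuous_schwartzNorm m).comp hcont).aestronglyMeasurable _
      (hbound m N C D hC h1 h2)
  obtain ⟨I, hI, hI'⟩ := exists_schwartz_integral ν (fun z => c z • Φ z) hcont hint
  refine ⟨I, fun l => (hI l).trans (by simp), fun m N C D hC h1 h2 => (hI' m).trans ?_⟩
  rw [← integral_mul_const]
  refine integral_mono (hint m) ((Measure.integrable_pow_neg_integrablePower ν).mul_const _)
    fun z => ?_
  have hz : (0 : ℝ) < 1 + ‖z‖ := by positivity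
  have h3 := hbound m N C D hC h1 h2 z
  rw [Real.norm_of_nonneg (apply_nonneg _ _)] at h3
  change _ ≤ (1 + ‖z‖) ^ (-(ν.integrablePower : ℝ)) * (C * D)
  rw [Real.rpow_neg hz.le, Real.rpow_natCast, ← div_eq_inv_mul, le_div_iff₀ (by positivity),
    mul_comm]
  exact h3

theorem HasDecay.exists_bound (hb : HasDecay μ b) (φ : 𝓢(E, ℂ)) (M : ℕ) :
    ∃ C, ∀ z, (1 + ‖z‖) ^ M * ‖embed μ (b z) φ‖ ≤ C := by
  obtain ⟨m, C, -, h⟩ := hb M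
  exact ⟨_, h φ⟩

/-- The frame expansion, assumed pointwise, converges as an integral in `𝓢` because the coefficients
decay faster than the atoms grow. Hence every continuous functional can be applied under the
integral. -/
theorem IsFrame.functional (h : IsFrame μ ν a b) (l : 𝓢(E, ℂ) →L[ℂ] ℂ) (φ : 𝓢(E, ℂ)) :
    ∫ z, embed μ (b z) φ * l (a z) ∂ν = l φ := by
  obtain ⟨I, hI, -⟩ := exists_weighted_integral ν a h.continuous_left h.moderate_left
    (fun z => embed μ (b z) φ) (continuous_embed_apply μ h.continuous_right φ)
    (h.decay.exists_bound φ)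
  have : I = φ := by
    ext x
    rw [← h.reproducing φ x]
    exact hI (TemperedDistribution.delta x)
  rw [← hI, this]

theorem IsFrame.embed_injective (h : IsFrame μ ν a b) : Function.Injective (embed μ) := by
  refine (injective_iff_map_eq_zero _).2 fun f hf => ?_
  ext x
  rw [← h.reproducing f x]
  simp only [embed_symm μ _ f, hf]
  simp

theorem IsFrame.ext_functional (h : IsFrame μ ν a b) {l l' : 𝓢(E, ℂ) →L[ℂ] ℂ}
    (hl : ∀ z, l (a z) = l' (a z)) : l = l' := by
  ext φ
  rw [← h.functional, ← h.functional l']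
  simp only [hl]

/-- Automatic continuity of linear maps into the Schwartz space. -/
theorem IsFrame.continuous_of_weakly_continuous (h : IsFrame μ ν a b)
    (Λ : 𝓢(H, ℂ) →ₗ[ℂ] 𝓢(E, ℂ)) (hΛ : ∀ f, Continuous fun g => embed μ f (Λ g)) :
    Continuous Λ := by
  refine WithSeminorms.continuous_of_isBounded (schwartzNorm_withSeminorms (E := H))
    (schwartzNorm_withSeminorms (E := E)) Λ fun m => ?_
  obtain ⟨N, C, hC, h1⟩ := h.moderate_left m
  -- The weighted frame coefficients of `Λ g` are continuous in `g` by hypothesis and bounded in `z`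
  -- by decay. As `𝓢(H)` is barrelled, their supremum is a continuous seminorm. The exponent leaves
  -- room for an integrable weight and for the growth of the atoms, so the expansion of `Λ g`
  -- inherits the bound.
  let p : Z → Seminorm ℂ 𝓢(H, ℂ) := fun z =>
    ((1 + ‖z‖₊) ^ (ν.integrablePower + N) : NNReal) •
      (normSeminorm ℂ ℂ).comp ((embed μ (b z) : 𝓢(E, ℂ) →L[ℂ] ℂ).toLinearMap ∘ₗ Λ)
  have hp : ∀ z g, p z g =
      (1 + ‖z‖) ^ (ν.integrablePower + N) * ‖embed μ (b z) (Λ g)‖ := fun z g => by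
    change ((((1 + ‖z‖₊) ^ (ν.integrablePower + N) : NNReal)) : ℝ) * ‖embed μ (b z) (Λ g)‖ = _
    simp
  have hbdd : BddAbove (Set.range p) := Seminorm.bddAbove_range_iff.2 fun g => by
    obtain ⟨D, hD⟩ := h.decay.exists_bound (Λ g) (ν.integrablePower + N)
    refine ⟨D, ?_⟩
    rintro _ ⟨z, rfl⟩
    simpa only [hp] using hD z
  have hcont : Continuous ((⨆ z, p z : Seminorm ℂ 𝓢(H, ℂ)) : 𝓢(H, ℂ) → ℝ) := by
    have := Seminorm.continuous_iSup p (fun z => by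
      have h2 : (p z : 𝓢(H, ℂ) → ℝ) = fun g =>
        (1 + ‖z‖) ^ (ν.integrablePower + N) * ‖embed μ (b z) (Λ g)‖ := funext (hp z)
      rw [h2]
      exact continuous_const.mul (hΛ _).norm) hbdd
    rwa [← Seminorm.coe_iSup_eq hbdd] at this
  obtain ⟨k, D, hD, h3⟩ := exists_le_schwartzNorm (⨆ z, p z) hcont
  set K := ∫ z, (1 + ‖z‖) ^ (-(ν.integrablePower : ℝ)) ∂ν
  refine ⟨{k}, (K * (C * D)).toNNReal, fun g => ?_⟩
  obtain ⟨I, hI, hI'⟩ := exists_weighted_integral ν a h.continuous_left h.moderate_left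
    (fun z => embed μ (b z) (Λ g)) (continuous_embed_apply μ h.continuous_right _)
    (h.decay.exists_bound _)
  have e : I = Λ g := schwartzMap_ext_functional fun l => by rw [hI, h.functional]
  have h4 := hI' m N C (D * schwartzNorm H k g) hC h1 fun z => by
    rw [← hp]
    refine le_trans ?_ (h3 g)
    rw [Seminorm.iSup_apply hbdd]
    exact le_ciSup (Seminorm.bddAbove_range_iff.1 hbdd g) z
  rw [e] at h4
  rw [Finset.sup_singleton]
  change schwartzNorm E m (Λ g) ≤ ((K * (C * D)).toNNReal : ℝ) * schwartzNorm H k g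
  refine h4.trans ?_
  calc K * (C * (D * schwartzNorm H k g)) = K * (C * D) * schwartzNorm H k g := by ring
    _ ≤ _ := mul_le_mul_of_nonneg_right (Real.le_coe_toNNReal _) (apply_nonneg _ _)

end Frames

/-! ### Tensor products of frames. -/

section TensorFrame
variable {E F Z : Type} [NormedAddCommGroup E] [NormedSpace ℝ E]
  [MeasurableSpace E] [BorelSpace E] [SecondCountableTopology E]
  [NormedAddCommGroup F] [NormedSpace ℝ F]
  [NormedAddCommGroup Z] [MeasurableSpace Z] [BorelSpace Z]

/-- Integration against a Schwartz function in the first variable,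
`G ↦ (y ↦ ∫ f(x) G(x, y) dμ(x))`. -/
noncomputable def integralLeft (μ : Measure E) [μ.HasTemperateGrowth] (f : 𝓢(E, ℂ)) :
    𝓢(E × F, ℂ) →L[ℂ] 𝓢(F, ℂ) :=
  partialIntegral μ ∘L smulLeftCLM ℂ (fun p : F × E => f p.2) ∘L
    compCLMOfContinuousLinearEquiv ℂ (ContinuousLinearEquiv.prodComm ℝ F E)

theorem integralLeft_apply (μ : Measure E) [μ.HasTemperateGrowth] (f : 𝓢(E, ℂ))
    (G : 𝓢(E × F, ℂ)) (y : F) : integralLeft μ f G y = ∫ x, f x * G (x, y) ∂μ := by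
  have hg : (fun p : F × E => f p.2).HasTemperateGrowth :=
    f.hasTemperateGrowth.comp (ContinuousLinearMap.snd ℝ F E).hasTemperateGrowth
  simp [integralLeft, smulLeftCLM_apply_apply hg]

theorem IsJointlyBounded.isModerate {H : Type} [NormedAddCommGroup H] [NormedSpace ℝ H]
    {B : 𝓢(E, ℂ) →ₗ[ℂ] 𝓢(E, ℂ) →ₗ[ℂ] 𝓢(H, ℂ)} (hB : IsJointlyBounded B)
    {a b : Z → 𝓢(E, ℂ)} (ha : IsModerate a) (hb : IsModerate b) :
    IsModerate fun p : Z × Z => B (a p.1) (b p.2) := by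
  intro m
  obtain ⟨m', C, hC, h⟩ := hB m
  obtain ⟨N₁, C₁, hC₁, h₁⟩ := ha m'
  obtain ⟨N₂, C₂, hC₂, h₂⟩ := hb m'
  refine ⟨N₁ + N₂, C * (C₁ * C₂), by positivity, fun p => (h _ _).trans ?_⟩
  have e1 : 1 + ‖p.1‖ ≤ 1 + ‖p‖ := by gcongr; exact norm_fst_le p
  have e2 : 1 + ‖p.2‖ ≤ 1 + ‖p‖ := by gcongr; exact norm_snd_le p
  calc C * (schwartzNorm E m' (a p.1) * schwartzNorm E m' (b p.2))
      ≤ C * ((C₁ * (1 + ‖p.1‖) ^ N₁) * (C₂ * (1 + ‖p.2‖) ^ N₂)) := by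
        gcongr; exacts [h₁ _, h₂ _]
    _ ≤ C * ((C₁ * (1 + ‖p‖) ^ N₁) * (C₂ * (1 + ‖p‖) ^ N₂)) := by gcongr
    _ = _ := by rw [pow_add]; ring

theorem IsModerate.tensor {a b : Z → 𝓢(E, ℂ)} (ha : IsModerate a) (hb : IsModerate b) :
    IsModerate fun p : Z × Z => schwartzTensor (a p.1) (b p.2) :=
  (isJointlyBounded_schwartzTensor (E := E) (F := E)).isModerate ha hb

theorem continuous_schwartzTensor {W : Type} [TopologicalSpace W] {a : W → 𝓢(E, ℂ)}
    {b : W → 𝓢(F, ℂ)} (ha : Continuous a) (hb : Continuous b) :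
    Continuous fun p => schwartzTensor (a p) (b p) :=
  (isJointlyBounded_schwartzTensor (E := E) (F := F)).continuous.comp (ha.prodMk hb)

variable [SecondCountableTopology Z] [NormedSpace ℝ Z] {μ : Measure E} [μ.HasTemperateGrowth]
  [SFinite μ] [(μ.prod μ).HasTemperateGrowth]
  {ν : Measure Z} [SFinite ν] [(ν.prod ν).HasTemperateGrowth] {a b : Z → 𝓢(E, ℂ)}

theorem embed_schwartzTensor (f g : 𝓢(E, ℂ)) (G : 𝓢(E × E, ℂ)) :
    embed (μ.prod μ) (schwartzTensor f g) G = embed μ g (integralLeft μ f G) := by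
  rw [embed_apply, embed_apply]
  have hi : Integrable (fun p : E × E => G p * schwartzTensor f g p) (μ.prod μ) := by
    obtain ⟨N, hN⟩ : ∃ C, ∀ p, ‖schwartzTensor f g p‖ ≤ C :=
      ⟨_, fun p => (schwartzTensor f g).norm_le_seminorm ℂ p⟩
    exact G.integrable.mul_bdd (c := N) (schwartzTensor f g).continuous.aestronglyMeasurable (.of_forall hN)
  rw [integral_prod_symm _ hi]
  congr 1; ext y
  rw [integralLeft_apply, ← integral_mul_const]
  congr 1; ext x
  simp only [schwartzTensor_apply]
  ring

/-- The reproducing formula is applied in one variable at a time. Decay against arbitrary functions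
of two variables is taken as a hypothesis; for Gabor atoms it is checked directly in
`gabor_tensor_decay`. -/
theorem IsFrame.tensor [ν.HasTemperateGrowth] (h : IsFrame μ ν a b)
    (hd : HasDecay (μ.prod μ) fun p : Z × Z => schwartzTensor (b p.1) (b p.2)) :
    IsFrame (μ.prod μ) (ν.prod ν) (fun p => schwartzTensor (a p.1) (a p.2))
      fun p => schwartzTensor (b p.1) (b p.2) where
  continuous_left := continuous_schwartzTensor (h.continuous_left.comp continuous_fst)
    (h.continuous_left.comp continuous_snd)
  continuous_right := continuous_schwartzTensor (h.continuous_right.comp continuous_fst)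
    (h.continuous_right.comp continuous_snd)
  moderate_left := h.moderate_left.tensor h.moderate_left
  moderate_right := h.moderate_right.tensor h.moderate_right
  decay := hd
  reproducing := fun G p => by
    obtain ⟨x, y⟩ := p
    have hca : Continuous fun p : Z × Z => schwartzTensor (a p.1) (a p.2) :=
      continuous_schwartzTensor (h.continuous_left.comp continuous_fst)
        (h.continuous_left.comp continuous_snd)
    have hcb : Continuous fun p : Z × Z => schwartzTensor (b p.1) (b p.2) :=
      continuous_schwartzTensor (h.continuous_right.comp continuous_fst)
        (h.continuous_right.comp continuous_snd)
    have hi : Integrable (fun p : Z × Z => embed (μ.prod μ) (schwartzTensor (b p.1) (b p.2)) G *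
        schwartzTensor (a p.1) (a p.2) (x, y)) (ν.prod ν) := by
      obtain ⟨N, C, hC, h1⟩ := (h.moderate_left.tensor h.moderate_left) 0
      obtain ⟨D, hD⟩ := hd.exists_bound G ((ν.prod ν).integrablePower + N)
      refine integrable_of_decay _ _ ((continuous_embed_apply _ hcb G).mul
        ((TemperedDistribution.delta (x, y)).continuous.comp hca)).aestronglyMeasurable (C * D)
        fun p => ?_
      have h2 : ‖schwartzTensor (a p.1) (a p.2) (x, y)‖ ≤ C * (1 + ‖p‖) ^ N :=
        ((norm_le_seminorm ℂ _ _).trans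
          (seminorm_le_schwartzNorm le_rfl le_rfl _)).trans (h1 p)
      rw [norm_mul]
      calc _ ≤ (1 + ‖p‖) ^ (ν.prod ν).integrablePower *
            (‖embed (μ.prod μ) (schwartzTensor (b p.1) (b p.2)) G‖ * (C * (1 + ‖p‖) ^ N)) := by
            gcongr
        _ = C * ((1 + ‖p‖) ^ ((ν.prod ν).integrablePower + N) *
            ‖embed (μ.prod μ) (schwartzTensor (b p.1) (b p.2)) G‖) := by rw [pow_add]; ring
        _ ≤ _ := mul_le_mul_of_nonneg_left (hD p) hC
    rw [integral_prod _ hi]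
    have h3 : ∀ z, ∫ w, embed (μ.prod μ) (schwartzTensor (b z) (b w)) G *
        schwartzTensor (a z) (a w) (x, y) ∂ν = integralLeft μ (b z) G y * a z x := fun z => by
      rw [← h.reproducing (integralLeft μ (b z) G) y, ← integral_mul_const]
      congr 1; ext w
      rw [embed_schwartzTensor, schwartzTensor_apply]
      ring
    simp_rw [h3]
    rw [← sliceCLM_apply x G y]
    have h4 := h.reproducing (sliceCLM y (compCLMOfContinuousLinearEquiv ℂ
      (ContinuousLinearEquiv.prodComm ℝ E E) G)) x
    rw [sliceCLM_apply] at h4 ⊢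
    refine Eq.trans ?_ h4
    congr 1; ext z
    rw [integralLeft_apply, embed_apply]
    congr 2; ext x'
    rw [sliceCLM_apply, mul_comm]
    rfl

end TensorFrame

/-! ### The Gabor frame and its tensor square. -/

section GaborFrame
variable {E : Type} [NormedAddCommGroup E] [InnerProductSpace ℝ E] [FiniteDimensional ℝ E]
  [MeasurableSpace E] [BorelSpace E]

/-- A tensor product of two Gabor atoms is a Gabor atom with window `γ ⊗ γ` on the Euclidean product
`WithLp 2 (E × E)`, where the one-variable estimate applies. The maximum norm is dominated by the
Euclidean norm. -/
theorem gabor_tensor_decay (γ : 𝓢(E, ℂ)) (M : ℕ) : ∃ (m : ℕ) (C : ℝ), 0 ≤ C ∧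
    ∀ (G : 𝓢(E × E, ℂ)) (p : (E × E) × (E × E)), (1 + ‖p‖) ^ M *
      ‖∫ x : E × E, G x * schwartzTensor (gabor γ p.1) (gabor γ p.2) x‖ ≤
        C * schwartzNorm (E × E) m G := by
  let e : WithLp 2 (E × E) ≃L[ℝ] E × E := WithLp.prodContinuousLinearEquiv 2 ℝ E E
  let T : 𝓢(E × E, ℂ) →L[ℂ] 𝓢(WithLp 2 (E × E), ℂ) := compCLMOfContinuousLinearEquiv ℂ e
  obtain ⟨m, C, hC, h⟩ := gabor_decay' (T (schwartzTensor γ γ)) M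
  obtain ⟨m', C', hC', h'⟩ := exists_bound_of_continuous T m
  refine ⟨m', C * C', by positivity, fun G p => ?_⟩
  let z : WithLp 2 (E × E) × WithLp 2 (E × E) :=
    (WithLp.toLp 2 (p.1.1, p.2.1), WithLp.toLp 2 (p.1.2, p.2.2))
  have h1 : ∫ x : E × E, G x * schwartzTensor (gabor γ p.1) (gabor γ p.2) x =
      ∫ x, T G x * gabor (T (schwartzTensor γ γ)) z x := by
    rw [← (WithLp.volume_preserving_ofLp E E).integral_comp
      (MeasurableEquiv.toLp 2 (E × E)).symm.measurableEmbedding]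
    congr 1; ext x
    simp only [schwartzTensor_apply, gabor_apply]
    have h2 : ∀ y, T (schwartzTensor γ γ) y = γ (WithLp.ofLp y).1 * γ (WithLp.ofLp y).2 :=
      fun y => rfl
    rw [h2, WithLp.prod_inner_apply]
    change G x.ofLp * _ = G x.ofLp * _
    simp only [z, WithLp.ofLp_sub, Prod.fst_sub, Prod.snd_sub]
    push_cast
    rw [mul_add, add_mul, Complex.exp_add]
    ring
  have h3 : ∀ u : E × E, ‖u‖ ≤ ‖WithLp.toLp 2 u‖ := fun u => by
    have := WithLp.prod_norm_sq_eq_of_L2 (WithLp.toLp 2 u)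
    rw [Prod.norm_def]
    refine max_le ?_ ?_ <;> refine abs_le_of_sq_le_sq' ?_ (norm_nonneg _) |>.2 <;>
      rw [this] <;> simp
  have h4 : ‖p‖ ≤ ‖z‖ := by
    have e1 := (h3 _).trans (norm_fst_le z)
    have e2 := (h3 _).trans (norm_snd_le z)
    refine norm_prod_le_iff.2 ⟨norm_prod_le_iff.2 ⟨?_, ?_⟩, norm_prod_le_iff.2 ⟨?_, ?_⟩⟩
    · exact (norm_fst_le (p.1.1, p.2.1)).trans e1
    · exact (norm_fst_le (p.1.2, p.2.2)).trans e2
    · exact (norm_snd_le (p.1.1, p.2.1)).trans e1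
    · exact (norm_snd_le (p.1.2, p.2.2)).trans e2
  rw [h1]
  calc _ ≤ (1 + ‖z‖) ^ M * ‖∫ x, T G x * gabor (T (schwartzTensor γ γ)) z x‖ := by gcongr
    _ ≤ C * schwartzNorm _ m (T G) := h _ _
    _ ≤ C * (C' * schwartzNorm (E × E) m' G) := by gcongr; exact h' G
    _ = _ := by ring

instance : (volume : Measure (E × E)).IsAddHaarMeasure := Measure.prod.instIsAddHaarMeasure _ _

instance : ((volume : Measure (E × E)).prod (volume : Measure (E × E))).IsAddHaarMeasure :=
  Measure.prod.instIsAddHaarMeasure _ _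

theorem norm_reflect_snd (z : E × E) : ‖(z.1, -z.2)‖ = ‖z‖ := by
  simp [Prod.norm_def]

theorem exists_gabor_frame {κ : ℝ} (hκ : 0 < κ) {μ : Measure E} [μ.HasTemperateGrowth] [SFinite μ]
    [(μ.prod μ).HasTemperateGrowth] (hμ : μ = ENNReal.ofReal κ • volume) :
    ∃ a b : E × E → 𝓢(E, ℂ), IsFrame μ volume a b ∧ HasDecay μ a ∧
      IsFrame (μ.prod μ) (volume.prod volume) (fun p => schwartzTensor (a p.1) (a p.2))
        fun p => schwartzTensor (b p.1) (b p.2) := by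
  obtain ⟨γ, hγ⟩ := exists_normalized_window E
  have hint : ∀ f : E → ℂ, ∫ x, f x ∂μ = (κ : ℂ) * ∫ x, f x := fun f => by
    rw [hμ, integral_smul_measure, ENNReal.toReal_ofReal hκ.le, Complex.real_smul]
  have hint₂ : ∀ f : E × E → ℂ, ∫ x, f x ∂(μ.prod μ) = (κ : ℂ) * ((κ : ℂ) * ∫ x, f x) :=
    fun f => by
      rw [hμ, Measure.prod_smul_left, Measure.prod_smul_right, integral_smul_measure,
        integral_smul_measure, ENNReal.toReal_ofReal hκ.le, Complex.real_smul, Complex.real_smul]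
      rfl
  have hκ' : (κ : ℂ) ≠ 0 := by exact_mod_cast hκ.ne'
  -- The factor `κ⁻¹` cancels the density of `μ`, and the reflected frequency is the one required by
  -- the reproducing formula.
  let b : E × E → 𝓢(E, ℂ) := fun z => (κ : ℂ)⁻¹ • gabor γ (z.1, -z.2)
  have hb : ∀ z φ, embed μ (b z) φ = ∫ p, φ p * gabor γ (z.1, -z.2) p := fun z φ => by
    rw [embed_apply, hint, ← integral_const_mul]
    congr 1; ext x
    simp only [b, smul_apply, smul_eq_mul]
    field_simp
  have hfr : IsFrame μ volume (gabor γ) b :=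
    { continuous_left := continuous_gabor γ
      continuous_right := by
        have h0 : Continuous fun z : E × E => gabor γ (z.1, -z.2) :=
          (continuous_gabor γ).comp (continuous_fst.prodMk continuous_snd.neg)
        exact h0.const_smul (κ : ℂ)⁻¹
      moderate_left := schwartzNorm_gabor_le γ
      moderate_right := fun m => by
        obtain ⟨N, C, hC, h⟩ := schwartzNorm_gabor_le γ m
        refine ⟨N, ‖(κ : ℂ)⁻¹‖ * C, by positivity, fun z => ?_⟩
        rw [map_smul_eq_mul, mul_assoc, ← norm_reflect_snd z]
        exact mul_le_mul_of_nonneg_left (h _) (norm_nonneg _)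
      decay := fun M => by
        obtain ⟨m, C, hC, h⟩ := gabor_decay' γ M
        refine ⟨m, C, hC, fun φ z => ?_⟩
        rw [hb, ← norm_reflect_snd z]
        exact h φ _
      reproducing := fun φ x => by
        simp_rw [hb]
        exact gabor_reproducing hγ φ x }
  refine ⟨gabor γ, b, hfr, fun M => ?_, hfr.tensor fun M => ?_⟩
  · obtain ⟨m, C, hC, h⟩ := gabor_decay' γ M
    refine ⟨m, κ * C, by positivity, fun φ z => ?_⟩
    rw [embed_apply, hint, norm_mul, Complex.norm_real, Real.norm_of_nonneg hκ.le]
    calc _ = κ * ((1 + ‖z‖) ^ M * ‖∫ p, φ p * gabor γ z p‖) := by ring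
      _ ≤ κ * (C * schwartzNorm E m φ) := mul_le_mul_of_nonneg_left (h φ z) hκ.le
      _ = _ := by ring
  · obtain ⟨m, C, hC, h⟩ := gabor_tensor_decay γ M
    refine ⟨m, C, hC, fun G p => ?_⟩
    have e : ‖(((p.1.1, -p.1.2), (p.2.1, -p.2.2)) : (E × E) × (E × E))‖ = ‖p‖ := by
      simp [Prod.norm_def]
    have h1 : embed (μ.prod μ) (schwartzTensor (b p.1) (b p.2)) G = ∫ x : E × E, G x *
        schwartzTensor (gabor γ (p.1.1, -p.1.2)) (gabor γ (p.2.1, -p.2.2)) x := by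
      rw [embed_apply, hint₂, ← mul_assoc, ← integral_const_mul]
      congr 1; ext x
      simp only [schwartzTensor_apply, b, smul_apply, smul_eq_mul]
      field_simp
    rw [h1, ← e]
    exact h G _

end GaborFrame

/-! ### Weakly continuous functionals on tempered distributions. -/

section Dual
variable {E : Type} [NormedAddCommGroup E] [NormedSpace ℝ E]

/-- The weakly continuous functionals on the tempered distributions are the test functions. -/
theorem exists_eq_eval (A : 𝓢'(E, ℂ) →L[ℂ] ℂ) : ∃ φ : 𝓢(E, ℂ), ∀ T, A T = T φ := by
  obtain ⟨φ, hφ⟩ := LinearMap.dualEmbedding_surjective (topDualPairing ℂ 𝓢(E, ℂ))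
    (A.comp (PointwiseConvergenceCLM.equivWeakDual ℂ 𝓢(E, ℂ)).symm.toContinuousLinearMap)
  refine ⟨φ, fun T => ?_⟩
  exact (DFunLike.congr_fun hφ (PointwiseConvergenceCLM.equivWeakDual ℂ 𝓢(E, ℂ) T)).symm

end Dual

/-! ### Operators determined on test functions, on frames and on elementary tensors. -/

section Lift
variable {E H Z : Type} [NormedAddCommGroup E] [NormedSpace ℝ E]
  [MeasurableSpace E] [BorelSpace E] [SecondCountableTopology E]
  [NormedAddCommGroup H] [NormedSpace ℝ H]
  [NormedAddCommGroup Z] [MeasurableSpace Z] [BorelSpace Z]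
  [SecondCountableTopology Z] [NormedSpace ℝ Z] {μ : Measure E} [μ.HasTemperateGrowth]
  {ν : Measure Z} [ν.HasTemperateGrowth] {a b : Z → 𝓢(E, ℂ)}

/-- A weakly continuous operator is a transpose: `A T φ = T x` for a test function `x` that depends
on `φ` only. Pairings with test functions determine `x`. -/
theorem IsFrame.ext_dual {F : Type} [NormedAddCommGroup F] [NormedSpace ℝ F]
    (h : IsFrame μ ν a b) {A A' : 𝓢'(E, ℂ) →L[ℂ] 𝓢'(F, ℂ)}
    (hA : ∀ f, A (embed μ f) = A' (embed μ f)) : A = A' := by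
  ext T φ
  obtain ⟨x, hx⟩ := exists_eq_eval ((PointwiseConvergenceCLM.evalCLM (.id ℂ) ℂ φ).comp A)
  obtain ⟨y, hy⟩ := exists_eq_eval ((PointwiseConvergenceCLM.evalCLM (.id ℂ) ℂ φ).comp A')
  have hxy : x = y := by
    refine h.embed_injective ?_
    ext f
    rw [embed_symm, embed_symm μ y, ← hx, ← hy]
    exact DFunLike.congr_fun (hA f) φ
  have h1 := hx T
  rw [hxy, ← hy T] at h1
  exact h1

theorem continuous_of_schwartzNorm_le (Λ : 𝓢(E, ℂ) →ₗ[ℂ] 𝓢(H, ℂ))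
    (h : ∀ m, ∃ (k : ℕ) (C : ℝ), ∀ g, schwartzNorm H m (Λ g) ≤ C * schwartzNorm E k g) :
    Continuous Λ := by
  refine WithSeminorms.continuous_of_isBounded (schwartzNorm_withSeminorms (E := E))
    (schwartzNorm_withSeminorms (E := H)) Λ fun m => ?_
  obtain ⟨k, C, hk⟩ := h m
  refine ⟨{k}, C.toNNReal, fun g => ?_⟩
  rw [Finset.sup_singleton]
  exact (hk g).trans (mul_le_mul_of_nonneg_right (Real.le_coe_toNNReal _) (apply_nonneg _ _))

theorem integrable_weighted (Φ : Z → 𝓢(H, ℂ))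
    (hΦ : Continuous Φ) (hm : IsModerate Φ) (c : Z → ℂ) (hc : Continuous c)
    (hd : ∀ M : ℕ, ∃ C, ∀ z, (1 + ‖z‖) ^ M * ‖c z‖ ≤ C) (l : 𝓢(H, ℂ) →L[ℂ] ℂ) :
    Integrable (fun z => c z * l (Φ z)) ν := by
  obtain ⟨m, B, hB, h0⟩ := exists_bound_of_functional l
  obtain ⟨N, C, hC, h1⟩ := hm m
  obtain ⟨D, h2⟩ := hd (ν.integrablePower + N)
  refine integrable_of_decay ν _ (hc.mul (l.continuous.comp hΦ)).aestronglyMeasurable (B * C * D)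
    fun z => ?_
  rw [norm_mul]
  calc _ ≤ (1 + ‖z‖) ^ ν.integrablePower * (‖c z‖ * (B * (C * (1 + ‖z‖) ^ N))) := by
        gcongr
        exact (h0 _).trans (mul_le_mul_of_nonneg_left (h1 z) hB.le)
    _ = B * C * ((1 + ‖z‖) ^ (ν.integrablePower + N) * ‖c z‖) := by rw [pow_add]; ring
    _ ≤ _ := mul_le_mul_of_nonneg_left (h2 z) (by positivity)

/-- A moderate family indexed by a frame extends to a continuous linear map. -/
theorem IsFrame.exists_synthesis (h : IsFrame μ ν a b) (Φ : Z → 𝓢(H, ℂ)) (hΦ : Continuous Φ)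
    (hm : IsModerate Φ) : ∃ L : 𝓢(E, ℂ) →L[ℂ] 𝓢(H, ℂ),
      ∀ (l : 𝓢(H, ℂ) →L[ℂ] ℂ) G, l (L G) = ∫ z, embed μ (b z) G * l (Φ z) ∂ν := by
  choose I hI hI' using fun G => exists_weighted_integral ν Φ hΦ hm
    (fun z => embed μ (b z) G) (continuous_embed_apply μ h.continuous_right G)
    (h.decay.exists_bound G)
  have hint := fun G (l : 𝓢(H, ℂ) →L[ℂ] ℂ) => integrable_weighted (ν := ν) Φ hΦ hm
    (fun z => embed μ (b z) G) (continuous_embed_apply μ h.continuous_right G)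
    (h.decay.exists_bound G) l
  let Λ : 𝓢(E, ℂ) →ₗ[ℂ] 𝓢(H, ℂ) :=
    { toFun := I
      map_add' := fun G G' => schwartzMap_ext_functional fun l => by
        rw [map_add, hI, hI, hI, ← integral_add (hint G l) (hint G' l)]
        congr 1; ext z
        rw [map_add, add_mul]
      map_smul' := fun c G => schwartzMap_ext_functional fun l => by
        rw [map_smul, hI, hI, RingHom.id_apply, smul_eq_mul, ← integral_const_mul]
        congr 1; ext z
        rw [map_smul, smul_eq_mul, mul_assoc] }
  refine ⟨⟨Λ, continuous_of_schwartzNorm_le Λ fun m => ?_⟩, fun l G => hI G l⟩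
  obtain ⟨N, C, hC, h1⟩ := hm m
  obtain ⟨k, D, hD, h2⟩ := h.decay (ν.integrablePower + N)
  refine ⟨k, (∫ z, (1 + ‖z‖) ^ (-(ν.integrablePower : ℝ)) ∂ν) * (C * D), fun G => ?_⟩
  refine (hI' G m N C (D * schwartzNorm E k G) hC h1 (h2 G)).trans_eq (by ring)

variable [SFinite μ] [(μ.prod μ).HasTemperateGrowth] [SFinite ν]
  [(ν.prod ν).HasTemperateGrowth]

/-- The atoms of the tensor frame are elementary tensors, so a frame expansion plays the role of
density of their span. -/
theorem ext_tensor_functional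
    (h : IsFrame (μ.prod μ) (ν.prod ν) (fun p => schwartzTensor (a p.1) (a p.2))
      fun p => schwartzTensor (b p.1) (b p.2)) {l l' : 𝓢(E × E, ℂ) →L[ℂ] ℂ}
    (hl : ∀ f g, l (schwartzTensor f g) = l' (schwartzTensor f g)) : l = l' :=
  h.ext_functional fun _ => hl _ _

/-- The continuous linear map on `𝓢(E × E)` determined by a bilinear map on `𝓢(E)`. -/
theorem exists_tensor_lift (h₁ : IsFrame μ ν a b)
    (h : IsFrame (μ.prod μ) (ν.prod ν) (fun p => schwartzTensor (a p.1) (a p.2))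
      fun p => schwartzTensor (b p.1) (b p.2))
    (B : 𝓢(E, ℂ) →ₗ[ℂ] 𝓢(E, ℂ) →ₗ[ℂ] 𝓢(H, ℂ)) (hB : IsJointlyBounded B) :
    ∃ L : 𝓢(E × E, ℂ) →L[ℂ] 𝓢(H, ℂ), ∀ f g, L (schwartzTensor f g) = B f g := by
  have hΦ : Continuous fun p : Z × Z => B (a p.1) (a p.2) :=
    hB.continuous.comp ((h₁.continuous_left.comp continuous_fst).prodMk
      (h₁.continuous_left.comp continuous_snd))
  have hm : IsModerate fun p : Z × Z => B (a p.1) (a p.2) := hB.isModerate h₁.moderate_left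
    h₁.moderate_left
  obtain ⟨L, hL⟩ := h.exists_synthesis _ hΦ hm
  refine ⟨L, fun f g => schwartzMap_ext_functional fun l => ?_⟩
  -- For `f ⊗ g` the coefficients factor, and the double integral collapses by the frame expansion
  -- of `g` and then that of `f`, with the other argument of `B` frozen.
  let l₁ : 𝓢(E, ℂ) → 𝓢(E, ℂ) →L[ℂ] ℂ := fun f =>
    l.comp ⟨B f, hB.continuous.comp (Continuous.prodMk_right f)⟩
  let l₂ : 𝓢(E, ℂ) → 𝓢(E, ℂ) →L[ℂ] ℂ := fun g =>
    l.comp ⟨B.flip g, hB.continuous.comp (Continuous.prodMk_left g)⟩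
  have hint := integrable_weighted (ν := ν.prod ν) _ hΦ hm _
    (continuous_embed_apply _ h.continuous_right (schwartzTensor f g))
    (h.decay.exists_bound (schwartzTensor f g)) l
  rw [hL, integral_prod _ hint]
  change _ = l₂ g f
  rw [← h₁.functional (l₂ g) f]
  congr 1; ext z
  change _ = _ * l₁ (a z) g
  rw [← h₁.functional (l₁ (a z)) g, ← integral_const_mul]
  congr 1; ext w
  rw [embed_schwartzTensor]
  have h2 : integralLeft μ (b z) (schwartzTensor f g) = embed μ (b z) f • g := by
    ext y
    rw [integralLeft_apply, smul_apply, embed_apply, smul_eq_mul, ← integral_mul_const]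
    congr 1; ext x
    rw [schwartzTensor_apply]; ring
  rw [h2, map_smul, smul_eq_mul, mul_assoc]
  rfl

end Lift

/-! ### Frames on phase space and contractions with distributions. -/

section PhaseFrame

theorem exists_phase_frame (n : ℕ) : ∃ a b : Phase n × Phase n → 𝓢(Phase n, ℂ),
    IsFrame (phaseMeasure n) volume a b ∧ HasDecay (phaseMeasure n) a ∧
      IsFrame (phaseMeasure₂ n) (volume.prod volume) (fun p => schwartzTensor (a p.1) (a p.2))
        fun p => schwartzTensor (b p.1) (b p.2) :=
  exists_gabor_frame (by positivity) rfl

variable {n : ℕ}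

theorem embed_phase_injective : Function.Injective (embed (phaseMeasure n)) := by
  obtain ⟨a, b, h, -, -⟩ := exists_phase_frame n
  exact h.embed_injective

theorem embed_phase₂_injective : Function.Injective (embed (phaseMeasure₂ n)) := by
  obtain ⟨a, b, -, -, h⟩ := exists_phase_frame n
  exact h.embed_injective

theorem phase_ext_dual {F : Type} [NormedAddCommGroup F] [NormedSpace ℝ F]
    {A A' : 𝓢'(Phase n, ℂ) →L[ℂ] 𝓢'(F, ℂ)}
    (hA : ∀ f, A (embed (phaseMeasure n) f) = A' (embed (phaseMeasure n) f)) : A = A' := by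
  obtain ⟨a, b, h, -, -⟩ := exists_phase_frame n
  exact h.ext_dual hA

theorem phase₂_ext_dual {F : Type} [NormedAddCommGroup F] [NormedSpace ℝ F]
    {A A' : 𝓢'(Phase n × Phase n, ℂ) →L[ℂ] 𝓢'(F, ℂ)}
    (hA : ∀ f, A (embed (phaseMeasure₂ n) f) = A' (embed (phaseMeasure₂ n) f)) : A = A' := by
  obtain ⟨a, b, -, -, h⟩ := exists_phase_frame n
  exact h.ext_dual hA

theorem phase_ext_tensor_functional {l l' : 𝓢'(Phase n × Phase n, ℂ)}
    (hl : ∀ f g, l (schwartzTensor f g) = l' (schwartzTensor f g)) : l = l' := by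
  obtain ⟨a, b, -, -, h⟩ := exists_phase_frame n
  exact ext_tensor_functional h hl

variable {H : Type} [NormedAddCommGroup H] [NormedSpace ℝ H]

theorem exists_phase_tensor_lift (B : 𝓢(Phase n, ℂ) →ₗ[ℂ] 𝓢(Phase n, ℂ) →ₗ[ℂ] 𝓢(H, ℂ))
    (hB : IsJointlyBounded B) :
    ∃ L : 𝓢(Phase n × Phase n, ℂ) →L[ℂ] 𝓢(H, ℂ), ∀ f g, L (schwartzTensor f g) = B f g := by
  obtain ⟨a, b, h₁, -, h⟩ := exists_phase_frame n
  exact exists_tensor_lift h₁ h B hB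

theorem embed_tensor (f g f' g' : 𝓢(Phase n, ℂ)) :
    embed (phaseMeasure₂ n) (schwartzTensor f g) (schwartzTensor f' g') =
      embed (phaseMeasure n) f f' * embed (phaseMeasure n) g g' := by
  have h2 : integralLeft (phaseMeasure n) f (schwartzTensor f' g') =
      embed (phaseMeasure n) f f' • g' := by
    ext y
    rw [integralLeft_apply, smul_apply, embed_apply, smul_eq_mul, ← integral_mul_const]
    congr 1; ext x
    rw [schwartzTensor_apply]; ring
  rw [embed_schwartzTensor, h2, map_smul, smul_eq_mul]

/-- The map `f ⊗ g ↦ T(g) f`. -/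
theorem exists_contractRight (T : 𝓢'(Phase n, ℂ)) :
    ∃ L : 𝓢(Phase n × Phase n, ℂ) →L[ℂ] 𝓢(Phase n, ℂ),
      ∀ f g, L (schwartzTensor f g) = T g • f :=
  exists_phase_tensor_lift (LinearMap.mk₂ ℂ (fun f g => T g • f) (fun _ _ _ => smul_add _ _ _)
    (fun _ _ _ => smul_comm _ _ _) (fun f g g' => by rw [map_add, add_smul])
    (fun c f g => by rw [map_smul, smul_assoc]))
    (isJointlyBounded_of_separately_continuous _
      (fun f => T.continuous.smul continuous_const) fun g => continuous_id.const_smul (T g))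

/-- The map `f ⊗ g ↦ T(f) g`. -/
theorem exists_contractLeft (T : 𝓢'(Phase n, ℂ)) :
    ∃ L : 𝓢(Phase n × Phase n, ℂ) →L[ℂ] 𝓢(Phase n, ℂ),
      ∀ f g, L (schwartzTensor f g) = T f • g :=
  exists_phase_tensor_lift (LinearMap.mk₂ ℂ (fun f g => T f • g)
    (fun f f' g => by rw [map_add, add_smul]) (fun c f g => by rw [map_smul, smul_assoc])
    (fun _ _ _ => smul_add _ _ _) (fun _ _ _ => smul_comm _ _ _))
    (isJointlyBounded_of_separately_continuous _
      (fun f => continuous_id.const_smul (T f)) fun g => T.continuous.smul continuous_const)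

/-- Contraction of the second variable with a distribution, `f ⊗ g ↦ T(g) f`. -/
noncomputable def contractRight (T : 𝓢'(Phase n, ℂ)) :
    𝓢(Phase n × Phase n, ℂ) →L[ℂ] 𝓢(Phase n, ℂ) := (exists_contractRight T).choose

/-- Contraction of the first variable with a distribution, `f ⊗ g ↦ T(f) g`. -/
noncomputable def contractLeft (T : 𝓢'(Phase n, ℂ)) :
    𝓢(Phase n × Phase n, ℂ) →L[ℂ] 𝓢(Phase n, ℂ) := (exists_contractLeft T).choose

theorem contractRight_tensor (T : 𝓢'(Phase n, ℂ)) (f g : 𝓢(Phase n, ℂ)) :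
    contractRight T (schwartzTensor f g) = T g • f := (exists_contractRight T).choose_spec f g

theorem contractLeft_tensor (T : 𝓢'(Phase n, ℂ)) (f g : 𝓢(Phase n, ℂ)) :
    contractLeft T (schwartzTensor f g) = T f • g := (exists_contractLeft T).choose_spec f g

/-- Fubini's theorem for `S ⊗ T`: both sides are continuous in `G` and equal `S(f) T(g)` on
elementary tensors. -/
theorem apply_contractRight (S T : 𝓢'(Phase n, ℂ)) (G : 𝓢(Phase n × Phase n, ℂ)) :
    S (contractRight T G) = T (contractLeft S G) := by
  refine DFunLike.congr_fun (phase_ext_tensor_functional 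
    (l := PointwiseConvergenceCLM.precomp ℂ (contractRight T) S)
    (l' := PointwiseConvergenceCLM.precomp ℂ (contractLeft S) T) fun f g => ?_) G
  change S (contractRight T _) = T (contractLeft S _)
  rw [contractRight_tensor, contractLeft_tensor, map_smul, map_smul, smul_eq_mul, smul_eq_mul,
    mul_comm]

theorem embed_contractRight (f g : 𝓢(Phase n, ℂ)) (G : 𝓢(Phase n × Phase n, ℂ)) :
    embed (phaseMeasure n) f (contractRight (embed (phaseMeasure n) g) G) =
      embed (phaseMeasure₂ n) (schwartzTensor f g) G := by
  refine DFunLike.congr_fun (phase_ext_tensor_functional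
    (l := PointwiseConvergenceCLM.precomp ℂ (contractRight (embed (phaseMeasure n) g))
      (embed (phaseMeasure n) f))
    (l' := embed (phaseMeasure₂ n) (schwartzTensor f g)) fun f' g' => ?_) G
  change embed (phaseMeasure n) f (contractRight _ _) =
    embed (phaseMeasure₂ n) (schwartzTensor f g) (schwartzTensor f' g')
  rw [contractRight_tensor, embed_tensor, map_smul, smul_eq_mul, mul_comm]

end PhaseFrame

/-! ### The Schwartz kernel of `φ ↦ f # φ # g`. -/

section Kernel
variable {n : ℕ} {P : SchwartzProduct (Phase n)}

theorem distMul_id_apply (g h : 𝓢(Phase n, ℂ)) (T : 𝓢'(Phase n, ℂ)) :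
    P.distMul (.id ℂ _) g T h = T (P.mul g h) := rfl

theorem mulDist_id_apply (g h : 𝓢(Phase n, ℂ)) (T : 𝓢'(Phase n, ℂ)) :
    P.mulDist (.id ℂ _) g T h = T (P.mul h g) := rfl

theorem IsSmoothing.embed_sandwich (hB : IsSmoothing P) (f : 𝓢(Phase n, ℂ)) (T : 𝓢'(Phase n, ℂ))
    (g φ : 𝓢(Phase n, ℂ)) :
    embed (phaseMeasure n) (sandwich P f T g) φ = T (P.mul (P.mul g φ) f) := by
  have h := Classical.epsilon_spec (hB f g T)
  change embed (phaseMeasure n) (sandwich P f T g) = _ at h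
  rw [h]
  rfl

theorem IsTracialStarProduct.embed_mul_left (hA : IsTracialStarProduct P) (f g h : 𝓢(Phase n, ℂ)) :
    embed (phaseMeasure n) (P.mul f g) h = embed (phaseMeasure n) f (P.mul g h) := by
  rw [embed_symm _ _ h, embed_symm _ f, embed_apply, embed_apply, ← hA.integral_mul,
    ← hA.integral_mul, hA.mul_assoc]

theorem IsTracialStarProduct.embed_mul_right (hA : IsTracialStarProduct P)
    (f g h : 𝓢(Phase n, ℂ)) :
    embed (phaseMeasure n) (P.mul f g) h = embed (phaseMeasure n) g (P.mul h f) := by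
  rw [embed_apply, embed_apply, ← hA.integral_mul, ← hA.integral_mul, hA.mul_assoc]

/-- For a functional `l`, `l(f # a_w # g) = ⟨a_w, g # l # f⟩`, and `g # l # f` is a test function by
(B), so this decays rapidly in `w`. Weak boundedness gives boundedness in every norm, and uniform
boundedness makes the estimate uniform in `f` and `g`. -/
theorem exists_bound_mul_decay (hB : IsSmoothing P) {Z : Type} [NormedAddCommGroup Z]
    {a : Z → 𝓢(Phase n, ℂ)} (ha : HasDecay (phaseMeasure n) a) (m M : ℕ) :
    ∃ (m' : ℕ) (C : ℝ), 0 ≤ C ∧ ∀ w f g, (1 + ‖w‖) ^ M *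
      schwartzNorm (Phase n) m (P.mul (P.mul f (a w)) g) ≤
        C * (schwartzNorm (Phase n) m' f * schwartzNorm (Phase n) m' g) := by
  let c : Z → ℂ := fun w => (((1 + ‖w‖) ^ M : ℝ) : ℂ)
  have hc : ∀ w, ‖c w‖ = (1 + ‖w‖) ^ M := fun w => by
    rw [Complex.norm_real, Real.norm_of_nonneg (by positivity)]
  let B : Z → 𝓢(Phase n, ℂ) →ₗ[ℂ] 𝓢(Phase n, ℂ) →ₗ[ℂ] 𝓢(Phase n, ℂ) := fun w =>
    c w • P.mul.comp (P.mul.flip (a w))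
  have hbdd : ∀ f g, BddAbove (Set.range fun w => schwartzNorm (Phase n) m (B w f g)) :=
    fun f g => bddAbove_schwartzNorm_of_weakly_bounded _ (fun l => by
      obtain ⟨k, D, -, hD⟩ := ha M
      refine ⟨D * schwartzNorm (Phase n) k (sandwich P g l f), ?_⟩
      rintro _ ⟨w, rfl⟩
      have e : l (P.mul (P.mul f (a w)) g) =
          embed (phaseMeasure n) (a w) (sandwich P g l f) := by
        rw [embed_symm]
        exact (hB.embed_sandwich g l f (a w)).symm
      change ‖l (c w • P.mul (P.mul f (a w)) g)‖ ≤ _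
      rw [map_smul, norm_smul, hc, e]
      exact hD _ w) m
  obtain ⟨m', C, hC, h⟩ := exists_bound_of_pointwise_bounded (fun _ => schwartzNorm (Phase n) m) B
    (fun w f => (continuous_schwartzNorm m).comp ((P.continuous_mul_left _).const_smul (c w)))
    (fun w g => (continuous_schwartzNorm m).comp (((P.continuous_mul_right g).comp
      (P.continuous_mul_right (a w))).const_smul (c w))) hbdd
  refine ⟨m', C, hC, fun w f g => (h w f g).trans_eq' ?_⟩
  change schwartzNorm (Phase n) m (c w • P.mul (P.mul f (a w)) g) = _
  rw [map_smul_eq_mul, hc]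

/-- The kernel is `∫ b_w ⊗ (f # a_w # g) dw`. The second factor decays faster than the first one
grows, and pairing with `f₁ ⊗ f₂` reproduces the frame expansion of `f₁` inside `f # f₁ # g`. -/
theorem exists_kernel (hB : IsSmoothing P) :
    ∃ k : 𝓢(Phase n, ℂ) →ₗ[ℂ] 𝓢(Phase n, ℂ) →ₗ[ℂ] 𝓢(Phase n × Phase n, ℂ),
      IsJointlyBounded k ∧ ∀ f g f₁ f₂,
        embed (phaseMeasure₂ n) (k f g) (schwartzTensor f₁ f₂) =
          embed (phaseMeasure n) (P.mul (P.mul f f₁) g) f₂ := by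
  obtain ⟨a, b, hF, ha, -⟩ := exists_phase_frame n
  let ν : Measure (Phase n × Phase n) := volume
  let Φ : 𝓢(Phase n, ℂ) → 𝓢(Phase n, ℂ) → Phase n × Phase n → 𝓢(Phase n × Phase n, ℂ) :=
    fun f g w => schwartzTensor (b w) (P.mul (P.mul f (a w)) g)
  have hcont : ∀ f g, Continuous (Φ f g) := fun f g =>
    continuous_schwartzTensor hF.continuous_right ((P.continuous_mul_right g).comp
      ((P.continuous_mul_left f).comp hF.continuous_left))
  have hbound : ∀ m, ∃ (m' : ℕ) (C : ℝ), 0 ≤ C ∧ ∀ f g w,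
      (1 + ‖w‖) ^ ν.integrablePower * schwartzNorm _ m (Φ f g w) ≤
        C * (schwartzNorm (Phase n) m' f * schwartzNorm (Phase n) m' g) := fun m => by
    obtain ⟨m₁, C₁, hC₁, h₁⟩ := isJointlyBounded_schwartzTensor (E := Phase n) (F := Phase n) m
    obtain ⟨N, C₂, hC₂, h₂⟩ := hF.moderate_right m₁
    -- The decay is requested with exponent `N` for the growth of `b` plus an integrable weight.
    obtain ⟨m₃, C₃, hC₃, h₃⟩ := exists_bound_mul_decay hB ha m₁ (ν.integrablePower + N)
    refine ⟨m₃, C₁ * C₂ * C₃, by positivity, fun f g w => ?_⟩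
    calc _ ≤ (1 + ‖w‖) ^ ν.integrablePower * (C₁ * ((C₂ * (1 + ‖w‖) ^ N) *
          schwartzNorm (Phase n) m₁ (P.mul (P.mul f (a w)) g))) := by
          gcongr
          refine (h₁ _ _).trans ?_
          gcongr
          exact h₂ w
      _ = C₁ * C₂ * ((1 + ‖w‖) ^ (ν.integrablePower + N) *
          schwartzNorm (Phase n) m₁ (P.mul (P.mul f (a w)) g)) := by rw [pow_add]; ring
      _ ≤ C₁ * C₂ * (C₃ * (schwartzNorm (Phase n) m₃ f * schwartzNorm (Phase n) m₃ g)) :=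
          mul_le_mul_of_nonneg_left (h₃ w f g) (by positivity)
      _ = _ := by ring
  have hint : ∀ f g m, Integrable (fun w => schwartzNorm _ m (Φ f g w)) ν := fun f g m => by
    obtain ⟨m', C, hC, h⟩ := hbound m
    refine integrable_of_decay ν _
      ((continuous_schwartzNorm m).comp (hcont f g)).aestronglyMeasurable
      (C * (schwartzNorm (Phase n) m' f * schwartzNorm (Phase n) m' g)) fun w => ?_
    rw [Real.norm_of_nonneg (apply_nonneg _ _)]
    exact h f g w
  choose I hI hI' using fun f g => exists_schwartz_integral ν (Φ f g) (hcont f g) (hint f g)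
  have hintl : ∀ f g (l : 𝓢(Phase n × Phase n, ℂ) →L[ℂ] ℂ),
      Integrable (fun w => l (Φ f g w)) ν := fun f g l => by
    obtain ⟨m, C, hC, h⟩ := exists_bound_of_functional l
    exact ((hint f g m).const_mul C).mono' (l.continuous.comp (hcont f g)).aestronglyMeasurable
      (.of_forall fun w => h _)
  let k : 𝓢(Phase n, ℂ) →ₗ[ℂ] 𝓢(Phase n, ℂ) →ₗ[ℂ] 𝓢(Phase n × Phase n, ℂ) :=
    LinearMap.mk₂ ℂ I
      (fun f f' g => schwartzMap_ext_functional fun l => by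
        rw [map_add, hI, hI, hI, ← integral_add (hintl f g l) (hintl f' g l)]
        congr 1; ext w
        simp only [Φ, map_add, LinearMap.add_apply])
      (fun c f g => schwartzMap_ext_functional fun l => by
        rw [map_smul, hI, hI, smul_eq_mul, ← integral_const_mul]
        congr 1; ext w
        simp only [Φ, map_smul, LinearMap.smul_apply, smul_eq_mul])
      (fun f g g' => schwartzMap_ext_functional fun l => by
        rw [map_add, hI, hI, hI, ← integral_add (hintl f g l) (hintl f g' l)]
        congr 1; ext w
        simp only [Φ, map_add])
      (fun c f g => schwartzMap_ext_functional fun l => by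
        rw [map_smul, hI, hI, smul_eq_mul, ← integral_const_mul]
        congr 1; ext w
        simp only [Φ, map_smul, smul_eq_mul])
  refine ⟨k, fun m => ?_, fun f g f₁ f₂ => ?_⟩
  · obtain ⟨m', C, hC, h⟩ := hbound m
    refine ⟨m', (∫ w, (1 + ‖w‖) ^ (-(ν.integrablePower : ℝ)) ∂ν) * C, by positivity,
      fun f g => (hI' f g m).trans ?_⟩
    rw [mul_assoc, ← integral_mul_const]
    refine integral_mono (hint f g m)
      ((Measure.integrable_pow_neg_integrablePower ν).mul_const _) fun z => ?_
    have hz : (0 : ℝ) < 1 + ‖z‖ := by positivity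
    change _ ≤ (1 + ‖z‖) ^ (-(ν.integrablePower : ℝ)) * _
    rw [Real.rpow_neg hz.le, Real.rpow_natCast, ← div_eq_inv_mul, le_div_iff₀ (by positivity),
      mul_comm]
    exact h f g z
  · rw [embed_symm]
    change embed (phaseMeasure₂ n) (schwartzTensor f₁ f₂) (I f g) = _
    rw [show embed (phaseMeasure₂ n) (schwartzTensor f₁ f₂) (I f g) = _ from hI f g _]
    let l : 𝓢(Phase n, ℂ) →L[ℂ] ℂ :=
      ((embed (phaseMeasure n) f₂ : 𝓢(Phase n, ℂ) →L[ℂ] ℂ).comp (P.rightCLM g)).comp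
        (P.leftCLM f)
    have h1 := hF.functional l f₁
    rw [embed_symm _ _ f₂]
    refine Eq.trans ?_ h1
    congr 1; ext w
    refine (embed_tensor _ _ _ _).trans ?_
    rw [embed_symm _ f₁]
    rfl

end Kernel

/-! ### Contractions of the kernel and the existence of `N`. -/

section KernelContraction
variable {n : ℕ} {P : SchwartzProduct (Phase n)}

/-- The test function `k_{f,g}` with `⟨k_{f,g}, f₁ ⊗ f₂⟩ = ∫ f # f₁ # g # f₂`. -/
noncomputable def IsSmoothing.kernel (hB : IsSmoothing P) :
    𝓢(Phase n, ℂ) →ₗ[ℂ] 𝓢(Phase n, ℂ) →ₗ[ℂ] 𝓢(Phase n × Phase n, ℂ) := (exists_kernel hB).choose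

theorem IsSmoothing.kernel_bounded (hB : IsSmoothing P) : IsJointlyBounded hB.kernel :=
  (exists_kernel hB).choose_spec.1

theorem IsSmoothing.embed_kernel (hB : IsSmoothing P) (f g f₁ f₂ : 𝓢(Phase n, ℂ)) :
    embed (phaseMeasure₂ n) (hB.kernel f g) (schwartzTensor f₁ f₂) =
      embed (phaseMeasure n) (P.mul (P.mul f f₁) g) f₂ :=
  (exists_kernel hB).choose_spec.2 f g f₁ f₂

theorem IsTracialStarProduct.embed_cyclic (hA : IsTracialStarProduct P)
    (f φ g ψ : 𝓢(Phase n, ℂ)) :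
    embed (phaseMeasure n) (P.mul (P.mul f φ) g) ψ =
      embed (phaseMeasure n) φ (P.mul (P.mul g ψ) f) := by
  rw [hA.embed_mul_left, hA.embed_mul_right]

theorem contractRight_embed_kernel (hA : IsTracialStarProduct P) (hB : IsSmoothing P)
    (f g φ : 𝓢(Phase n, ℂ)) :
    contractRight (embed (phaseMeasure n) φ) (hB.kernel f g) = P.mul (P.mul g φ) f := by
  refine embed_phase_injective ?_
  ext ψ
  rw [embed_symm, embed_contractRight, embed_symm, hB.embed_kernel, hA.embed_cyclic,
    embed_symm]

theorem contractLeft_embed_kernel (hA : IsTracialStarProduct P) (hB : IsSmoothing P)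
    (f g φ : 𝓢(Phase n, ℂ)) :
    contractLeft (embed (phaseMeasure n) φ) (hB.kernel f g) = P.mul (P.mul f φ) g := by
  refine embed_phase_injective ?_
  ext ψ
  rw [embed_symm, ← apply_contractRight, contractRight_embed_kernel hA hB, hA.embed_cyclic]

/-- Tested against `ψ`, the contraction moves to the other variable, where only a test function is
contracted and cyclicity of the trace applies. -/
theorem contractRight_kernel (hA : IsTracialStarProduct P) (hB : IsSmoothing P)
    (f g : 𝓢(Phase n, ℂ)) (T : 𝓢'(Phase n, ℂ)) :
    contractRight T (hB.kernel f g) = sandwich P g T f := by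
  refine embed_phase_injective ?_
  ext ψ
  rw [embed_symm, apply_contractRight, contractLeft_embed_kernel hA hB, hB.embed_sandwich]

theorem contractLeft_kernel (hA : IsTracialStarProduct P) (hB : IsSmoothing P)
    (f g : 𝓢(Phase n, ℂ)) (T : 𝓢'(Phase n, ℂ)) :
    contractLeft T (hB.kernel f g) = sandwich P f T g := by
  refine embed_phase_injective ?_
  ext ψ
  rw [embed_symm, ← apply_contractRight, contractRight_embed_kernel hA hB, hB.embed_sandwich]

/-- Both sides are `S ⊗ T` evaluated at the single kernel `k_{g,f}`. This is the exchange rule that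
lets exponentials trade places in the product formula. -/
theorem apply_sandwich (hA : IsTracialStarProduct P) (hB : IsSmoothing P)
    (f g : 𝓢(Phase n, ℂ)) (S T : 𝓢'(Phase n, ℂ)) :
    S (sandwich P f T g) = T (sandwich P g S f) := by
  rw [← contractRight_kernel hA hB, apply_contractRight, contractLeft_kernel hA hB]

theorem IsNMap.unique {N N' : 𝓢'(Phase n × Phase n, ℂ) →L[ℂ] 𝓢'(Phase n × Phase n, ℂ)}
    (hN : IsNMap P N) (hN' : IsNMap P N') : N = N' := by
  refine phase₂_ext_dual fun Φ => ?_
  ext G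
  let ev : 𝓢'(Phase n × Phase n, ℂ) →L[ℂ] ℂ := PointwiseConvergenceCLM.evalCLM (.id ℂ) ℂ G
  refine DFunLike.congr_fun (phase_ext_tensor_functional
    (l := (ev.comp N).comp (embed (phaseMeasure₂ n)))
    (l' := (ev.comp N').comp (embed (phaseMeasure₂ n))) fun f₁ f₂ => ?_) Φ
  refine DFunLike.congr_fun (phase_ext_tensor_functional
    (l := N (embed (phaseMeasure₂ n) (schwartzTensor f₁ f₂)))
    (l' := N' (embed (phaseMeasure₂ n) (schwartzTensor f₁ f₂))) fun g₁ g₂ => ?_) G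
  rw [hN, hN']

/-- The transpose of the map `N`: it sends `g₁ ⊗ g₂` to the kernel of `ĝ₁` and `ĝ₂`. -/
theorem exists_transposeN (hB : IsSmoothing P) :
    ∃ A : 𝓢(Phase n × Phase n, ℂ) →L[ℂ] 𝓢(Phase n × Phase n, ℂ), ∀ g₁ g₂,
      A (schwartzTensor g₁ g₂) = hB.kernel (symplFourier n g₁) (symplFourier n g₂) := by
  refine exists_phase_tensor_lift (hB.kernel.compl₁₂ (symplFourier n).toLinearMap
    (symplFourier n).toLinearMap) (isJointlyBounded_of_separately_continuous _ (fun f => ?_)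
      fun g => ?_)
  · exact hB.kernel_bounded.continuous.comp
      (continuous_const.prodMk (symplFourier n).continuous)
  · exact hB.kernel_bounded.continuous.comp
      ((symplFourier n).continuous.prodMk continuous_const)

/-- The transpose of `A` satisfies the defining relation of `N`, so the choice in `mapN` is not
vacuous, and uniqueness identifies the chosen map with this transpose. -/
theorem mapN_apply (hA : IsTracialStarProduct P) (hB : IsSmoothing P) :
    ∃ A : 𝓢(Phase n × Phase n, ℂ) →L[ℂ] 𝓢(Phase n × Phase n, ℂ), (∀ g₁ g₂,
      A (schwartzTensor g₁ g₂) = hB.kernel (symplFourier n g₁) (symplFourier n g₂)) ∧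
      ∀ T G, mapN P T G = T (A G) := by
  obtain ⟨A, hAk⟩ := exists_transposeN hB
  refine ⟨A, hAk, fun T G => ?_⟩
  have h : IsNMap P (PointwiseConvergenceCLM.precomp ℂ A) := fun f₁ f₂ g₁ g₂ => by
    change embed (phaseMeasure₂ n) (schwartzTensor f₁ f₂) (A (schwartzTensor g₁ g₂)) = _
    rw [hAk, embed_symm, hB.embed_kernel, hA.embed_mul_left, embed_symm, embed_apply]
  have h' : IsNMap P (mapN P) := Classical.epsilon_spec ⟨_, h⟩
  rw [h'.unique h]
  rfl

end KernelContraction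

/-! ### Pairings with exponentials in one and two variables. -/

section Fourier
variable {n : ℕ}

theorem sympl_swap (X Y : Phase n) : sympl Y X = -sympl X Y := by
  simp only [sympl, ← Finset.sum_neg_distrib]
  exact Finset.sum_congr rfl fun i _ => by ring

theorem continuous_sympl : Continuous fun p : Phase n × Phase n => sympl p.1 p.2 := by
  unfold sympl
  fun_prop

/-- The function `X ↦ ⟨𝐞_X, f⟩`. -/
noncomputable def expTransform (n : ℕ) : 𝓢(Phase n, ℂ) →L[ℂ] 𝓢(Phase n, ℂ) :=
  compCLMOfContinuousLinearEquiv ℂ (ContinuousLinearEquiv.neg ℝ) ∘L symplFourier n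

theorem expTransform_apply (f : 𝓢(Phase n, ℂ)) (X : Phase n) :
    expTransform n f X = expDist X f := rfl

/-- Fubini's theorem. The antisymmetry of `σ` reverses the sign of the exponent under transposition,
hence `expTransform` on the right. -/
theorem embed_symplFourier (f g : 𝓢(Phase n, ℂ)) :
    embed (phaseMeasure n) (symplFourier n f) g =
      embed (phaseMeasure n) f (expTransform n g) := by
  rw [embed_apply, embed_apply]
  simp_rw [symplFourier_apply, expTransform_apply, expDist_apply, ← integral_const_mul,
    ← integral_mul_const]
  rw [integral_integral_swap]
  · congr 1; ext Y; congr 1; ext X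
    rw [sympl_swap Y X]
    push_cast
    ring_nf
  · have h1 := (g.integrable (μ := phaseMeasure n)).mul_prod (f.integrable (μ := phaseMeasure n))
    refine h1.mono ?_ (.of_forall fun p => ?_)
    · refine Continuous.aestronglyMeasurable ?_
      have := continuous_sympl (n := n)
      have hf := f.continuous
      have hg := g.continuous
      simp only [Function.uncurry_def]
      fun_prop
    · simp only [Function.uncurry, norm_mul, Complex.norm_exp]
      simp

theorem exists_expTransform₂ (n : ℕ) :
    ∃ L : 𝓢(Phase n × Phase n, ℂ) →L[ℂ] 𝓢(Phase n × Phase n, ℂ), ∀ f g,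
      L (schwartzTensor f g) = schwartzTensor (expTransform n f) (expTransform n g) := by
  refine exists_phase_tensor_lift ((LinearMap.mk₂ ℂ
      (fun (f : 𝓢(Phase n, ℂ)) (g : 𝓢(Phase n, ℂ)) => schwartzTensor f g)
      (fun f f' g => by ext p; simp [add_mul]) (fun c f g => by ext p; simp [mul_assoc])
      (fun f g g' => by simp) (fun c f g => by simp)).compl₁₂ (expTransform n).toLinearMap
    (expTransform n).toLinearMap) (isJointlyBounded_of_separately_continuous _ (fun f => ?_)
      fun g => ?_)
  · exact continuous_schwartzTensor continuous_const (expTransform n).continuous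
  · exact continuous_schwartzTensor (expTransform n).continuous continuous_const

/-- The map `G ↦ ((X, Y) ↦ ⟨𝐞_X ⊗ 𝐞_Y, G⟩)`. -/
noncomputable def expTransform₂ (n : ℕ) :
    𝓢(Phase n × Phase n, ℂ) →L[ℂ] 𝓢(Phase n × Phase n, ℂ) := (exists_expTransform₂ n).choose

theorem expTransform₂_tensor (f g : 𝓢(Phase n, ℂ)) : expTransform₂ n (schwartzTensor f g) =
    schwartzTensor (expTransform n f) (expTransform n g) := (exists_expTransform₂ n).choose_spec f g

theorem expTransform₂_apply (G : 𝓢(Phase n × Phase n, ℂ)) (X Y : Phase n) :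
    expTransform₂ n G (X, Y) = expDist X (contractRight (expDist Y) G) := by
  refine DFunLike.congr_fun (phase_ext_tensor_functional
    (l := (TemperedDistribution.delta (X, Y)).comp (expTransform₂ n))
    (l' := PointwiseConvergenceCLM.precomp ℂ (contractRight (expDist Y)) (expDist X))
    fun f g => ?_) G
  change expTransform₂ n (schwartzTensor f g) (X, Y) = expDist X (contractRight (expDist Y) _)
  rw [expTransform₂_tensor, contractRight_tensor, schwartzTensor_apply, map_smul, smul_eq_mul,
    mul_comm, expTransform_apply, expTransform_apply]

theorem embed_expTransform₂ (G : 𝓢(Phase n × Phase n, ℂ)) (g₁ g₂ : 𝓢(Phase n, ℂ)) :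
    embed (phaseMeasure₂ n) (expTransform₂ n G) (schwartzTensor g₁ g₂) =
      embed (phaseMeasure₂ n) G (schwartzTensor (symplFourier n g₁) (symplFourier n g₂)) := by
  rw [embed_symm, embed_symm _ G]
  refine DFunLike.congr_fun (phase_ext_tensor_functional
    (l := PointwiseConvergenceCLM.precomp ℂ (expTransform₂ n)
      (embed (phaseMeasure₂ n) (schwartzTensor g₁ g₂)))
    (l' := embed (phaseMeasure₂ n) (schwartzTensor (symplFourier n g₁) (symplFourier n g₂)))
    fun f g => ?_) G
  change embed (phaseMeasure₂ n) (schwartzTensor g₁ g₂) (expTransform₂ n _) =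
    embed (phaseMeasure₂ n) _ (schwartzTensor f g)
  rw [expTransform₂_tensor, embed_tensor, embed_tensor, embed_symplFourier, embed_symplFourier]

end Fourier

/-! ### The modulation mapping on test functions. -/

section Window
variable {n : ℕ} {P : SchwartzProduct (Phase n)}

theorem integral_phase₂ (G : 𝓢(Phase n × Phase n, ℂ)) :
    ∫ p, G p ∂phaseMeasure₂ n = ∫ X, ∫ Y, G (X, Y) ∂phaseMeasure n ∂phaseMeasure n :=
  integral_prod _ G.integrable

theorem exists_mul (F G : 𝓢(Phase n × Phase n, ℂ)) :
    ∃ H : 𝓢(Phase n × Phase n, ℂ), ∀ p, H p = F p * G p :=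
  ⟨smulLeftCLM ℂ F G, fun p => by simp [smulLeftCLM_apply_apply F.hasTemperateGrowth]⟩

theorem embed_phase₂_apply (F G : 𝓢(Phase n × Phase n, ℂ)) :
    embed (phaseMeasure₂ n) F G =
      ∫ X, ∫ Y, G (X, Y) * F (X, Y) ∂phaseMeasure n ∂phaseMeasure n := by
  obtain ⟨H, hH⟩ := exists_mul G F
  rw [embed_apply]
  simp_rw [← hH]
  exact integral_phase₂ H

theorem distTensor_embed (f h : 𝓢(Phase n, ℂ)) :
    distTensor h (embed (phaseMeasure n) f) = embed (phaseMeasure₂ n) (schwartzTensor f h) := by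
  ext G
  obtain ⟨k, hk, hk'⟩ := distTensor_apply h (embed (phaseMeasure n) f) G
  rw [hk', embed_phase₂_apply, embed_apply]
  congr 1; ext X
  rw [hk, ← integral_mul_const]
  congr 1; ext Y
  rw [schwartzTensor_apply]
  ring

/-- Composition with the change of variables `C`. -/
noncomputable def compC (n : ℕ) : 𝓢(Phase n × Phase n, ℂ) →L[ℂ] 𝓢(Phase n × Phase n, ℂ) :=
  compCLMOfContinuousLinearEquiv ℂ (changeC n)

theorem compC_apply (G : 𝓢(Phase n × Phase n, ℂ)) (X Y : Phase n) :
    compC n G (X, Y) = G (-X, X - Y) := rfl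

theorem mapC_apply (T : 𝓢'(Phase n × Phase n, ℂ)) (G : 𝓢(Phase n × Phase n, ℂ)) :
    mapC n T (compC n G) = T G := by
  change T (compCLMOfContinuousLinearEquiv ℂ (changeC n).symm (compC n G)) = T G
  congr 1
  ext p
  exact congrArg G ((changeC n).apply_symm_apply p)

theorem integral_compC (G : 𝓢(Phase n × Phase n, ℂ)) :
    ∫ p, compC n G p ∂phaseMeasure₂ n = ∫ p, G p ∂phaseMeasure₂ n := by
  rw [integral_phase₂, integral_phase₂]
  simp_rw [compC_apply]
  rw [← integral_neg_eq_self]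
  congr 1; ext X
  rw [neg_neg]
  exact integral_sub_left_eq_self (fun Y => G (X, Y)) _ _

theorem compC_surjective : Function.Surjective (compC n) := fun G =>
  ⟨compCLMOfContinuousLinearEquiv ℂ (changeC n).symm G, by
    ext p
    exact congrArg G ((changeC n).symm_apply_apply p)⟩

theorem embed_compC (F G : 𝓢(Phase n × Phase n, ℂ)) :
    embed (phaseMeasure₂ n) (compC n F) (compC n G) = embed (phaseMeasure₂ n) F G := by
  obtain ⟨H, hH⟩ := exists_mul G F
  have h1 : ∀ p, compC n H p = compC n G p * compC n F p := fun p => hH _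
  rw [embed_apply, embed_apply]
  simp_rw [← hH, ← h1]
  exact integral_compC H

theorem mapC_embed (F : 𝓢(Phase n × Phase n, ℂ)) :
    mapC n (embed (phaseMeasure₂ n) F) = embed (phaseMeasure₂ n) (compC n F) := by
  ext G
  obtain ⟨G, rfl⟩ := compC_surjective G
  rw [mapC_apply, embed_compC]

/-- The function `M(f ⊗ h)` for test functions, `(X, Y) ↦ ⟨𝐞_{-X} # f, 𝐞_{X - Y} # h⟩`. -/
noncomputable def IsSmoothing.window (hB : IsSmoothing P) (f h : 𝓢(Phase n, ℂ)) :
    𝓢(Phase n × Phase n, ℂ) :=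
  compC n (expTransform₂ n (hB.kernel h f))

theorem window_apply (hA : IsTracialStarProduct P) (hB : IsSmoothing P) (f h : 𝓢(Phase n, ℂ))
    (X Y : Phase n) :
    hB.window f h (X, Y) = expDist (-X) (sandwich P f (expDist (X - Y)) h) := by
  rw [IsSmoothing.window, compC_apply, expTransform₂_apply, contractRight_kernel hA hB]

/-- On `G = g₁ ⊗ g₂` both sides are `∫ h # ĝ₁ # f # ĝ₂`, up to a cyclic rotation. Hence the
distribution `N(f ⊗ h)` is a Schwartz function. -/
theorem embed_transposeN (hA : IsTracialStarProduct P) (hB : IsSmoothing P)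
    (f h : 𝓢(Phase n, ℂ)) (A : 𝓢(Phase n × Phase n, ℂ) →L[ℂ] 𝓢(Phase n × Phase n, ℂ))
    (hk : ∀ g₁ g₂, A (schwartzTensor g₁ g₂) =
      hB.kernel (symplFourier n g₁) (symplFourier n g₂)) (G : 𝓢(Phase n × Phase n, ℂ)) :
    embed (phaseMeasure₂ n) (schwartzTensor f h) (A G) =
      embed (phaseMeasure₂ n) (expTransform₂ n (hB.kernel h f)) G := by
  refine DFunLike.congr_fun (phase_ext_tensor_functional
    (l := PointwiseConvergenceCLM.precomp ℂ A
      (embed (phaseMeasure₂ n) (schwartzTensor f h)))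
    (l' := embed (phaseMeasure₂ n) (expTransform₂ n (hB.kernel h f))) fun g₁ g₂ => ?_) G
  change embed (phaseMeasure₂ n) (schwartzTensor f h) (A (schwartzTensor g₁ g₂)) =
    embed (phaseMeasure₂ n) _ (schwartzTensor g₁ g₂)
  rw [embed_expTransform₂, hB.embed_kernel, hk, embed_symm, hB.embed_kernel, hA.embed_cyclic,
    hA.embed_cyclic, embed_symm, hA.embed_mul_right, hA.mul_assoc]

theorem modulationWindow_embed (hA : IsTracialStarProduct P) (hB : IsSmoothing P)
    (f h : 𝓢(Phase n, ℂ)) : modulationWindow P h (embed (phaseMeasure n) f) =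
      embed (phaseMeasure₂ n) (hB.window f h) := by
  obtain ⟨A, hk, hA'⟩ := mapN_apply hA hB
  change mapC n (mapN P (distTensor h (embed (phaseMeasure n) f))) = _
  rw [distTensor_embed, IsSmoothing.window, ← mapC_embed]
  congr 1
  ext G
  rw [hA', embed_transposeN hA hB f h A hk]

end Window

/-! ### Parseval's formula for the symplectic Fourier transformation. -/

section Parseval
variable {n : ℕ}

theorem norm_symplRotation (Y : Phase n) : ‖(2 * Real.pi) • symplRotation n Y‖ = ‖Y‖ := by
  have := Real.pi_ne_zero
  rw [EuclideanSpace.norm_eq, EuclideanSpace.norm_eq, Fintype.sum_sum_type, Fintype.sum_sum_type,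
    add_comm]
  congr 2 <;> refine Finset.sum_congr rfl fun i _ => ?_ <;>
    simp [symplRotation] <;> field_simp <;> simp

/-- The map is `(2π)⁻¹` times a linear isometry of a space of dimension `2n`. Its Jacobian cancels
the square of the factor `(2π)⁻ⁿ` in the transformation. -/
theorem integral_comp_symplRotation (f : Phase n → ℂ) :
    ∫ Y, f (symplRotation n Y) = (((2 * Real.pi) ^ (2 * n) : ℝ) : ℂ) * ∫ Y, f Y := by
  have hp : (2 * Real.pi) ≠ 0 := by positivity
  let J : Phase n ≃ₗᵢ[ℝ] Phase n :=
    { ((symplRotation n).toLinearEquiv.trans (LinearEquiv.smulOfNeZero ℝ _ (2 * Real.pi) hp)) with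
      norm_map' := norm_symplRotation }
  have hJ : ∀ Y, symplRotation n Y = (2 * Real.pi)⁻¹ • J Y := fun Y => by
    change _ = (2 * Real.pi)⁻¹ • ((2 * Real.pi) • symplRotation n Y)
    rw [smul_smul, inv_mul_cancel₀ hp, one_smul]
  simp_rw [hJ]
  rw [J.measurePreserving.integral_comp J.toHomeomorph.measurableEmbedding
    (fun V => f ((2 * Real.pi)⁻¹ • V)), Measure.integral_comp_smul, Complex.real_smul]
  congr 2
  rw [finrank_euclideanSpace, Fintype.card_sum, Fintype.card_fin, ← two_mul, inv_pow, inv_inv,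
    abs_of_pos (by positivity)]

theorem integral_fourierTransform_neg_mul (a b : 𝓢(Phase n, ℂ)) :
    ∫ V, 𝓕 a (-V) * 𝓕 b V = ∫ X, a X * b X := by
  have h : ∀ V, 𝓕 a (-V) = (𝓕⁻ a) V := fun V => rfl
  simp_rw [h]
  rw [← integral_fourier_mul_eq]
  simp

theorem integral_expDist_mul (a b : 𝓢(Phase n, ℂ)) :
    ∫ W, expDist W a * expDist (-W) b ∂phaseMeasure n = ∫ X, a X * b X ∂phaseMeasure n := by
  have h1 : ∀ W, expDist W a * expDist (-W) b = ((((2 * Real.pi)⁻¹ ^ n) ^ 2 : ℝ) : ℂ) *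
      ((fun V => 𝓕 a (-V) * 𝓕 b V) (symplRotation n W)) := fun W => by
    have e1 : expDist W a = (((2 * Real.pi)⁻¹ ^ n : ℝ) : ℂ) * 𝓕 a (symplRotation n (-W)) := rfl
    have e2 : expDist (-W) b =
      (((2 * Real.pi)⁻¹ ^ n : ℝ) : ℂ) * 𝓕 b (symplRotation n (- -W)) := rfl
    rw [e1, e2, neg_neg, map_neg]
    push_cast
    ring
  simp_rw [h1, integral_const_mul]
  rw [phaseMeasure, integral_smul_measure, integral_smul_measure,
    integral_comp_symplRotation fun V => 𝓕 a (-V) * 𝓕 b V,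
    integral_fourierTransform_neg_mul, Complex.real_smul, Complex.real_smul, mul_left_comm,
    ← mul_assoc _ _ (∫ X, a X * b X), ← Complex.ofReal_mul, ← pow_mul, mul_comm n 2, ← mul_pow,
    inv_mul_cancel₀ (by positivity), one_pow, Complex.ofReal_one, one_mul]

end Parseval

/-! ### The product formula for modulations of test functions. -/

section Homomorphism
variable {n : ℕ} {P : SchwartzProduct (Phase n)}

theorem mul_sandwich_mul (hA : IsTracialStarProduct P) (hB : IsSmoothing P)
    (f g h h' : 𝓢(Phase n, ℂ)) (T : 𝓢'(Phase n, ℂ)) :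
    P.mul (P.mul f (sandwich P g T h')) h = sandwich P (P.mul f g) T (P.mul h' h) := by
  refine embed_phase_injective ?_
  ext ψ
  rw [hA.embed_cyclic, hB.embed_sandwich, hB.embed_sandwich]
  simp only [hA.mul_assoc]

/-- With `W = X - Z` and the exchange rule, the integrand of `⋄` is `⟨𝐞_W, h # 𝐞_{-X} # f⟩ ⟨𝐞_{-W},
g # 𝐞_{X-Y} # h'⟩`. Parseval's formula in `W` turns the integral into `⟨𝐞_{-X}, f # g # 𝐞_{X-Y} # h'
# h⟩`; the windows are multiplied in reverse order. -/
theorem diamond_window (hA : IsTracialStarProduct P) (hB : IsSmoothing P)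
    (f g h h' : 𝓢(Phase n, ℂ)) :
    (diamond n).mul (hB.window f h) (hB.window g h') =
      hB.window (P.mul f g) (P.mul h' h) := by
  ext ⟨X, Y⟩
  rw [diamond_apply, window_apply hA hB, ← mul_sandwich_mul hA hB, ← hB.embed_sandwich,
    embed_symm, embed_apply, ← integral_expDist_mul,
    ← integral_sub_left_eq_self _ (phaseMeasure n) X]
  congr 1; ext Z
  rw [window_apply hA hB, window_apply hA hB, apply_sandwich hA hB f h, neg_sub, sub_sub_sub_cancel_right,
    sub_sub_cancel, sub_sub_cancel_left]

end Homomorphism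

/-! ### The crossed product as a tracial algebra. -/

section Diamond
variable {n : ℕ}

theorem integrable_diagonal (H : 𝓢(Phase n × Phase n, ℂ)) (X Y : Phase n) :
    Integrable (fun Z => H (X - Z, Y - Z)) (phaseMeasure n) := by
  have h := (integrable_partial (phaseMeasure n) (reflect n H) (X - Y)).comp_sub_right Y
  refine h.congr (.of_forall fun Z => ?_)
  simp only [reflect_apply]
  congr 2 <;> abel

theorem diamond_assoc (F G H : 𝓢(Phase n × Phase n, ℂ)) :
    (diamond n).mul ((diamond n).mul F G) H = (diamond n).mul F ((diamond n).mul G H) := by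
  ext ⟨X, Y⟩
  simp_rw [diamond_apply, ← integral_mul_const, ← integral_const_mul]
  rw [integral_integral_swap]
  · congr 1; ext W
    rw [← integral_add_right_eq_self _ W]
    congr 1; ext Z
    simp only [add_sub_cancel_right, sub_add_eq_sub_sub_swap, mul_assoc]
  · obtain ⟨C, hC⟩ : ∃ C, ∀ p, ‖G p‖ ≤ C := ⟨_, fun p => G.norm_le_seminorm ℂ p⟩
    -- For Fubini's theorem the middle factor `G` only needs to be bounded; `F` and `H` supply
    -- integrability in separate variables.
    have h1 := ((integrable_diagonal H X Y).mul_prod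
      (integrable_partial (phaseMeasure n) F X)).norm.mul_const C
    refine h1.mono' ?_ (.of_forall fun p => ?_)
    · refine Continuous.aestronglyMeasurable ?_
      have hF := F.continuous
      have hG := G.continuous
      have hH := H.continuous
      simp only [Function.uncurry_def]
      fun_prop
    · simp only [Function.uncurry, norm_mul]
      calc _ = ‖H (X - p.1, Y - p.1)‖ * ‖F (X, p.2)‖ * ‖G (X - p.2, p.1 - p.2)‖ := by ring
        _ ≤ _ := by gcongr; exact hC _

/-- The duality that goes with the crossed product. -/
theorem embed_reflect_apply (F G : 𝓢(Phase n × Phase n, ℂ)) :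
    embed (phaseMeasure₂ n) F (reflect n G) =
      ∫ X, (diamond n).mul F G (X, 0) ∂phaseMeasure n := by
  rw [embed_phase₂_apply]
  congr 1; ext X
  rw [diamond_apply]
  congr 1; ext Y
  rw [reflect_apply, zero_sub, mul_comm]

theorem integral_reflect (G : 𝓢(Phase n × Phase n, ℂ)) :
    ∫ p, reflect n G p ∂phaseMeasure₂ n = ∫ p, G p ∂phaseMeasure₂ n := by
  rw [integral_phase₂]
  simp_rw [reflect_apply]
  rw [integral_integral_swap (f := fun X Y => G (X - Y, -Y)) (reflect n G).integrable]
  simp_rw [fun Y => integral_sub_right_eq_self (fun X => G (X, -Y)) Y (μ := phaseMeasure n)]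
  rw [integral_neg_eq_self (fun Y => ∫ X, G (X, Y) ∂phaseMeasure n), integral_phase₂]
  exact integral_integral_swap (f := fun Y X => G (X, Y)) G.integrable.swap

/-- The reflection is an involution that preserves the measure. Symmetry of the pairing is the trace
property of `⋄`. -/
theorem embed_reflect_symm (F G : 𝓢(Phase n × Phase n, ℂ)) :
    embed (phaseMeasure₂ n) F (reflect n G) = embed (phaseMeasure₂ n) G (reflect n F) := by
  obtain ⟨H, hH⟩ := exists_mul (reflect n G) F
  have h1 : ∀ p, reflect n H p = reflect n F p * G p := fun ⟨X, Y⟩ => by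
    rw [reflect_apply, hH, reflect_apply, reflect_apply, mul_comm]
    simp
  rw [embed_apply, embed_apply]
  simp_rw [← hH, ← h1]
  exact (integral_reflect H).symm

/-- The pairing is the trace `∫ (F ⋄ G)(X, 0) dX` of the product, so associativity moves the factor
across. -/
theorem embed_diamond_left (F G H : 𝓢(Phase n × Phase n, ℂ)) :
    embed (phaseMeasure₂ n) ((diamond n).mul F G) (reflect n H) =
      embed (phaseMeasure₂ n) F (reflect n ((diamond n).mul G H)) := by
  rw [embed_reflect_apply, embed_reflect_apply, diamond_assoc]

theorem embed_diamond_right (F G H : 𝓢(Phase n × Phase n, ℂ)) :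
    embed (phaseMeasure₂ n) ((diamond n).mul F G) (reflect n H) =
      embed (phaseMeasure₂ n) G (reflect n ((diamond n).mul H F)) := by
  rw [embed_reflect_symm, embed_diamond_left _ _ _ |>.symm, embed_reflect_symm]

theorem diamond_distMul_embed (F G : 𝓢(Phase n × Phase n, ℂ)) :
    (diamond n).distMul (reflect n) G (embed (phaseMeasure₂ n) F) =
      embed (phaseMeasure₂ n) ((diamond n).mul F G) := by
  ext H
  rw [← reflect_reflect H, SchwartzProduct.distMul_apply _ _ reflect_reflect, embed_diamond_left]

theorem diamond_mulDist_embed (F G : 𝓢(Phase n × Phase n, ℂ)) :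
    (diamond n).mulDist (reflect n) F (embed (phaseMeasure₂ n) G) =
      embed (phaseMeasure₂ n) ((diamond n).mul F G) := by
  ext H
  rw [← reflect_reflect H, SchwartzProduct.mulDist_apply _ _ reflect_reflect, embed_diamond_right]

end Diamond

/-! ### Consistency of `#` on test functions with its extension by duality. -/

section Sharp
variable {n : ℕ} {P : SchwartzProduct (Phase n)}

theorem sharp_distMul_embed (hA : IsTracialStarProduct P) (f g : 𝓢(Phase n, ℂ)) :
    P.distMul (.id ℂ _) g (embed (phaseMeasure n) f) = embed (phaseMeasure n) (P.mul f g) := by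
  ext h
  rw [distMul_id_apply, hA.embed_mul_left]

theorem sharp_mulDist_embed (hA : IsTracialStarProduct P) (f g : 𝓢(Phase n, ℂ)) :
    P.mulDist (.id ℂ _) f (embed (phaseMeasure n) g) = embed (phaseMeasure n) (P.mul f g) := by
  ext h
  rw [mulDist_id_apply, hA.embed_mul_right]

end Sharp

/-! ### Intertwining, orthogonality and inversion of the modulation mapping. -/

section Intertwining
variable {n : ℕ} {P : SchwartzProduct (Phase n)}

/-- Both sides are weakly continuous in `T`, and for test functions the equality is the product
formula. With `h' = h` idempotent the window is preserved. -/
theorem modulationWindow_distMul (hA : IsTracialStarProduct P) (hB : IsSmoothing P)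
    (g h h' : 𝓢(Phase n, ℂ)) (T : 𝓢'(Phase n, ℂ)) :
    (diamond n).distMul (reflect n) (hB.window g h') (modulationWindow P h T) =
      modulationWindow P (P.mul h' h) (P.distMul (.id ℂ _) g T) := by
  refine DFunLike.congr_fun (phase_ext_dual
    (A := ((diamond n).distMul (reflect n) (hB.window g h')).comp (modulationWindow P h))
    (A' := (modulationWindow P (P.mul h' h)).comp (P.distMul (.id ℂ _) g)) fun f => ?_) T
  change (diamond n).distMul (reflect n) (hB.window g h') (modulationWindow P h _) =
    modulationWindow P (P.mul h' h) (P.distMul (.id ℂ _) g _)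
  rw [sharp_distMul_embed hA, modulationWindow_embed hA hB, modulationWindow_embed hA hB,
    diamond_distMul_embed, diamond_window hA hB]

theorem modulationWindow_mulDist (hA : IsTracialStarProduct P) (hB : IsSmoothing P)
    (g h h' : 𝓢(Phase n, ℂ)) (T : 𝓢'(Phase n, ℂ)) :
    (diamond n).mulDist (reflect n) (hB.window g h') (modulationWindow P h T) =
      modulationWindow P (P.mul h h') (P.mulDist (.id ℂ _) g T) := by
  refine DFunLike.congr_fun (phase_ext_dual
    (A := ((diamond n).mulDist (reflect n) (hB.window g h')).comp (modulationWindow P h))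
    (A' := (modulationWindow P (P.mul h h')).comp (P.mulDist (.id ℂ _) g)) fun f => ?_) T
  change (diamond n).mulDist (reflect n) (hB.window g h') (modulationWindow P h _) =
    modulationWindow P (P.mul h h') (P.mulDist (.id ℂ _) g _)
  rw [sharp_mulDist_embed hA, modulationWindow_embed hA hB, modulationWindow_embed hA hB,
    diamond_mulDist_embed, diamond_window hA hB]

/-- The transpose of the modulation mapping with window `h`. -/
theorem exists_modulation_transpose (hA : IsTracialStarProduct P) (hB : IsSmoothing P)
    (h : 𝓢(Phase n, ℂ)) (G : 𝓢(Phase n × Phase n, ℂ)) :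
    ∃ k : 𝓢(Phase n, ℂ), (∀ T, modulationWindow P h T (reflect n G) = T k) ∧
      ∀ f, embed (phaseMeasure n) f k =
        embed (phaseMeasure₂ n) (hB.window f h) (reflect n G) := by
  obtain ⟨k, hk⟩ := exists_eq_eval ((PointwiseConvergenceCLM.evalCLM (.id ℂ) ℂ
    (reflect n G)).comp (modulationWindow P h))
  refine ⟨k, hk, fun f => ?_⟩
  rw [← modulationWindow_embed hA hB]
  exact (hk _).symm

/-- By the product formula the trace of the product is the integral over `X` of `⟨Θ_X(f # f'), h' #
h⟩`, which condition (C) evaluates. -/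
theorem embed_window_window (hA : IsTracialStarProduct P) (hB : IsSmoothing P)
    (hC : HasOrthogonality P) (f h f' h' : 𝓢(Phase n, ℂ)) :
    embed (phaseMeasure₂ n) (hB.window f h) (reflect n (hB.window f' h')) =
      embed (phaseMeasure n) f f' * embed (phaseMeasure n) h h' := by
  rw [embed_reflect_apply, diamond_window hA hB]
  simp_rw [window_apply hA hB, sub_zero]
  refine (hC _ _).trans ?_
  rw [hA.integral_mul, hA.integral_mul, embed_symm, embed_apply, embed_apply]

theorem modulationWindow_apply_window (hA : IsTracialStarProduct P) (hB : IsSmoothing P)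
    (hC : HasOrthogonality P) (h f' h' : 𝓢(Phase n, ℂ)) (T : 𝓢'(Phase n, ℂ)) :
    modulationWindow P h T (reflect n (hB.window f' h')) =
      T f' * embed (phaseMeasure n) h h' := by
  obtain ⟨k, hk, hk'⟩ := exists_modulation_transpose hA hB h (hB.window f' h')
  have : k = embed (phaseMeasure n) h h' • f' := by
    refine embed_phase_injective ?_
    ext f
    rw [embed_symm, hk', embed_window_window hA hB hC, embed_symm _ _ f, map_smul, smul_eq_mul,
      mul_comm]
  rw [hk, this, map_smul, smul_eq_mul, mul_comm]

/-- A distribution whose modulation is a test function is a test function. -/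
theorem exists_embed_of_modulationWindow (hA : IsTracialStarProduct P) (hB : IsSmoothing P)
    (hC : HasOrthogonality P) {h : 𝓢(Phase n, ℂ)} (h0 : h ≠ 0) {T : 𝓢'(Phase n, ℂ)}
    {Φ : 𝓢(Phase n × Phase n, ℂ)}
    (hT : embed (phaseMeasure₂ n) Φ = modulationWindow P h T) :
    ∃ k, embed (phaseMeasure n) k = T := by
  -- The transpose of `M_{h'}`, divided by `⟨h, h'⟩`, recovers `T` from `M_h(T)`. Applied to a test
  -- function it gives a test function.
  obtain ⟨h', hh'⟩ : ∃ h', embed (phaseMeasure n) h h' ≠ 0 := by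
    by_contra! hc
    refine h0 (embed_phase_injective ?_)
    ext f
    rw [hc, map_zero]
    rfl
  obtain ⟨k, -, hk⟩ := exists_modulation_transpose hA hB h' Φ
  refine ⟨(embed (phaseMeasure n) h h')⁻¹ • k, ?_⟩
  ext f
  rw [embed_symm, map_smul, hk, embed_reflect_symm, hT, modulationWindow_apply_window hA hB hC,
    smul_eq_mul, mul_comm, mul_assoc, mul_inv_cancel₀ hh', mul_one]

end Intertwining

/-! ### Products in an abstract Moyal algebra. -/

section Moyal
variable {E : Type} [NormedAddCommGroup E] [NormedSpace ℝ E]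
  [MeasurableSpace E] [BorelSpace E] [SecondCountableTopology E]

/-- Linear maps into the Schwartz space that are continuous for the duality given by `μ` are
continuous. -/
def HasAutomaticContinuity (μ : Measure E) [μ.HasTemperateGrowth] : Prop :=
  ∀ Λ : 𝓢(E, ℂ) →ₗ[ℂ] 𝓢(E, ℂ), (∀ f, Continuous fun g => embed μ f (Λ g)) → Continuous Λ

variable {P : SchwartzProduct E} {τ : 𝓢(E, ℂ) →L[ℂ] 𝓢(E, ℂ)} {μ : Measure E}
  [μ.HasTemperateGrowth]

/-- The product exists as a tempered distribution because `h ↦ T · h` is continuous on `𝓢`: it is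
weakly continuous by duality, and automatic continuity upgrades this. -/
theorem moyalMul_apply (hτ : ∀ h, τ (τ h) = h) (hμ : Function.Injective (embed μ))
    (hc : HasAutomaticContinuity μ) {T : 𝓢'(E, ℂ)} (hT : T ∈ P.moyal τ μ) (S : 𝓢'(E, ℂ))
    {h k : 𝓢(E, ℂ)} (hk : embed μ k = P.distMul τ h T) :
    P.moyalMul τ μ S T (τ h) = S (τ k) := by
  choose Λ hΛ using fun g => (hT g).1
  have hΛ' : ∀ g φ, embed μ (Λ g) φ = T (τ (P.mul g (τ φ))) := fun g φ => by
    rw [hΛ]; rfl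
  let L : 𝓢(E, ℂ) →ₗ[ℂ] 𝓢(E, ℂ) :=
    { toFun := Λ
      map_add' := fun g g' => hμ <| by
        ext φ
        rw [hΛ', map_add, map_add, LinearMap.add_apply, map_add, map_add, ← hΛ', ← hΛ']
        rfl
      map_smul' := fun c g => hμ <| by
        ext φ
        rw [hΛ', map_smul, map_smul, LinearMap.smul_apply, map_smul, map_smul, ← hΛ']
        rfl }
  have hL : Continuous L := hc L fun f => by
    simp_rw [embed_symm μ f]
    change Continuous fun g => embed μ (Λ g) f
    simp_rw [hΛ']
    exact T.continuous.comp (τ.continuous.comp (P.continuous_mul_right (τ f)))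
  let U : 𝓢'(E, ℂ) := PointwiseConvergenceCLM.precomp ℂ (τ ∘L ⟨L, hL⟩ ∘L τ) S
  have hU : ∃ U : 𝓢'(E, ℂ), ∀ h k, embed μ k = P.distMul τ h T → U (τ h) = S (τ k) := by
    refine ⟨U, fun h k hk => ?_⟩
    change S (τ (Λ (τ (τ h)))) = S (τ k)
    rw [hτ, hμ (hk.trans (hΛ h).symm)]
  exact Classical.epsilon_spec hU h k hk

theorem moyalMul_add_left (hτ : ∀ h, τ (τ h) = h) (hμ : Function.Injective (embed μ))
    (hc : HasAutomaticContinuity μ) {T : 𝓢'(E, ℂ)} (hT : T ∈ P.moyal τ μ) (S S' : 𝓢'(E, ℂ)) :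
    P.moyalMul τ μ (S + S') T = P.moyalMul τ μ S T + P.moyalMul τ μ S' T := by
  ext h
  obtain ⟨k, hk⟩ := (hT (τ h)).1
  have e : ∀ S, P.moyalMul τ μ S T h = S (τ k) := fun S => by
    rw [← moyalMul_apply hτ hμ hc hT S hk, hτ]
  rw [e]
  change S (τ k) + S' (τ k) = P.moyalMul τ μ S T h + P.moyalMul τ μ S' T h
  rw [e, e]

theorem moyalMul_sub_left (hτ : ∀ h, τ (τ h) = h) (hμ : Function.Injective (embed μ))
    (hc : HasAutomaticContinuity μ) {T : 𝓢'(E, ℂ)} (hT : T ∈ P.moyal τ μ) (S S' : 𝓢'(E, ℂ)) :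
    P.moyalMul τ μ (S - S') T = P.moyalMul τ μ S T - P.moyalMul τ μ S' T := by
  rw [eq_sub_iff_add_eq, ← moyalMul_add_left hτ hμ hc hT, sub_add_cancel]

theorem moyalMul_add_right (hτ : ∀ h, τ (τ h) = h) (hμ : Function.Injective (embed μ))
    (hc : HasAutomaticContinuity μ) {T T' : 𝓢'(E, ℂ)} (hT : T ∈ P.moyal τ μ)
    (hT' : T' ∈ P.moyal τ μ) (S : 𝓢'(E, ℂ)) :
    P.moyalMul τ μ S (T + T') = P.moyalMul τ μ S T + P.moyalMul τ μ S T' := by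
  ext h
  obtain ⟨k, hk⟩ := (hT (τ h)).1
  obtain ⟨k', hk'⟩ := (hT' (τ h)).1
  have hkk : embed μ (k + k') = P.distMul τ (τ h) (T + T') := by rw [map_add, map_add, hk, hk']
  change _ = P.moyalMul τ μ S T h + P.moyalMul τ μ S T' h
  have e := moyalMul_apply hτ hμ hc (add_mem hT hT') S hkk
  rw [map_add, map_add, ← moyalMul_apply hτ hμ hc hT S hk,
    ← moyalMul_apply hτ hμ hc hT' S hk', hτ] at e
  exact e

theorem moyalMul_sub_right (hτ : ∀ h, τ (τ h) = h) (hμ : Function.Injective (embed μ))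
    (hc : HasAutomaticContinuity μ) {T T' : 𝓢'(E, ℂ)} (hT : T ∈ P.moyal τ μ)
    (hT' : T' ∈ P.moyal τ μ) (S : 𝓢'(E, ℂ)) :
    P.moyalMul τ μ S (T - T') = P.moyalMul τ μ S T - P.moyalMul τ μ S T' := by
  rw [eq_sub_iff_add_eq, ← moyalMul_add_right hτ hμ hc (sub_mem hT hT') hT', sub_add_cancel]

end Moyal

/-! ### Induced algebras and inverse-closedness. -/

section PhaseMoyal
variable {n : ℕ} {P : SchwartzProduct (Phase n)}

theorem phase_automaticContinuity : HasAutomaticContinuity (phaseMeasure n) := by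
  obtain ⟨a, b, h, -, -⟩ := exists_phase_frame n
  exact h.continuous_of_weakly_continuous

theorem phase₂_automaticContinuity : HasAutomaticContinuity (phaseMeasure₂ n) := by
  obtain ⟨a, b, -, -, h⟩ := exists_phase_frame n
  exact h.continuous_of_weakly_continuous

theorem sharpMul_apply {T : 𝓢'(Phase n, ℂ)} (hT : T ∈ moyalSharp P) (S : 𝓢'(Phase n, ℂ))
    {h k : 𝓢(Phase n, ℂ)} (hk : embed (phaseMeasure n) k = P.distMul (.id ℂ _) h T) :
    sharpMul P S T h = S k :=
  moyalMul_apply (τ := .id ℂ _) (fun _ => rfl) embed_phase_injective phase_automaticContinuity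
    hT S hk

theorem diamondMul_apply {T : 𝓢'(Phase n × Phase n, ℂ)} (hT : T ∈ moyalDiamond n)
    (S : 𝓢'(Phase n × Phase n, ℂ)) {h k : 𝓢(Phase n × Phase n, ℂ)}
    (hk : embed (phaseMeasure₂ n) k = (diamond n).distMul (reflect n) h T) :
    diamondMul n S T (reflect n h) = S (reflect n k) :=
  moyalMul_apply reflect_reflect embed_phase₂_injective phase₂_automaticContinuity hT S hk

theorem sharpMul_assoc (hA : IsTracialStarProduct P) {T U : 𝓢'(Phase n, ℂ)}
    (hT : T ∈ moyalSharp P) (hU : U ∈ moyalSharp P) (hTU : sharpMul P T U ∈ moyalSharp P)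
    (S : 𝓢'(Phase n, ℂ)) :
    sharpMul P (sharpMul P S T) U = sharpMul P S (sharpMul P T U) := by
  ext k
  obtain ⟨u, hu⟩ := (hU k).1
  obtain ⟨t, ht⟩ := (hT u).1
  have h1 : embed (phaseMeasure n) t = P.distMul (.id ℂ _) k (sharpMul P T U) := by
    ext φ
    have hw : embed (phaseMeasure n) (P.mul u φ) = P.distMul (.id ℂ _) (P.mul k φ) U := by
      ext ψ
      rw [hA.embed_mul_left, hu, distMul_id_apply, distMul_id_apply, hA.mul_assoc]
    rw [ht, distMul_id_apply, distMul_id_apply, sharpMul_apply hU T hw]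
  rw [sharpMul_apply hU _ hu, sharpMul_apply hT _ ht, sharpMul_apply hTU _ h1]

/-- After transposition the claim is that `M_hᵗ(M_h(T) ⋄ G) = T # M_hᵗ(G)`, which does not involve
`S`. Tested against `f` it becomes the intertwining relation `M_h(f) ⋄ M_h(T) = M_h(f # T)`, where
`h # h = h` enters. -/
theorem modulationWindow_sharpMul (hA : IsTracialStarProduct P) (hB : IsSmoothing P)
    {h : 𝓢(Phase n, ℂ)} (hh : P.mul h h = h) {T : 𝓢'(Phase n, ℂ)} (hT : T ∈ moyalSharp P)
    (hMT : modulationWindow P h T ∈ moyalDiamond n) (S : 𝓢'(Phase n, ℂ)) :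
    modulationWindow P h (sharpMul P S T) =
      diamondMul n (modulationWindow P h S) (modulationWindow P h T) := by
  ext G
  obtain ⟨G, rfl⟩ : ∃ G', reflect n G' = G := ⟨_, reflect_reflect G⟩
  obtain ⟨V, hV⟩ := (hMT G).1
  obtain ⟨k₀, hk₀, hk₀'⟩ := exists_modulation_transpose hA hB h G
  obtain ⟨k₁, hk₁, hk₁'⟩ := exists_modulation_transpose hA hB h V
  obtain ⟨l, hl⟩ := (hT k₀).1
  -- Here `k₀ = M_hᵗ(G)`, `l = T # k₀`, `V = M_h(T) ⋄ G` and `k₁ = M_hᵗ(V)`, with transposes for the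
  -- pairing `⟪·, ·⟫'`.
  have e : k₁ = l := by
    refine embed_phase_injective ?_
    ext f
    obtain ⟨r, hr⟩ := (hT f).2
    have h1 := modulationWindow_mulDist hA hB f h h T
    rw [hh, ← hr, modulationWindow_embed hA hB] at h1
    rw [embed_symm, hk₁', embed_reflect_symm, hV,
      SchwartzProduct.distMul_apply _ _ reflect_reflect,
      ← SchwartzProduct.mulDist_apply _ _ reflect_reflect, h1, ← hk₀', hr, hl]
    rfl
  rw [hk₀, diamondMul_apply hMT _ hV, hk₁, sharpMul_apply hT _ hl, e]

/-- `M_h(T # g) = M_h(T) ⋄ M_h(g)` is a test function because `M_h(T)` lies in the Moyal algebra of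
`⋄`, so `T # g` is a test function by inversion; likewise on the left. -/
theorem induced_le_moyalSharp (hA : IsTracialStarProduct P) (hB : IsSmoothing P)
    (hC : HasOrthogonality P) {h : 𝓢(Phase n, ℂ)} (h0 : h ≠ 0) (hh : P.mul h h = h)
    {L : Submodule ℂ 𝓢'(Phase n × Phase n, ℂ)} (hL : L ≤ moyalDiamond n) :
    induced P h L ≤ moyalSharp P := by
  intro T hT g
  obtain ⟨⟨F, hF⟩, ⟨G, hG⟩⟩ := hL hT (hB.window g h)
  have h1 := modulationWindow_distMul hA hB g h h T
  have h2 := modulationWindow_mulDist hA hB g h h T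
  rw [hh] at h1 h2
  exact ⟨exists_embed_of_modulationWindow hA hB hC h0 (hF.trans h1),
    exists_embed_of_modulationWindow hA hB hC h0 (hG.trans h2)⟩

theorem isSubalgebraOf_induced (hA : IsTracialStarProduct P) (hB : IsSmoothing P)
    (hC : HasOrthogonality P) {h : 𝓢(Phase n, ℂ)} (h0 : h ≠ 0) (hh : P.mul h h = h)
    {L : Submodule ℂ 𝓢'(Phase n × Phase n, ℂ)}
    (hL : IsSubalgebraOf (diamondMul n) (moyalDiamond n) L) :
    IsSubalgebraOf (sharpMul P) (moyalSharp P) (induced P h L) := by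
  have h1 := induced_le_moyalSharp hA hB hC h0 hh hL.1
  refine ⟨h1, fun F hF G hG => ?_⟩
  change modulationWindow P h (sharpMul P F G) ∈ L
  rw [modulationWindow_sharpMul hA hB hh (h1 hG) (hL.1 hG)]
  exact hL.2 _ hF _ hG

/-- Inverses in a corner extend to the whole algebra: the cross terms `F (u - p)` and `(u - p) G`
vanish and `u - p` is idempotent, so the product is `p + (u - p)`. -/
theorem diamondMul_add_one_sub {L : Submodule ℂ 𝓢'(Phase n × Phase n, ℂ)}
    (hL : IsSubalgebraOf (diamondMul n) (moyalDiamond n) L)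
    {u p F G : 𝓢'(Phase n × Phase n, ℂ)} (hu : IsUnitOf (diamondMul n) L u) (hp : p ∈ L)
    (hF : F ∈ L) (hG : G ∈ L) (hpp : diamondMul n p p = p) (hFp : diamondMul n F p = F)
    (hpG : diamondMul n p G = G) (hFG : diamondMul n F G = p) :
    diamondMul n (F + (u - p)) (G + (u - p)) = u := by
  have hm := fun {F} (hF : F ∈ L) => hL.1 hF
  have hadd : ∀ S S' {T}, T ∈ L →
      diamondMul n (S + S') T = diamondMul n S T + diamondMul n S' T := fun S S' T hT =>
    moyalMul_add_left reflect_reflect embed_phase₂_injective phase₂_automaticContinuity (hm hT) S S'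
  have hsub : ∀ S S' {T}, T ∈ L →
      diamondMul n (S - S') T = diamondMul n S T - diamondMul n S' T := fun S S' T hT =>
    moyalMul_sub_left reflect_reflect embed_phase₂_injective phase₂_automaticContinuity (hm hT) S S'
  have hadd' : ∀ S {T T'}, T ∈ L → T' ∈ L →
      diamondMul n S (T + T') = diamondMul n S T + diamondMul n S T' := fun S T T' hT hT' =>
    moyalMul_add_right reflect_reflect embed_phase₂_injective phase₂_automaticContinuity
      (hm hT) (hm hT') S
  have hsub' : ∀ S {T T'}, T ∈ L → T' ∈ L →
      diamondMul n S (T - T') = diamondMul n S T - diamondMul n S T' := fun S T T' hT hT' =>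
    moyalMul_sub_right reflect_reflect embed_phase₂_injective phase₂_automaticContinuity
      (hm hT) (hm hT') S
  rw [hadd' _ hG (sub_mem hu.1 hp), hadd _ _ hG, hadd _ _ (sub_mem hu.1 hp), hsub _ _ hG,
    hsub _ _ (sub_mem hu.1 hp), hsub' _ hu.1 hp, hsub' _ hu.1 hp, hsub' _ hu.1 hp, hFG, hFp, hpG,
    hpp, (hu.2 F hF).2, (hu.2 G hG).1, (hu.2 u hu.1).1, (hu.2 p hp).1, (hu.2 p hp).2]
  abel

theorem isInverseClosed_induced (hA : IsTracialStarProduct P) (hB : IsSmoothing P)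
    (hC : HasOrthogonality P) {h : 𝓢(Phase n, ℂ)} (h0 : h ≠ 0) (hh : P.mul h h = h)
    {K L : Submodule ℂ 𝓢'(Phase n × Phase n, ℂ)}
    (hL : IsSubalgebraOf (diamondMul n) (moyalDiamond n) L)
    (hKL : IsSpectrallyInvariant (diamondMul n) K L)
    (hKh : IsUnital (sharpMul P) (induced P h K)) :
    IsInverseClosed (sharpMul P) (induced P h K) (induced P h L) := by
  intro e he F hF G hG hFG hGF
  obtain ⟨hKL, ⟨u, huK, hu⟩, hinv⟩ := hKL
  obtain ⟨e', he', hunit⟩ := hKh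
  have hLh := isSubalgebraOf_induced hA hB hC h0 hh hL
  have hF' : F ∈ induced P h L := hKL hF
  have he'L : e' ∈ induced P h L := hKL he'
  -- The two units may differ a priori. An element of `𝔎^M_h` that is invertible in `𝔏^M_h` forces
  -- `e' = e' # (F # G) = (e' # F) # G = e`, which places `M_h(e)` in `𝔎`.
  have hee : e = e' := by
    have h1 := sharpMul_assoc hA (hLh.1 hF') (hLh.1 hG) (hLh.1 (hLh.2 _ hF' _ hG)) e'
    rw [(hunit F hF).1, hFG, (he.2 e' he'L).2] at h1
    exact h1
  have heK : e ∈ induced P h K := hee ▸ he'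
  have hmul : ∀ S, ∀ T ∈ induced P h L, modulationWindow P h (sharpMul P S T) =
      diamondMul n (modulationWindow P h S) (modulationWindow P h T) := fun S T hT =>
    modulationWindow_sharpMul hA hB hh (hLh.1 hT) (hL.1 hT) S
  set M := modulationWindow P h with hM
  have hMF : M F ∈ L := hF'
  have hMG : M G ∈ L := hG
  have hMe : M e ∈ L := he.1
  have hpp : diamondMul n (M e) (M e) = M e := by rw [← hmul _ _ he.1, (he.2 e he.1).1]
  have hup : u - M e ∈ K := sub_mem huK heK
  have h1 := diamondMul_add_one_sub hL hu hMe hMF hMG hpp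
    (by rw [← hmul _ _ he.1, (he.2 F hF').2]) (by rw [← hmul _ _ hG, (he.2 G hG).1])
    (by rw [← hmul _ _ hG, hFG])
  have h2 := diamondMul_add_one_sub hL hu hMe hMG hMF hpp
    (by rw [← hmul _ _ he.1, (he.2 G hG).2]) (by rw [← hmul _ _ hF', (he.2 F hF').1])
    (by rw [← hmul _ _ hF', hGF])
  -- Spectral invariance is used with the true unit `u` of `𝔏`, which is why the complementary
  -- idempotent has to be added.
  have h3 := hinv u hu (M F + (u - M e)) (add_mem hF hup) (M G + (u - M e))
    (add_mem hMG (hKL hup)) h1 h2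
  change M G ∈ K
  have h4 := sub_mem h3 hup
  rwa [add_sub_cancel_right] at h4

end PhaseMoyal
end PhaseSpace

theorem mainTheorem8 (n : ℕ) (P : SchwartzProduct (Phase n))
    (hA : IsTracialStarProduct P) (hB : IsSmoothing P) (hC : HasOrthogonality P)
    (K L : Submodule ℂ 𝓢'(Phase n × Phase n, ℂ))
    (hK : IsSubalgebraOf (diamondMul n) (moyalDiamond n) K)
    (hL : IsSubalgebraOf (diamondMul n) (moyalDiamond n) L)
    (hKL : IsSpectrallyInvariant (diamondMul n) K L)
    (h : 𝓢(Phase n, ℂ)) (hh : P.mul h h = h) (h0 : h ≠ 0)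
    (hKh : IsUnital (sharpMul P) (induced P h K))
    (hLh : IsUnital (sharpMul P) (induced P h L)) :
    IsSubalgebraOf (sharpMul P) (moyalSharp P) (induced P h K) ∧
    IsSubalgebraOf (sharpMul P) (moyalSharp P) (induced P h L) ∧
    induced P h K ≤ induced P h L ∧
    IsInverseClosed (sharpMul P) (induced P h K) (induced P h L) ∧
    ((∃ e ∈ induced P h K, IsUnitOf (sharpMul P) (induced P h L) e) →
      IsSpectrallyInvariant (sharpMul P) (induced P h K) (induced P h L)) := by
  have hKh' := isSubalgebraOf_induced hA hB hC h0 hh hK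
  have hLh' := isSubalgebraOf_induced hA hB hC h0 hh hL
  have hle : induced P h K ≤ induced P h L := Submodule.comap_mono hKL.1
  have hinv := isInverseClosed_induced hA hB hC h0 hh hL hKL hKh
  exact ⟨hKh', hLh', hle, hinv, fun he => ⟨hle, he, hinv⟩⟩
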